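/- Let $K$ be a field and let $A=\bigoplus_{i\in\mathbb Z}A_i$ be a finite-dimensional $\mathbb Z$-graded $K$-algebra with a triangular decomposition $\mathcal T=(A^-,T,A^+)$: $A^-,T,A^+$ are graded subalgebras such that multiplication $A^-\otimes_K T\otimes_K A^+\to A$ is a vector space isomorphism, $T\subseteq A_0$, $A^+$ (resp. $A^-$) lives in degrees $\ge 0$ (resp. $\le 0$), $A^\pm_0=K$, $A^\pm T=TA^\pm$, and $T$ is split (the endomorphisms of each simple $T$-module are the scalars). Assume that $T$ is semisimple and that $A$ is self-injective (injective as a left $A$-module). Notation. $\mathcal G(A)$ is the category of finitely generated $\mathbb Z$-graded left $A$-modules with degree-preserving maps; heads, socles, composition series and projective covers are taken in it. $\operatorname{Irr}\mathcal G(T)$ is the set of isomorphism classes of simple objects of $\mathcal G(T)$; each $\lambda$ is concentrated in one degree $\deg\lambda$, and $\mu<\lambda$ means $\deg\mu<\deg\lambda$. Let $B^+=A^+T$, and let $\Delta(\lambda)=A\otimes_{B^+}\lambda$, where elements of $B^+$ of positive degree act on $\lambda$ by $0$. The opposite algebra $A^{\mathrm{op}}$, with $(A^{\mathrm{op}})_i=A_{-i}$,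 carries the triangular decomposition $((A^+)^{\mathrm{op}},T^{\mathrm{op}},(A^-)^{\mathrm{op}})$. The dual $M^*=\operatorname{Hom}_K(M,K)$, with $(M^*)_i=(M_i)^*$, takes graded modules over an algebra to graded modules over the opposite algebra. Put $\nabla(\lambda)=\Delta(\lambda^*)^*$, with $\Delta(\lambda^*)$ formed over $A^{\mathrm{op}}$. Let $L(\lambda)=\operatorname{Hd}\Delta(\lambda)$ (these represent, without repetition, all simple objects of $\mathcal G(A)$) and let $P(\lambda)$ be the projective cover of $L(\lambda)$. The Nakayama permutation $\nu$ of $\operatorname{Irr}\mathcal G(T)$ is defined by $\operatorname{Soc}P(\lambda)\simeq L(\nu(\lambda))$. An object $M$ has highest weight $\lambda$ if $[M:L(\lambda)]=1$ and $[M:L(\mu)]\ne0$ implies $\mu=\lambda$ or $\mu<\lambda$. A standard (resp. costandard) filtration of $M$ is a finite filtration by graded submodules with all successive quotients of the form $\Delta(\mu)$ (resp. $\nabla(\mu)$). Theorem. Every $P(\lambda)$, $\lambda\in\operatorname{Irr}\mathcal G(T)$, has a (unique) highest weight, denoted $\lambda^h$. Moreover: (a) $\lambda\mapsto\lambda^h$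 is a permutation of $\operatorname{Irr}\mathcal G(T)$. (b) $\operatorname{Soc}\Delta(\lambda)\simeq L(\lambda^\dagger)$, where $\lambda^\dagger:=\nu(\lambda^{h^{-1}})$ is a permutation of $\operatorname{Irr}\mathcal G(T)$. (c) $P(\lambda)$ has a standard filtration, and in every standard filtration of $P(\lambda)$ the bottom factor (the smallest nonzero submodule) is $\Delta(\lambda^h)$. (d) $(\lambda^h)^*=(\nu(\lambda)^*)^h$ in $\operatorname{Irr}\mathcal G(T^{\mathrm{op}})$, where $h$ on the right is the map from $\lambda$ to the highest weight of $P(\lambda)$ for $A^{\mathrm{op}}$, again a permutation. (e) $P(\lambda)$ has a costandard filtration, and in every costandard filtration of $P(\lambda)$ the top factor is $\nabla(\lambda^h)$. (f) $\operatorname{Hd}\nabla(\lambda)\simeq L(\nu^{-1}(\lambda^\dagger))=L(\lambda^{h^{-1}})$. -/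

import Mathlib

open scoped TensorProduct DirectSum

universe u

/-! ## Graded modules of finite dimension -/

/-- An object of the category `𝒢(A)` of finitely generated `ℤ`-graded left modules over a
finite-dimensional graded `K`-algebra `(A, 𝒜)`. As `A` is finite-dimensional, finitely generated
means finite-dimensional over `K`. -/
structure GrMod {K A : Type u} [Field K] [Ring A] [Algebra K A] (𝒜 : ℤ → Submodule K A) :
    Type (u + 1) where
  carrier : Type u
  [grp : AddCommGroup carrier]
  [modK : Module K carrier]
  [modA : Module A carrier]
  [tower : IsScalarTower K A carrier]
  [fin : Module.Finite K carrier]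
  /-- the homogeneous components -/
  gr : ℤ → Submodule K carrier
  internal : DirectSum.IsInternal gr
  smul_mem : ∀ (i j : ℤ) (a : A) (x : carrier), a ∈ 𝒜 i → x ∈ gr j → a • x ∈ gr (i + j)

namespace GrMod

instance {K A : Type u} [Field K] [Ring A] [Algebra K A] {𝒜 : ℤ → Submodule K A} :
    CoeSort (GrMod 𝒜) (Type u) := ⟨GrMod.carrier⟩

attribute [instance] GrMod.grp GrMod.modK GrMod.modA GrMod.tower GrMod.fin

section Internal

variable {K V : Type u} [Field K] [AddCommGroup V] [Module K V]

theorem isInternal_of_proj (gr : ℤ → Submodule K V) (p : ℤ → V →ₗ[K] V)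
    (hself : ∀ i, ∀ x ∈ gr i, p i x = x) (hne : ∀ i j, j ≠ i → ∀ x ∈ gr j, p i x = 0)
    (htop : ⨆ i, gr i = ⊤) : DirectSum.IsInternal gr := by
  rw [DirectSum.isInternal_submodule_iff_iSupIndep_and_iSup_eq_top]
  refine ⟨?_, htop⟩
  intro i
  rw [Submodule.disjoint_def]
  intro x hx hx'
  have hle : (⨆ j, ⨆ (_ : j ≠ i), gr j) ≤ LinearMap.ker (p i) :=
    iSup_le fun j => iSup_le fun hj y hy => hne i j hj y hy
  rw [← hself i x hx]
  exact hle hx'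

end Internal

section Basic

variable {K A : Type u} [Field K] [Ring A] [Algebra K A] {𝒜 : ℤ → Submodule K A}

/-- A graded module is the direct sum of its homogeneous components. -/
noncomputable def sumEquiv (M : GrMod 𝒜) : (⨁ i, M.gr i) ≃ₗ[K] M :=
  LinearEquiv.ofBijective (DirectSum.coeLinearMap M.gr) M.internal

/-- The projection of a graded module onto its homogeneous component of degree `i`. -/
noncomputable def proj (M : GrMod 𝒜) (i : ℤ) : M →ₗ[K] M :=
  (M.gr i).subtype ∘ₗ DirectSum.component K ℤ (fun j => M.gr j) i ∘ₗ
    M.sumEquiv.symm.toLinearMap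

theorem proj_mem (M : GrMod 𝒜) (i : ℤ) (x : M) : M.proj i x ∈ M.gr i :=
  Subtype.prop _

theorem symm_of_mem (M : GrMod 𝒜) (i : ℤ) (x : M) (hx : x ∈ M.gr i) :
    M.sumEquiv.symm x = DirectSum.lof K ℤ (fun j => M.gr j) i ⟨x, hx⟩ := by
  rw [LinearEquiv.symm_apply_eq]
  exact (DirectSum.coeLinearMap_lof M.gr i ⟨x, hx⟩).symm

theorem proj_self (M : GrMod 𝒜) (i : ℤ) (x : M) (hx : x ∈ M.gr i) : M.proj i x = x := by
  simp [proj, symm_of_mem M i x hx, DirectSum.component.lof_self]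

theorem proj_ne (M : GrMod 𝒜) (i j : ℤ) (hij : j ≠ i) (x : M) (hx : x ∈ M.gr j) :
    M.proj i x = 0 := by
  simp [proj, symm_of_mem M j x hx, DirectSum.component.of, hij]

theorem iSup_gr (M : GrMod 𝒜) : ⨆ i, M.gr i = ⊤ := M.internal.submodule_iSup_eq_top

theorem proj_ext (M : GrMod 𝒜) {W : Type u} [AddCommGroup W] [Module K W] (f g : M →ₗ[K] W)
    (h : ∀ i, ∀ x ∈ M.gr i, f x = g x) : f = g := by
  have : (⊤ : Submodule K M) ≤ LinearMap.eqLocus f g := by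
    rw [← M.iSup_gr]
    exact iSup_le fun i x hx => h i x hx
  ext x
  exact this (Submodule.mem_top : x ∈ ⊤)

theorem exists_finset (M : GrMod 𝒜) :
    ∃ s : Finset ℤ, ∀ x : M, x = ∑ i ∈ s, M.proj i x := by
  have hfin : {i | M.gr i ≠ ⊥}.Finite :=
    WellFoundedGT.finite_ne_bot_of_iSupIndep M.internal.submodule_iSupIndep
  refine ⟨hfin.toFinset, ?_⟩
  have : (LinearMap.id : M →ₗ[K] M) = ∑ i ∈ hfin.toFinset, M.proj i := by
    apply proj_ext
    intro i x hx
    rw [LinearMap.sum_apply]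
    by_cases hi : M.gr i = ⊥
    · have : x = 0 := by simpa [hi] using hx
      simp [this]
    · rw [Finset.sum_eq_single i]
      · simp [proj_self M i x hx]
      · intro j _ hj
        exact M.proj_ne j i hj.symm x hx
      · intro h
        simp [hi] at h
  intro x
  simpa using LinearMap.congr_fun this x

theorem proj_smul (M : GrMod 𝒜) (i n : ℤ) (a : A) (ha : a ∈ 𝒜 i) (x : M) :
    M.proj n (a • x) = a • M.proj (n - i) x := by
  have : M.proj n ∘ₗ Algebra.lsmul K K M a = Algebra.lsmul K K M a ∘ₗ M.proj (n - i) := by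
    apply proj_ext
    intro j y hy
    simp only [LinearMap.comp_apply, Algebra.lsmul_coe]
    have hm := M.smul_mem i j a y ha hy
    by_cases h : i + j = n
    · subst h
      rw [M.proj_self _ _ hm, show i + j - i = j by ring, M.proj_self _ _ hy]
    · rw [M.proj_ne _ _ h _ hm, M.proj_ne _ j (by omega) _ hy, smul_zero]
  exact LinearMap.congr_fun this x

/-- An `A`-submodule is graded if it contains the homogeneous components of its elements. -/
def IsGraded (M : GrMod 𝒜) (N : Submodule A M) : Prop :=
  ∀ x ∈ N, ∀ i, M.proj i x ∈ N

/-- The subobjects of `M` in `𝒢(A)`: its graded submodules. -/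
abbrev GrSub (M : GrMod 𝒜) : Type u := {N : Submodule A M // M.IsGraded N}

instance (M : GrMod 𝒜) : OrderBot M.GrSub where
  bot := ⟨⊥, fun x hx i => by rw [(Submodule.mem_bot A).1 hx, map_zero]; exact Submodule.zero_mem _⟩
  bot_le N := show (⊥ : Submodule A M) ≤ N.1 from bot_le

instance (M : GrMod 𝒜) : OrderTop M.GrSub where
  top := ⟨⊤, fun _ _ _ => Submodule.mem_top⟩
  le_top N := show N.1 ≤ (⊤ : Submodule A M) from le_top

/-- A graded submodule as an object of `𝒢(A)`. -/
noncomputable def sub (M : GrMod 𝒜) (N : M.GrSub) : GrMod 𝒜 where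
  carrier := N.1
  fin := inferInstanceAs (Module.Finite K (N.1.restrictScalars K))
  gr i := (M.gr i).comap (N.1.subtype.restrictScalars K)
  internal := by
    refine isInternal_of_proj _
      (fun i => ((M.proj i).restrict (p := N.1.restrictScalars K) (q := N.1.restrictScalars K)
        fun x hx => N.2 x hx i)) ?_ ?_ ?_
    · intro i x hx
      exact Subtype.ext (M.proj_self i x.1 hx)
    · intro i j hij x hx
      exact Subtype.ext (M.proj_ne i j hij x.1 hx)
    · rw [eq_top_iff]
      intro x _
      obtain ⟨s, hs⟩ := M.exists_finset
      have hx : x = ∑ i ∈ s, (⟨M.proj i x.1, N.2 x.1 x.2 i⟩ : N.1) := by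
        apply Subtype.ext
        rw [AddSubmonoidClass.coe_finsetSum]
        exact hs x.1
      rw [hx]
      exact Submodule.sum_mem _ fun i _ =>
        Submodule.mem_iSup_of_mem i (M.proj_mem i x.1)
  smul_mem i j a x ha hx := M.smul_mem i j a x.1 ha hx

/-- The quotient by a graded submodule as an object of `𝒢(A)`. -/
noncomputable def quot (M : GrMod 𝒜) (N : M.GrSub) : GrMod 𝒜 where
  carrier := M ⧸ N.1
  gr i := (M.gr i).map (N.1.mkQ.restrictScalars K)
  fin := Module.Finite.of_surjective (N.1.mkQ.restrictScalars K) N.1.mkQ_surjective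
  internal := by
    refine isInternal_of_proj _
      (fun i => (N.1.restrictScalars K).mapQ (N.1.restrictScalars K) (M.proj i)
        fun x hx => N.2 x hx i) ?_ ?_ ?_
    · rintro i _ ⟨x, hx, rfl⟩
      exact congrArg N.1.mkQ (M.proj_self i x hx)
    · rintro i j hij _ ⟨x, hx, rfl⟩
      exact (congrArg N.1.mkQ (M.proj_ne i j hij x hx)).trans (map_zero _)
    · rw [← Submodule.map_iSup, M.iSup_gr, Submodule.map_top, LinearMap.range_eq_top]
      exact N.1.mkQ_surjective
  smul_mem := by
    rintro i j a _ ha ⟨x, hx, rfl⟩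
    exact ⟨a • x, M.smul_mem i j a x ha hx, map_smul N.1.mkQ a x⟩

theorem proj_sub (M : GrMod 𝒜) (N : M.GrSub) (i : ℤ) (x : M.sub N) :
    ((M.sub N).proj i x : N.1).1 = M.proj i x.1 := by
  have : (N.1.subtype.restrictScalars K) ∘ₗ (M.sub N).proj i =
      M.proj i ∘ₗ (N.1.subtype.restrictScalars K) := by
    apply proj_ext (M.sub N)
    intro j y hy
    by_cases h : j = i
    · subst h
      exact (congrArg Subtype.val ((M.sub N).proj_self j y hy)).trans
        (M.proj_self j y.1 hy).symm
    · exact (congrArg Subtype.val ((M.sub N).proj_ne i j h y hy)).trans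
        (M.proj_ne i j h y.1 hy).symm
  exact LinearMap.congr_fun this x

/-- For graded submodules `N' ⊆ N` of `M`, the graded module `N / N'`. -/
noncomputable def factor (M : GrMod 𝒜) (N N' : M.GrSub) : GrMod 𝒜 :=
  (M.sub N).quot ⟨N'.1.comap N.1.subtype, fun x hx i => by
    have := N'.2 x.1 hx i
    rw [← proj_sub M N i x] at this
    exact this⟩

/-- `M ≅ N` in `𝒢(A)`: there is an `A`-linear bijection matching homogeneous components. -/
def Iso (M N : GrMod 𝒜) : Prop :=
  ∃ e : M ≃ₗ[A] N, ∀ (i : ℤ) (x : M), x ∈ M.gr i ↔ e x ∈ N.gr i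

theorem Iso.refl (M : GrMod 𝒜) : M.Iso M := ⟨LinearEquiv.refl A M, fun _ _ => Iff.rfl⟩

theorem Iso.symm {M N : GrMod 𝒜} : M.Iso N → N.Iso M := fun ⟨e, he⟩ =>
  ⟨e.symm, fun i x => by rw [he i (e.symm x), e.apply_symm_apply]⟩

theorem Iso.trans {M N L : GrMod 𝒜} : M.Iso N → N.Iso L → M.Iso L := fun ⟨e, he⟩ ⟨f, hf⟩ =>
  ⟨e.trans f, fun i x => by rw [he i x, hf i (e x), LinearEquiv.trans_apply]⟩

/-- The morphisms of `𝒢(A)`: the `A`-linear maps preserving degrees. -/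
def Hom (M N : GrMod 𝒜) : Type u :=
  {f : M →ₗ[A] N // ∀ (i : ℤ) (x : M), x ∈ M.gr i → f x ∈ N.gr i}

/-- `M` is a simple object of `𝒢(A)`. -/
def IsSimple (M : GrMod 𝒜) : Prop :=
  Nontrivial M ∧ ∀ N : M.GrSub, N = ⊥ ∨ N = ⊤

/-- The socle in `𝒢(A)`: the sum of all simple graded submodules. -/
noncomputable def soc (M : GrMod 𝒜) : M.GrSub :=
  ⟨⨆ N : {N : M.GrSub // (M.sub N).IsSimple}, N.1.1, fun x hx i => by
    refine Submodule.iSup_induction _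
      (motive := fun y => M.proj i y ∈ ⨆ N : {N : M.GrSub // (M.sub N).IsSimple}, N.1.1) hx ?_ ?_ ?_
    · intro N y hy
      exact Submodule.mem_iSup_of_mem N (N.1.2 y hy i)
    · rw [map_zero]
      exact Submodule.zero_mem _
    · intro y z hy hz
      rw [map_add]
      exact Submodule.add_mem _ hy hz⟩

/-- The radical in `𝒢(A)`: the intersection of all maximal graded submodules. -/
noncomputable def rad (M : GrMod 𝒜) : M.GrSub :=
  ⟨⨅ N : {N : M.GrSub // IsCoatom N}, N.1.1, fun x hx i => by
    rw [Submodule.mem_iInf] at hx ⊢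
    exact fun N => N.1.2 x (hx N) i⟩

/-- The head `Hd M = M / Rad M`. -/
noncomputable def head (M : GrMod 𝒜) : GrMod 𝒜 := M.quot M.rad

/-- `P` is a projective object of `𝒢(A)`. -/
def IsProjective (P : GrMod 𝒜) : Prop :=
  ∀ (M N : GrMod 𝒜) (g : M.Hom N) (f : P.Hom N), Function.Surjective g.1 →
    ∃ k : P.Hom M, ∀ x, g.1 (k.1 x) = f.1 x

/-- `P` is a projective cover of `M` in `𝒢(A)`: there is an epimorphism from the projective object
`P` onto `M` that maps no proper graded submodule of `P` onto `M`. -/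
def IsProjectiveCover (P M : GrMod 𝒜) : Prop :=
  P.IsProjective ∧ ∃ f : P.Hom M, Function.Surjective f.1 ∧
    ∀ N : P.GrSub, N.1.map f.1 = ⊤ → N = ⊤

/-- A finite filtration `M = F⁰ ⊇ F¹ ⊇ ⋯ ⊇ Fˢ = 0` in `𝒢(A)`; the values of `step` beyond the
length `s` play no role. -/
structure Filtration (M : GrMod 𝒜) where
  length : ℕ
  step : ℕ → M.GrSub
  step_zero : step 0 = ⊤
  step_length : step length = ⊥
  step_le : ∀ i < length, step (i + 1) ≤ step i

/-- The subquotient `Fⁱ / Fⁱ⁺¹` of a filtration. -/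
noncomputable def Filtration.quotient {M : GrMod 𝒜} (F : M.Filtration) (i : ℕ) : GrMod 𝒜 :=
  M.factor (F.step i) (F.step (i + 1))

/-- The multiplicity `[M : S]` of a simple object `S` in `M`: the number of subquotients isomorphic
to `S` in a composition series of `M`. By Jordan–Hölder every composition series gives the same
number, so the set below has exactly one element. -/
noncomputable def mult (M S : GrMod 𝒜) : ℕ :=
  sInf {n | ∃ F : M.Filtration, (∀ i < F.length, (F.quotient i).IsSimple) ∧
    n = Nat.card {i : Fin F.length // (F.quotient i).Iso S}}

theorem exists_gr_ne_bot (M : GrMod 𝒜) (hM : M.IsSimple) : ∃ d, M.gr d ≠ ⊥ := by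
  by_contra! h
  have := hM.1
  have ht := M.iSup_gr
  simp only [h, iSup_bot] at ht
  obtain ⟨x, hx⟩ := exists_ne (0 : M)
  exact hx ((Submodule.mem_bot K).1 (ht ▸ Submodule.mem_top))

theorem isGraded_span [GradedAlgebra 𝒜] (M : GrMod 𝒜) (S : Set M)
    (hS : ∀ x ∈ S, ∀ i, M.proj i x ∈ Submodule.span A S) : M.IsGraded (Submodule.span A S) := by
  intro x hx
  induction hx using Submodule.span_induction with
  | mem x hx => exact hS x hx
  | zero => intro i; rw [map_zero]; exact Submodule.zero_mem _
  | add x y _ _ hx hy => intro i; rw [map_add]; exact Submodule.add_mem _ (hx i) (hy i)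
  | smul a x _ hx =>
    intro i
    induction a using DirectSum.Decomposition.inductionOn 𝒜 with
    | zero => rw [zero_smul, map_zero]; exact Submodule.zero_mem _
    | @homogeneous j a =>
      rw [M.proj_smul j i a.1 a.2]
      exact Submodule.smul_mem _ _ (hx _)
    | add a b ha hb => rw [add_smul, map_add]; exact Submodule.add_mem _ ha hb

end Basic

/-! ### Standard duality -/

section Dual

variable {K A B : Type u} [Field K] [Ring A] [Algebra K A] [Ring B] [Algebra K B]
  {𝒜 : ℤ → Submodule K A} {ℬ : ℤ → Submodule K B}

/-- Standard duality. If `φ` identifies the graded algebra `A` with the opposite of `B`, with the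
grading reversed, the dual `M* = Hom_K(M, K)` of `M ∈ 𝒢(B)` is an object of `𝒢(A)`: `a ∈ A` acts by
`(a f)(x) = f (φ(a) x)`, and `(M*)ᵢ` consists of the functionals that vanish on `Mⱼ` for all
`j ≠ i`. -/
noncomputable def dual (φ : A ≃ₐ[K] Bᵐᵒᵖ) (hφ : ∀ i, ∀ a ∈ 𝒜 i, (φ a).unop ∈ ℬ (-i))
    (M : GrMod ℬ) : GrMod 𝒜 :=
  letI modA : Module A (Module.Dual K M) :=
    { smul := fun a f => f ∘ₗ Algebra.lsmul K K M (φ a).unop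
      one_smul := fun f => by
        ext x
        change f ((φ 1).unop • x) = f x
        simp
      mul_smul := fun a b f => by
        ext x
        change f ((φ (a * b)).unop • x) = f ((φ b).unop • (φ a).unop • x)
        simp [mul_smul]
      smul_zero := fun a => by ext x; rfl
      smul_add := fun a f g => by ext x; rfl
      add_smul := fun a b f => by
        ext x
        change f ((φ (a + b)).unop • x) = f ((φ a).unop • x) + f ((φ b).unop • x)
        simp [add_smul]
      zero_smul := fun f => by
        ext x
        change f ((φ 0).unop • x) = 0
        simp }
  { carrier := Module.Dual K M
    modA := modA
    tower := ⟨fun c a f => by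
      ext x
      change f ((φ (c • a)).unop • x) = c • f ((φ a).unop • x)
      simp⟩
    gr := fun i =>
      { carrier := {f | ∀ j ≠ i, ∀ x ∈ M.gr j, f x = 0}
        zero_mem' := fun _ _ _ _ => rfl
        add_mem' := fun {f g} hf hg j hj x hx => by
          rw [LinearMap.add_apply, hf j hj x hx, hg j hj x hx, add_zero]
        smul_mem' := fun c f hf j hj x hx => by
          rw [LinearMap.smul_apply, hf j hj x hx, smul_zero] }
    internal := by
      refine isInternal_of_proj _ (fun i => LinearMap.lcomp K K (M.proj i)) ?_ ?_ ?_
      · intro i f hf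
        apply proj_ext M
        intro j x hx
        change f (M.proj i x) = f x
        by_cases h : j = i
        · subst h
          rw [M.proj_self j x hx]
        · rw [M.proj_ne i j h x hx, hf j h x hx, map_zero]
      · intro i j hij f hf
        ext x
        exact hf i hij.symm _ (M.proj_mem i x)
      · rw [eq_top_iff]
        intro f _
        obtain ⟨s, hs⟩ := M.exists_finset
        have hf : f = ∑ i ∈ s, f ∘ₗ M.proj i := by
          ext x
          rw [LinearMap.sum_apply]
          conv_lhs => rw [hs x, map_sum]
          rfl
        rw [hf]
        refine Submodule.sum_mem _ fun i _ => Submodule.mem_iSup_of_mem i ?_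
        intro j hj x hx
        rw [LinearMap.comp_apply, M.proj_ne i j hj x hx, map_zero]
    smul_mem := fun i j a f ha hf k hk x hx =>
      hf (-i + k) (by omega) _ (M.smul_mem (-i) k _ x (hφ i a ha) hx) }

/-- An element of the dual module as a functional. -/
noncomputable def dualEquiv (φ : A ≃ₐ[K] Bᵐᵒᵖ) (hφ : ∀ i, ∀ a ∈ 𝒜 i, (φ a).unop ∈ ℬ (-i))
    (M : GrMod ℬ) : M.dual φ hφ ≃ₗ[K] Module.Dual K M :=
  LinearEquiv.refl K (Module.Dual K M)

theorem dual_smul_apply (φ : A ≃ₐ[K] Bᵐᵒᵖ) (hφ : ∀ i, ∀ a ∈ 𝒜 i, (φ a).unop ∈ ℬ (-i))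
    (M : GrMod ℬ) (a : A) (f : M.dual φ hφ) (x : M) :
    dualEquiv φ hφ M (a • f) x = dualEquiv φ hφ M f ((φ a).unop • x) := rfl

theorem dual_proj_apply (φ : A ≃ₐ[K] Bᵐᵒᵖ) (hφ : ∀ i, ∀ a ∈ 𝒜 i, (φ a).unop ∈ ℬ (-i))
    (M : GrMod ℬ) (i : ℤ) (f : M.dual φ hφ) (x : M) :
    dualEquiv φ hφ M ((M.dual φ hφ).proj i f) x = dualEquiv φ hφ M f (M.proj i x) := by
  have : (dualEquiv φ hφ M).toLinearMap ∘ₗ (M.dual φ hφ).proj i =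
      LinearMap.lcomp K K (M.proj i) ∘ₗ (dualEquiv φ hφ M).toLinearMap := by
    apply proj_ext (M.dual φ hφ)
    intro j f hf
    change dualEquiv φ hφ M ((M.dual φ hφ).proj i f) = dualEquiv φ hφ M f ∘ₗ M.proj i
    by_cases h : j = i
    · subst h
      rw [(M.dual φ hφ).proj_self j f hf]
      apply proj_ext M
      intro k x hx
      change _ = dualEquiv φ hφ M f (M.proj j x)
      by_cases hk : k = j
      · subst hk
        rw [M.proj_self k x hx]
      · rw [M.proj_ne j k hk x hx]
        exact (hf k hk x hx).trans (map_zero _).symm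
    · rw [(M.dual φ hφ).proj_ne i j h f hf, map_zero]
      apply LinearMap.ext
      intro x
      exact (hf i (Ne.symm h) _ (M.proj_mem i x)).symm
  exact LinearMap.congr_fun (LinearMap.congr_fun this f) x

/-- Duality preserves simple objects. -/
theorem IsSimple.dual {M : GrMod ℬ} (hM : M.IsSimple) (φ : A ≃ₐ[K] Bᵐᵒᵖ)
    (hφ : ∀ i, ∀ a ∈ 𝒜 i, (φ a).unop ∈ ℬ (-i)) : (M.dual φ hφ).IsSimple := by
  have := hM.1
  refine ⟨inferInstanceAs (Nontrivial (Module.Dual K M)), fun U => ?_⟩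
  let U' : Submodule K (Module.Dual K M) :=
    (U.1.restrictScalars K).map (dualEquiv φ hφ M).toLinearMap
  have hmem : ∀ f : M.dual φ hφ, dualEquiv φ hφ M f ∈ U' ↔ f ∈ U.1 := fun f =>
    ⟨fun ⟨_, hg, hgf⟩ => (dualEquiv φ hφ M).injective hgf ▸ hg, fun hf => ⟨f, hf, rfl⟩⟩
  let N : M.GrSub := ⟨
    { carrier := {x | ∀ f ∈ U.1, dualEquiv φ hφ M f x = 0}
      zero_mem' := fun f _ => map_zero _
      add_mem' := fun {x y} hx hy f hf => by rw [map_add, hx f hf, hy f hf, add_zero]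
      smul_mem' := fun b x hx f hf => by
        have h2 := hx _ (U.1.smul_mem (φ.symm (MulOpposite.op b)) hf)
        rw [dual_smul_apply] at h2
        simpa using h2 },
    fun x hx i f hf => by
      have h2 := hx _ (U.2 f hf i)
      rw [dual_proj_apply] at h2
      exact h2⟩
  have hN : U'.dualCoannihilator = N.1.restrictScalars K := by
    ext x
    rw [Submodule.mem_dualCoannihilator]
    exact ⟨fun h f hf => h _ ((hmem f).2 hf), fun h f hf => h f ((hmem f).1 hf)⟩
  have hU : U' = (N.1.restrictScalars K).dualAnnihilator := by
    rw [← hN, Subspace.dualCoannihilator_dualAnnihilator_eq]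
  rcases hM.2 N with h | h
  · right
    apply Subtype.ext
    change U.1 = ⊤
    rw [eq_top_iff]
    intro f _
    rw [← hmem, hU, Submodule.mem_dualAnnihilator]
    intro x hx
    have hx0 : x ∈ N.1 := hx
    rw [h] at hx0
    rw [(Submodule.mem_bot B).1 hx0, map_zero]
  · left
    apply Subtype.ext
    change U.1 = ⊥
    rw [eq_bot_iff]
    intro f hf
    rw [← hmem, hU, Submodule.mem_dualAnnihilator] at hf
    rw [Submodule.mem_bot, ← (dualEquiv φ hφ M).map_eq_zero_iff]
    apply LinearMap.ext
    intro x
    refine hf x ?_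
    have : x ∈ N.1 := by rw [h]; exact Submodule.mem_top
    exact this

end Dual

/-! ### Extension of scalars from the ground field -/

section Tensor

variable {K A : Type u} [Field K] [Ring A] [Algebra K A] (𝒜 : ℤ → Submodule K A)
  [GradedAlgebra 𝒜] {B : Type u} [Ring B] [Algebra K B] {ℬ : ℤ → Submodule K B}

/-- The projection of `A ⊗ M` onto the component of degree `n`. -/
noncomputable def tensorProj (M : GrMod ℬ) (n : ℤ) : A ⊗[K] M →ₗ[K] A ⊗[K] M :=
  TensorProduct.lift
    (DirectSum.toModule K ℤ (M →ₗ[K] A ⊗[K] M)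
        (fun i => LinearMap.lcomp K _ (M.proj (n - i)) ∘ₗ TensorProduct.mk K A M ∘ₗ
          (𝒜 i).subtype) ∘ₗ
      (DirectSum.decomposeLinearEquiv 𝒜).toLinearMap)

theorem tensorProj_tmul (M : GrMod ℬ) (n i : ℤ) (a : A) (ha : a ∈ 𝒜 i) (x : M) :
    tensorProj 𝒜 M n (a ⊗ₜ x) = a ⊗ₜ M.proj (n - i) x := by
  lift a to 𝒜 i using ha
  simp [tensorProj]

variable [FiniteDimensional K A]

/-- The graded left `A`-module `A ⊗_K M`; in degree `n` it is the sum of the `Aᵢ ⊗ M_{n-i}`. -/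
noncomputable def tensor (M : GrMod ℬ) : GrMod 𝒜 where
  carrier := A ⊗[K] M
  gr n := ⨆ i, Submodule.map₂ (TensorProduct.mk K A M) (𝒜 i) (M.gr (n - i))
  internal := by
    refine isInternal_of_proj _ (tensorProj 𝒜 M) ?_ ?_ ?_
    · intro n
      change (⨆ i, _) ≤ LinearMap.eqLocus (tensorProj 𝒜 M n) LinearMap.id
      refine iSup_le fun i => Submodule.map₂_le.2 fun a ha x hx => ?_
      change tensorProj 𝒜 M n (a ⊗ₜ x) = a ⊗ₜ x
      rw [tensorProj_tmul 𝒜 M n i a ha, M.proj_self _ x hx]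
    · intro n m hnm
      change (⨆ i, _) ≤ LinearMap.ker (tensorProj 𝒜 M n)
      refine iSup_le fun i => Submodule.map₂_le.2 fun a ha x hx => ?_
      change tensorProj 𝒜 M n (a ⊗ₜ x) = 0
      rw [tensorProj_tmul 𝒜 M n i a ha, M.proj_ne _ (m - i) (by omega) x hx,
        TensorProduct.tmul_zero]
    · rw [eq_top_iff, ← TensorProduct.map₂_mk_top_top_eq_top,
        ← (DirectSum.Decomposition.isInternal 𝒜).submodule_iSup_eq_top, ← M.iSup_gr]
      rw [Submodule.map₂_iSup_left]
      refine iSup_le fun i => ?_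
      rw [Submodule.map₂_iSup_right]
      refine iSup_le fun j => ?_
      refine le_iSup_of_le (i + j) (le_iSup_of_le i ?_)
      rw [show i + j - i = j by ring]
  smul_mem i j a x ha hx := by
    have key : (⨆ k, Submodule.map₂ (TensorProduct.mk K A M) (𝒜 k) (M.gr (j - k))) ≤
        (⨆ k, Submodule.map₂ (TensorProduct.mk K A M) (𝒜 k) (M.gr (i + j - k))).comap
          (Algebra.lsmul K K (A ⊗[K] M) a) := by
      refine iSup_le fun k => Submodule.map₂_le.2 fun b hb y hy => ?_
      change (a * b) ⊗ₜ[K] y ∈ ⨆ k, Submodule.map₂ (TensorProduct.mk K A M) (𝒜 k)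
        (M.gr (i + j - k))
      refine Submodule.mem_iSup_of_mem (i + k)
        (Submodule.apply_mem_map₂ (TensorProduct.mk K A M) (SetLike.mul_mem_graded ha hb) ?_)
      rwa [show i + j - (i + k) = j - k by ring]
    exact key hx

/-- The element `a ⊗ x` of `A ⊗_K M`. -/
noncomputable def tmk (M : GrMod ℬ) : A →ₗ[K] M →ₗ[K] tensor 𝒜 M := TensorProduct.mk K A M

theorem tensor_proj (M : GrMod ℬ) (n i : ℤ) (a : A) (ha : a ∈ 𝒜 i) (x : M) :
    (tensor 𝒜 M).proj n (tmk 𝒜 M a x) = tmk 𝒜 M a (M.proj (n - i) x) := by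
  have : (tensor 𝒜 M).proj n ∘ₗ tmk 𝒜 M a = tmk 𝒜 M a ∘ₗ M.proj (n - i) := by
    apply proj_ext M
    intro j y hy
    have hm : tmk 𝒜 M a y ∈ (tensor 𝒜 M).gr (i + j) := by
      change a ⊗ₜ[K] y ∈ ⨆ k, Submodule.map₂ (TensorProduct.mk K A M) (𝒜 k) (M.gr (i + j - k))
      refine Submodule.mem_iSup_of_mem i
        (Submodule.apply_mem_map₂ (TensorProduct.mk K A M) ha ?_)
      rwa [show i + j - i = j by ring]
    rw [LinearMap.comp_apply, LinearMap.comp_apply]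
    by_cases h : i + j = n
    · subst h
      rw [(tensor 𝒜 M).proj_self _ _ hm, show i + j - i = j by ring, M.proj_self j y hy]
    · rw [(tensor 𝒜 M).proj_ne _ _ h _ hm, M.proj_ne _ j (by omega) y hy, map_zero]
  exact LinearMap.congr_fun this x

end Tensor

/-! ### Isomorphism classes of simple objects -/

section Irr

variable {K A : Type u} [Field K] [Ring A] [Algebra K A] (𝒜 : ℤ → Submodule K A)

/-- Isomorphism of simple objects of `𝒢(A)`. -/
def simpleSetoid : Setoid {M : GrMod 𝒜 // M.IsSimple} where
  r M N := M.1.Iso N.1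
  iseqv := ⟨fun M => Iso.refl M.1, fun h => h.symm, fun h h' => h.trans h'⟩

/-- The set `Irr 𝒢(A)` of isomorphism classes of simple objects of `𝒢(A)`. -/
def Irr : Type (u + 1) := Quotient (simpleSetoid 𝒜)

variable {𝒜}

/-- A simple object in the given isomorphism class. -/
noncomputable def Irr.rep (s : Irr 𝒜) : GrMod 𝒜 := (Quotient.out s).1

theorem Irr.rep_isSimple (s : Irr 𝒜) : s.rep.IsSimple := (Quotient.out s).2

/-- A degree in which the simple object `s` does not vanish. Over an algebra concentrated in degree
zero, a simple object lives in exactly one degree, and this is `deg s`. -/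
noncomputable def Irr.deg (s : Irr 𝒜) : ℤ :=
  Classical.choose (exists_gr_ne_bot s.rep s.rep_isSimple)

end Irr

end GrMod

/-! ## The opposite graded algebra -/

section Opposite

variable {K A : Type u} [Field K] [Ring A] [Algebra K A]

/-- The reversed grading of the opposite algebra: `(Aᵒᵖ)ᵢ = A₋ᵢ`. -/
def opGrading (𝒜 : ℤ → Submodule K A) (i : ℤ) : Submodule K Aᵐᵒᵖ :=
  (𝒜 (-i)).comap (MulOpposite.opLinearEquiv K).symm.toLinearMap

theorem opGrading_isInternal (𝒜 : ℤ → Submodule K A) [GradedAlgebra 𝒜] :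
    DirectSum.IsInternal (opGrading 𝒜) := by
  refine GrMod.isInternal_of_proj _
    (fun i => (MulOpposite.opLinearEquiv K).toLinearMap ∘ₗ
      ((𝒜 (-i)).subtype ∘ₗ DirectSum.component K ℤ (fun j => 𝒜 j) (-i) ∘ₗ
        (DirectSum.decomposeLinearEquiv 𝒜).toLinearMap) ∘ₗ
      (MulOpposite.opLinearEquiv K).symm.toLinearMap) ?_ ?_ ?_
  · intro i x hx
    apply MulOpposite.unop_injective
    exact DirectSum.decompose_of_mem_same 𝒜 (x := x.unop) hx
  · intro i j hij x hx
    apply MulOpposite.unop_injective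
    exact DirectSum.decompose_of_mem_ne 𝒜 (x := x.unop) hx (by omega)
  · rw [eq_top_iff]
    intro x _
    have hx : x.unop ∈ ⨆ i, 𝒜 i := by
      rw [(DirectSum.Decomposition.isInternal 𝒜).submodule_iSup_eq_top]
      exact Submodule.mem_top
    have hle : (⨆ i, 𝒜 i) ≤
        (⨆ i, opGrading 𝒜 i).comap (MulOpposite.opLinearEquiv K).toLinearMap := by
      refine iSup_le fun i a ha => Submodule.mem_iSup_of_mem (-i) ?_
      change a ∈ 𝒜 (- -i)
      rwa [neg_neg]
    exact hle hx

noncomputable instance (𝒜 : ℤ → Submodule K A) [GradedAlgebra 𝒜] :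
    GradedAlgebra (opGrading 𝒜) where
  one_mem := by
    change (1 : A) ∈ 𝒜 (-0)
    rw [neg_zero]
    exact SetLike.one_mem_graded 𝒜
  mul_mem i j a b ha hb := by
    change b.unop * a.unop ∈ 𝒜 (-(i + j))
    rw [show -(i + j) = -j + -i by ring]
    exact SetLike.mul_mem_graded hb ha
  toDecomposition := (opGrading_isInternal 𝒜).chooseDecomposition

end Opposite

/-! ## Triangular decompositions -/

/-- A triple `(A⁻, T, A⁺)` of graded subalgebras of `A` with `T` concentrated in degree zero, `A⁺`
in degrees `≥ 0` and `A⁻` in degrees `≤ 0`. -/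
structure GradedTriple {K A : Type u} [Field K] [Ring A] [Algebra K A]
    (𝒜 : ℤ → Submodule K A) where
  neg : Subalgebra K A
  T : Subalgebra K A
  pos : Subalgebra K A
  neg_le : neg.toSubmodule ≤ ⨆ i : ℕ, neg.toSubmodule ⊓ 𝒜 (-i)
  T_le : T.toSubmodule ≤ 𝒜 0
  pos_le : pos.toSubmodule ≤ ⨆ i : ℕ, pos.toSubmodule ⊓ 𝒜 i

namespace GradedTriple

variable {K A : Type u} [Field K] [Ring A] [Algebra K A] {𝒜 : ℤ → Submodule K A}

/-- The multiplication map `A⁻ ⊗ T ⊗ A⁺ → A`. -/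
noncomputable def mulMap (τ : GradedTriple 𝒜) : (τ.neg ⊗[K] τ.T) ⊗[K] τ.pos →ₗ[K] A :=
  LinearMap.mul' K A ∘ₗ TensorProduct.map
    (LinearMap.mul' K A ∘ₗ TensorProduct.map τ.neg.val.toLinearMap τ.T.val.toLinearMap)
    τ.pos.val.toLinearMap

/-- The triple `(A⁻, T, A⁺)` is a triangular decomposition of `A`. -/
structure IsTriangularDecomposition (τ : GradedTriple 𝒜) : Prop where
  /-- multiplication `A⁻ ⊗ T ⊗ A⁺ → A` is an isomorphism of vector spaces -/
  mul_bijective : Function.Bijective τ.mulMap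
  /-- `A⁻₀ = K` -/
  neg_zero : τ.neg.toSubmodule ⊓ 𝒜 0 = (⊥ : Subalgebra K A).toSubmodule
  /-- `A⁺₀ = K` -/
  pos_zero : τ.pos.toSubmodule ⊓ 𝒜 0 = (⊥ : Subalgebra K A).toSubmodule
  /-- `A⁻ T = T A⁻` as subspaces -/
  neg_comm : τ.neg.toSubmodule * τ.T.toSubmodule = τ.T.toSubmodule * τ.neg.toSubmodule
  /-- `A⁺ T = T A⁺` as subspaces -/
  pos_comm : τ.pos.toSubmodule * τ.T.toSubmodule = τ.T.toSubmodule * τ.pos.toSubmodule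
  /-- `T` is split: the only endomorphisms of a simple `T`-module are the scalars -/
  split : ∀ (V : Type u) [AddCommGroup V] [Module K V] [Module τ.T V] [IsScalarTower K τ.T V]
    [IsSimpleModule τ.T V] (f : V →ₗ[τ.T] V), ∃ c : K, ∀ v, f v = c • v

/-- The opposite triple `((A⁺)ᵒᵖ, Tᵒᵖ, (A⁻)ᵒᵖ)` in the opposite algebra. -/
def op (τ : GradedTriple 𝒜) : GradedTriple (opGrading 𝒜) where
  neg := τ.pos.op
  T := τ.T.op
  pos := τ.neg.op
  neg_le := by
    intro x hx
    have hle : (⨆ i : ℕ, τ.pos.toSubmodule ⊓ 𝒜 i) ≤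
        (⨆ i : ℕ, τ.pos.op.toSubmodule ⊓ opGrading 𝒜 (-i)).comap
          (MulOpposite.opLinearEquiv K).toLinearMap := by
      refine iSup_le fun i a ha => Submodule.mem_iSup_of_mem i ⟨ha.1, ?_⟩
      change a ∈ 𝒜 (- -(i : ℤ))
      rw [neg_neg]
      exact ha.2
    exact hle (τ.pos_le (show x.unop ∈ τ.pos.toSubmodule from hx))
  T_le := by
    intro x hx
    change x.unop ∈ 𝒜 (-0)
    rw [_root_.neg_zero]
    exact τ.T_le hx
  pos_le := by
    intro x hx
    have hle : (⨆ i : ℕ, τ.neg.toSubmodule ⊓ 𝒜 (-i)) ≤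
        (⨆ i : ℕ, τ.neg.op.toSubmodule ⊓ opGrading 𝒜 i).comap
          (MulOpposite.opLinearEquiv K).toLinearMap :=
      iSup_le fun i a ha => Submodule.mem_iSup_of_mem i ⟨ha.1, ha.2⟩
    exact hle (τ.neg_le (show x.unop ∈ τ.neg.toSubmodule from hx))

/-- The grading of the subalgebra `T`; by `T_le` it is concentrated in degree zero. -/
def grT (τ : GradedTriple 𝒜) (i : ℤ) : Submodule K τ.T := (𝒜 i).comap τ.T.val.toLinearMap

/-- The set `Irr 𝒢(T)`, which labels everything below. -/
abbrev Wt (τ : GradedTriple 𝒜) : Type (u + 1) := GrMod.Irr τ.grT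

/-- The partial order on `Irr 𝒢(T)`: `μ < lam` if and only if `deg μ < deg lam`. -/
def wtLE (τ : GradedTriple 𝒜) (μ lam : τ.Wt) : Prop := μ = lam ∨ μ.deg < lam.deg

/-- The positive Borel subalgebra `B⁺ = A⁺ T`, as a subspace of `A`. -/
def posBorel (τ : GradedTriple 𝒜) : Submodule K A := τ.pos.toSubmodule * τ.T.toSubmodule

section Standard

variable [GradedAlgebra 𝒜] [FiniteDimensional K A]

/-- The relations that turn `A ⊗_K M` into `A ⊗_{B⁺} Inf M`, where `Inf M` is the inflation of the
`T`-module `M` along the projection of `B⁺ = T ⊕ J⁺` onto `T` with kernel `J⁺`, the sum of the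
components of `B⁺` of positive degree. So `t ∈ T` acts on `Inf M` as on `M`, and homogeneous
elements `b ∈ B⁺` of positive degree act as zero. -/
def standardRel (τ : GradedTriple 𝒜) (M : GrMod τ.grT) : Set (GrMod.tensor 𝒜 M) :=
  {z | ∃ (t : τ.T) (m : M), z = GrMod.tmk 𝒜 M t m - GrMod.tmk 𝒜 M 1 (t • m)} ∪
  {z | ∃ (i : ℤ) (b : A) (m : M), 0 < i ∧ b ∈ τ.posBorel ∧ b ∈ 𝒜 i ∧ z = GrMod.tmk 𝒜 M b m}

theorem isGraded_standardRel (τ : GradedTriple 𝒜) (M : GrMod τ.grT) :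
    (GrMod.tensor 𝒜 M).IsGraded (Submodule.span A (τ.standardRel M)) := by
  apply GrMod.isGraded_span
  rintro _ (⟨t, m, rfl⟩ | ⟨i, b, m, hi, hb, hbi, rfl⟩) n
  · apply Submodule.subset_span
    refine Or.inl ⟨t, M.proj n m, ?_⟩
    have h0 : (t : A) ∈ 𝒜 0 := τ.T_le t.2
    refine (map_sub ((GrMod.tensor 𝒜 M).proj n) _ _).trans ?_
    have h1 := GrMod.tensor_proj 𝒜 M n 0 (t : A) h0 m
    have h2 := GrMod.tensor_proj 𝒜 M n 0 1 (SetLike.one_mem_graded 𝒜) (t • m)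
    rw [sub_zero] at h1 h2
    have h3 := M.proj_smul 0 n t h0 m
    rw [sub_zero] at h3
    rw [h3] at h2
    exact congrArg₂ (· - ·) h1 h2
  · apply Submodule.subset_span
    exact Or.inr ⟨i, b, M.proj (n - i) m, hi, hb, hbi, GrMod.tensor_proj 𝒜 M n i b hbi m⟩

/-- The (proper) standard functor `Δ(M) = A ⊗_{B⁺} Inf M`. -/
noncomputable def stdFunctor (τ : GradedTriple 𝒜) (M : GrMod τ.grT) : GrMod 𝒜 :=
  (GrMod.tensor 𝒜 M).quot ⟨Submodule.span A (τ.standardRel M), τ.isGraded_standardRel M⟩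

end Standard

/-- The identification of `Tᵒᵖ`, as a subalgebra of `Aᵒᵖ`, with the opposite algebra of `T`. -/
def opTEquiv (τ : GradedTriple 𝒜) : τ.op.T ≃ₐ[K] (τ.T)ᵐᵒᵖ where
  toFun t := MulOpposite.op ⟨t.1.unop, t.2⟩
  invFun t := ⟨MulOpposite.op t.unop.1, t.unop.2⟩
  left_inv _ := rfl
  right_inv _ := rfl
  map_mul' _ _ := rfl
  map_add' _ _ := rfl
  commutes' _ := rfl

/-- Standard duality `𝒢(T) → 𝒢(Tᵒᵖ)`. -/
noncomputable def dualT (τ : GradedTriple 𝒜) (M : GrMod τ.grT) : GrMod τ.op.grT :=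
  M.dual τ.opTEquiv fun _ _ ha => ha

/-- The bijection `lam ↦ lam*` from `Irr 𝒢(T)` to `Irr 𝒢(Tᵒᵖ)` induced by duality. -/
noncomputable def star (τ : GradedTriple 𝒜) (lam : τ.Wt) : τ.op.Wt :=
  Quotient.mk (GrMod.simpleSetoid τ.op.grT)
    ⟨τ.dualT lam.rep, lam.rep_isSimple.dual τ.opTEquiv fun _ _ ha => ha⟩

variable [GradedAlgebra 𝒜] [FiniteDimensional K A]

/-- The (proper) costandard functor `∇(M) = Δ(M*)*`, where the inner dual is that of `T`-modules,
`Δ` is the standard functor of the opposite triple, and the outer dual is `𝒢(Aᵒᵖ) → 𝒢(A)`. -/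
noncomputable def costdFunctor (τ : GradedTriple 𝒜) (M : GrMod τ.grT) : GrMod 𝒜 :=
  (τ.op.stdFunctor (τ.dualT M)).dual (AlgEquiv.opOp K A) fun i a ha => by
    change a ∈ 𝒜 (- -i)
    rwa [neg_neg]

/-- The standard object `Δ(lam)` (for semisimple `T`). -/
noncomputable def std (τ : GradedTriple 𝒜) (lam : τ.Wt) : GrMod 𝒜 := τ.stdFunctor lam.rep

/-- The costandard object `∇(lam)` (for semisimple `T`). -/
noncomputable def costd (τ : GradedTriple 𝒜) (lam : τ.Wt) : GrMod 𝒜 := τ.costdFunctor lam.rep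

/-- The simple object `L(lam) = Hd Δ(lam)`. -/
noncomputable def simple (τ : GradedTriple 𝒜) (lam : τ.Wt) : GrMod 𝒜 := (τ.std lam).head

/-- `P` is a projective cover `P(lam)` of `L(lam)`. -/
def IsP (τ : GradedTriple 𝒜) (lam : τ.Wt) (P : GrMod 𝒜) : Prop :=
  P.IsProjectiveCover (τ.simple lam)

/-- `M` has highest weight `lam`. -/
def HasHighestWeight (τ : GradedTriple 𝒜) (M : GrMod 𝒜) (lam : τ.Wt) : Prop :=
  (∀ μ : τ.Wt, M.mult (τ.simple μ) ≠ 0 → τ.wtLE μ lam) ∧ M.mult (τ.simple lam) = 1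

/-- `lam ↦ lam^h = h lam` sends `lam` to the highest weight of `P(lam)`: a projective cover `P(lam)`
exists, and `h lam` is its one and only highest weight. -/
def IsHighestWeightMap (τ : GradedTriple 𝒜) (h : τ.Wt → τ.Wt) : Prop :=
  ∀ lam : τ.Wt, (∃ P, τ.IsP lam P) ∧
    ∀ P, τ.IsP lam P → ∀ μ, τ.HasHighestWeight P μ ↔ μ = h lam

/-- `ν` is the graded Nakayama map, transported to `Irr 𝒢(T)`: `Soc P(lam) ≅ L(ν lam)`, and this
determines `ν lam`. -/
def IsNakayamaMap (τ : GradedTriple 𝒜) (ν : τ.Wt → τ.Wt) : Prop :=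
  ∀ lam : τ.Wt, ∀ P, τ.IsP lam P → ∀ μ, (P.sub P.soc).Iso (τ.simple μ) ↔ μ = ν lam

/-- All subquotients of the filtration `F` are standard objects. -/
def IsStandardFiltration (τ : GradedTriple 𝒜) {M : GrMod 𝒜} (F : M.Filtration) : Prop :=
  ∀ i < F.length, ∃ μ : τ.Wt, (F.quotient i).Iso (τ.std μ)

/-- All subquotients of the filtration `F` are costandard objects. -/
def IsCostandardFiltration (τ : GradedTriple 𝒜) {M : GrMod 𝒜} (F : M.Filtration) : Prop :=
  ∀ i < F.length, ∃ μ : τ.Wt, (F.quotient i).Iso (τ.costd μ)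

end GradedTriple

/-! The argument is a dimension count over `A⁻`. By a graded Nakayama lemma every graded module
satisfies dim M ≤ dim A⁻ · dim (M / A⁻_{<0} M) (`negMul_eq_top`, `finrank_add_le`). Equality, called
numerical freeness, is what freeness over `A⁻` amounts to, and only this equality is used. It holds
for `A ⊗ V` because A = A⁻ ⊗ T ⊗ A⁺, and it passes to direct summands, so every P(λ) has it. The
central fact is `finrank_gen_and_quot`: if M is numerically free and V is a T-submodule of its top
component, then AV = A⁻V has the largest possible dimension dim A⁻ · dim V, and M/AV is again
numerically free. A simple V therefore generates a copy of Δ, and induction gives standard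
filtrations.

Self-injectivity makes P(λ) injective. Being also local, it is uniform: any two nonzero subobjects
meet (`IsLocal.isUniform`). If the top component of P(λ) were decomposable over T, two complementary
pieces would generate submodules meeting in zero, by the dimension count. So this component is a
simple T-module (`exists_hasTop`). It is λ^h: it is the unique highest weight, Δ(λ^h) embeds in
P(λ), and P(λ) is the injective hull of Δ(λ^h). Hence h is injective, and Soc Δ(λ^h) = Soc P(λ) =
L(ν(λ)). A bottom factor of a standard filtration is then recognised by its socle. Surjectivity of h
and ν follows because both commute with shifts of degree and T has only finitely many simple modules
up to shift.

Duality gives the rest. As P(λ) is the injective hull of L(ν(λ)), its dual is the projective cover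
of L(ν(λ)*) over the opposite algebra, and the top component of this dual is (λ^h)*; comparing the
two yields (d). All indecomposable projectives over Aᵒᵖ arise in this way, so they too are injective
and the whole theory applies to the opposite triple. Dualizing Δ((λ^h)*) ⊆ P(λ)* gives an
epimorphism P(λ) → ∇(λ^h), whence the head of ∇(λ^h), and a top factor of a costandard filtration is
recognised by its head. -/

namespace GrMod

/-! ### Morphisms, kernels, images -/

section Category

variable {K A : Type u} [Field K] [Ring A] [Algebra K A] {𝒜 : ℤ → Submodule K A}
  {M N L : GrMod 𝒜}

theorem Hom.map_proj (f : M.Hom N) (i : ℤ) (x : M) : f.1 (M.proj i x) = N.proj i (f.1 x) := by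
  have : f.1.restrictScalars K ∘ₗ M.proj i = N.proj i ∘ₗ f.1.restrictScalars K := by
    apply proj_ext M
    intro j y hy
    have hf := f.2 j y hy
    by_cases h : j = i
    · subst h
      simp [M.proj_self _ _ hy, N.proj_self _ _ hf]
    · simp [M.proj_ne _ _ h _ hy, N.proj_ne _ _ h _ hf]
  exact LinearMap.congr_fun this x

/-- The identity morphism. -/
def Hom.id (M : GrMod 𝒜) : M.Hom M := ⟨LinearMap.id, fun _ _ h => h⟩

/-- Composition of morphisms. -/
def Hom.comp (g : N.Hom L) (f : M.Hom N) : M.Hom L :=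
  ⟨g.1 ∘ₗ f.1, fun i x hx => g.2 i _ (f.2 i x hx)⟩

/-- Difference of morphisms. -/
def Hom.diff (g f : M.Hom N) : M.Hom N :=
  ⟨g.1 - f.1, fun i x hx => (N.gr i).sub_mem (g.2 i x hx) (f.2 i x hx)⟩

/-- The kernel of a morphism. -/
def Hom.ker (f : M.Hom N) : M.GrSub :=
  ⟨LinearMap.ker f.1, fun x hx i => by
    rw [LinearMap.mem_ker] at hx ⊢
    rw [f.map_proj, hx, map_zero]⟩

/-- The image of a graded submodule. -/
def Hom.mapSub (f : M.Hom N) (X : M.GrSub) : N.GrSub :=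
  ⟨X.1.map f.1, by
    rintro _ ⟨x, hx, rfl⟩ i
    exact ⟨M.proj i x, X.2 x hx i, f.map_proj i x⟩⟩

/-- The preimage of a graded submodule. -/
def Hom.comapSub (f : M.Hom N) (X : N.GrSub) : M.GrSub :=
  ⟨X.1.comap f.1, fun x hx i => by
    rw [Submodule.mem_comap] at hx ⊢
    rw [f.map_proj]
    exact X.2 _ hx i⟩

/-- The intersection of two graded submodules. -/
def infSub (X Y : M.GrSub) : M.GrSub := ⟨X.1 ⊓ Y.1, fun x hx i => ⟨X.2 x hx.1 i, Y.2 x hx.2 i⟩⟩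

/-- The inclusion of a graded submodule. -/
noncomputable def incl (M : GrMod 𝒜) (X : M.GrSub) : (M.sub X).Hom M :=
  ⟨X.1.subtype, fun _ _ h => h⟩

/-- The projection onto a quotient. -/
noncomputable def mkQ (M : GrMod 𝒜) (X : M.GrSub) : M.Hom (M.quot X) :=
  ⟨X.1.mkQ, fun _ x h => ⟨x, h, rfl⟩⟩

theorem incl_injective (M : GrMod 𝒜) (X : M.GrSub) : Function.Injective (M.incl X).1 :=
  X.1.injective_subtype

theorem mkQ_surjective (M : GrMod 𝒜) (X : M.GrSub) : Function.Surjective (M.mkQ X).1 :=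
  X.1.mkQ_surjective

theorem mkQ_eq_zero (M : GrMod 𝒜) (X : M.GrSub) (x : M) : (M.mkQ X).1 x = 0 ↔ x ∈ X.1 :=
  Submodule.Quotient.mk_eq_zero X.1

/-- The corestriction of a morphism to a graded submodule. -/
noncomputable def Hom.cod (f : M.Hom N) (X : N.GrSub) (h : ∀ x, f.1 x ∈ X.1) : M.Hom (N.sub X) :=
  ⟨f.1.codRestrict X.1 h, fun i x hx => f.2 i x hx⟩

/-- The ungraded factorization preserves degrees because a preimage of a homogeneous element may be
replaced by its component of that degree. -/
theorem Hom.exists_desc (q : M.Hom N) (hq : Function.Surjective q.1) (f : M.Hom L)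
    (h : ∀ x, q.1 x = 0 → f.1 x = 0) : ∃ g : N.Hom L, ∀ x, g.1 (q.1 x) = f.1 x := by
  let g0 : N →ₗ[A] L := (LinearMap.ker q.1).liftQ f.1 (fun x hx => h x hx) ∘ₗ
    (q.1.quotKerEquivOfSurjective hq).symm.toLinearMap
  have hg : ∀ x, g0 (q.1 x) = f.1 x := by
    intro x
    have : (q.1.quotKerEquivOfSurjective hq).symm (q.1 x) = Submodule.Quotient.mk x := by
      rw [LinearEquiv.symm_apply_eq]
      rfl
    change (LinearMap.ker q.1).liftQ f.1 (fun x hx => h x hx)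
      ((q.1.quotKerEquivOfSurjective hq).symm (q.1 x)) = f.1 x
    rw [this]
    rfl
  refine ⟨⟨g0, ?_⟩, hg⟩
  intro i y hy
  obtain ⟨x, rfl⟩ := hq y
  have : q.1 (M.proj i x) = q.1 x := by rw [q.map_proj, N.proj_self i _ hy]
  rw [← this, hg]
  exact f.2 i _ (M.proj_mem i x)

theorem Hom.iso_of_bijective (f : M.Hom N) (h : Function.Bijective f.1) : M.Iso N := by
  refine ⟨LinearEquiv.ofBijective f.1 h, fun i x => ⟨f.2 i x, fun hx => ?_⟩⟩
  have : f.1 (M.proj i x) = f.1 x := by rw [f.map_proj]; exact N.proj_self i _ hx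
  rw [← h.1 this]
  exact M.proj_mem i x

theorem Iso.exists_hom (h : M.Iso N) : ∃ f : M.Hom N, Function.Bijective f.1 := by
  obtain ⟨e, he⟩ := h
  exact ⟨⟨e.toLinearMap, fun i x => (he i x).1⟩, e.bijective⟩

theorem quot_iso (X : M.GrSub) (g : M.Hom N) (hg : Function.Surjective g.1)
    (h : ∀ x, g.1 x = 0 ↔ x ∈ X.1) : (M.quot X).Iso N := by
  obtain ⟨k, hk⟩ := (M.mkQ X).exists_desc (M.mkQ_surjective X) g
    (fun x hx => (h x).2 ((M.mkQ_eq_zero X x).1 hx))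
  refine k.iso_of_bijective ⟨?_, fun y => ?_⟩
  · rw [← LinearMap.ker_eq_bot, LinearMap.ker_eq_bot']
    intro y hy
    obtain ⟨x, rfl⟩ := M.mkQ_surjective X y
    rw [hk, h] at hy
    exact (M.mkQ_eq_zero X x).2 hy
  · obtain ⟨x, rfl⟩ := hg y
    exact ⟨_, hk x⟩

/-- States the kernel condition inside `M`, so that subquotients can be identified without handling
the preimage of `Y` in `X`. -/
theorem factor_iso (X Y : M.GrSub) (g : (M.sub X).Hom N) (hg : Function.Surjective g.1)
    (h : ∀ x : M.sub X, g.1 x = 0 ↔ (M.incl X).1 x ∈ Y.1) : (M.factor X Y).Iso N :=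
  quot_iso _ g hg h

theorem gr_eq_bot_of_injective (f : M.Hom N) (hf : Function.Injective f.1) (i : ℤ)
    (h : N.gr i = ⊥) : M.gr i = ⊥ := by
  rw [eq_bot_iff]
  intro x hx
  have := f.2 i x hx
  rw [h, Submodule.mem_bot] at this
  exact (Submodule.mem_bot K).2 (hf (this.trans (map_zero _).symm))

theorem Hom.exists_homogeneous_preimage (f : M.Hom N) (hf : Function.Surjective f.1) (i : ℤ)
    (y : N) (hy : y ∈ N.gr i) : ∃ x ∈ M.gr i, f.1 x = y := by
  obtain ⟨x, rfl⟩ := hf y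
  exact ⟨M.proj i x, M.proj_mem i x, by rw [f.map_proj, N.proj_self i _ hy]⟩

theorem gr_eq_bot_of_surjective (f : M.Hom N) (hf : Function.Surjective f.1) (i : ℤ)
    (h : M.gr i = ⊥) : N.gr i = ⊥ := by
  rw [eq_bot_iff]
  intro y hy
  obtain ⟨x, hx, rfl⟩ := f.exists_homogeneous_preimage hf i y hy
  rw [h, Submodule.mem_bot] at hx
  rw [hx, map_zero]
  exact Submodule.zero_mem _

theorem exists_gr_ne_bot_of_nontrivial (M : GrMod 𝒜) [Nontrivial M] : ∃ d, M.gr d ≠ ⊥ := by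
  by_contra! h
  have ht := M.iSup_gr
  simp only [h, iSup_bot] at ht
  obtain ⟨x, hx⟩ := exists_ne (0 : M)
  exact hx ((Submodule.mem_bot K).1 (ht ▸ Submodule.mem_top))

theorem finite_gr_ne_bot (M : GrMod 𝒜) : {i | M.gr i ≠ ⊥}.Finite :=
  WellFoundedGT.finite_ne_bot_of_iSupIndep M.internal.submodule_iSupIndep

theorem exists_top_degree (M : GrMod 𝒜) [Nontrivial M] :
    ∃ d, M.gr d ≠ ⊥ ∧ ∀ j, d < j → M.gr j = ⊥ := by
  obtain ⟨d0, hd0⟩ := M.exists_gr_ne_bot_of_nontrivial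
  obtain ⟨d, hd, hmax⟩ := M.finite_gr_ne_bot.toFinset.exists_max_image _root_.id
    ⟨d0, by simpa using hd0⟩
  refine ⟨d, by simpa using hd, fun j hj => ?_⟩
  by_contra h
  exact absurd (hmax j (by simpa using h)) (not_le.2 hj)

instance (M : GrMod 𝒜) : IsArtinian A M := isArtinian_of_tower K inferInstance

/-- The descending chain condition supplies the minimal choices behind simple subobjects and
projective covers. -/
instance (M : GrMod 𝒜) : WellFoundedLT M.GrSub :=
  ⟨InvImage.wf (fun X : M.GrSub => X.1) (wellFounded_lt (α := Submodule A M))⟩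

theorem eq_bot_iff_sub (X : M.GrSub) : X = ⊥ ↔ X.1 = ⊥ :=
  ⟨fun h => by rw [h]; rfl, fun h => Subtype.ext h⟩

theorem eq_top_iff_sub (X : M.GrSub) : X = ⊤ ↔ X.1 = ⊤ :=
  ⟨fun h => by rw [h]; rfl, fun h => Subtype.ext h⟩

/-! ### Simple objects -/

theorem IsSimple.of_iso (hM : M.IsSimple) (h : M.Iso N) : N.IsSimple := by
  obtain ⟨f, hf⟩ := h.exists_hom
  refine ⟨(Equiv.ofBijective f.1 hf).symm.nontrivial_congr.2 hM.1, fun X => ?_⟩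
  rcases hM.2 (f.comapSub X) with h | h
  · left
    rw [eq_bot_iff_sub] at h ⊢
    rw [eq_bot_iff]
    intro y hy
    obtain ⟨x, rfl⟩ := hf.2 y
    have : x ∈ (f.comapSub X).1 := hy
    rw [h, Submodule.mem_bot] at this
    simp [this]
  · right
    rw [eq_top_iff_sub] at h ⊢
    rw [eq_top_iff]
    intro y _
    obtain ⟨x, rfl⟩ := hf.2 y
    have : x ∈ (f.comapSub X).1 := by rw [h]; exact Submodule.mem_top
    exact this

theorem IsSimple.surjective (hN : N.IsSimple) (f : M.Hom N) (x : M) (hx : f.1 x ≠ 0) :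
    Function.Surjective f.1 := by
  rcases hN.2 (f.mapSub ⊤) with h | h
  · rw [eq_bot_iff_sub] at h
    have : f.1 x ∈ (f.mapSub ⊤).1 := ⟨x, Submodule.mem_top, rfl⟩
    rw [h, Submodule.mem_bot] at this
    exact absurd this hx
  · rw [eq_top_iff_sub] at h
    intro y
    have : y ∈ (f.mapSub ⊤).1 := by rw [h]; exact Submodule.mem_top
    obtain ⟨z, -, hz⟩ := this
    exact ⟨z, hz⟩

theorem isSimple_sub_of_minimal (X : M.GrSub) (hX : X ≠ ⊥) (h : ∀ Y : M.GrSub, Y < X → Y = ⊥) :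
    (M.sub X).IsSimple := by
  refine ⟨?_, fun Y => ?_⟩
  · have : X.1 ≠ ⊥ := fun h => hX ((eq_bot_iff_sub X).2 h)
    exact Submodule.nontrivial_iff_ne_bot.2 this
  · by_cases hY : (M.incl X).mapSub Y = X
    · right
      rw [eq_top_iff_sub, eq_top_iff]
      intro y _
      have hle : X ≤ (M.incl X).mapSub Y := hY.ge
      have : (M.incl X).1 y ∈ ((M.incl X).mapSub Y).1 := hle y.2
      obtain ⟨z, hz, hzy⟩ := this
      rwa [← M.incl_injective X hzy]
    · left
      have hle : (M.incl X).mapSub Y ≤ X := by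
        rintro _ ⟨y, -, rfl⟩
        exact y.2
      have hb := h _ (lt_of_le_of_ne hle hY)
      rw [eq_bot_iff_sub] at hb ⊢
      rw [eq_bot_iff]
      intro y hy
      have : (M.incl X).1 y ∈ ((M.incl X).mapSub Y).1 := ⟨y, hy, rfl⟩
      rw [hb, Submodule.mem_bot] at this
      exact (Submodule.mem_bot A).2 (M.incl_injective X (this.trans (map_zero _).symm))

theorem exists_simple_sub_le (X : M.GrSub) (hX : X ≠ ⊥) :
    ∃ Y ≤ X, (M.sub Y).IsSimple := by
  obtain ⟨Y, ⟨hY, hYX⟩, hmin⟩ := wellFounded_lt.has_min {Y : M.GrSub | Y ≠ ⊥ ∧ Y ≤ X}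
    ⟨X, hX, le_refl X⟩
  refine ⟨Y, hYX, isSimple_sub_of_minimal Y hY fun Z hZ => ?_⟩
  by_contra h
  exact hmin Z ⟨h, hZ.le.trans hYX⟩ hZ

theorem ne_bot_of_isSimple_sub {X : M.GrSub} (h : (M.sub X).IsSimple) : X ≠ ⊥ := by
  intro h'
  rw [eq_bot_iff_sub] at h'
  exact Submodule.nontrivial_iff_ne_bot.1 h.1 h'

theorem eq_bot_or_eq_of_isSimple_sub {X Y : M.GrSub} (h : (M.sub X).IsSimple) (hY : Y ≤ X) :
    Y = ⊥ ∨ Y = X := by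
  rcases h.2 ((M.incl X).comapSub Y) with h | h
  · left
    rw [eq_bot_iff_sub] at h ⊢
    rw [eq_bot_iff]
    intro y hy
    let y' : M.sub X := ⟨y, hY hy⟩
    have hy' : y' ∈ ((M.incl X).comapSub Y).1 := hy
    rw [h, Submodule.mem_bot] at hy'
    exact (Submodule.mem_bot A).2 (congrArg (M.incl X).1 hy')
  · right
    refine le_antisymm hY fun y hy => ?_
    have : (show M.sub X from (⟨y, hy⟩ : X.1)) ∈ ((M.incl X).comapSub Y).1 := by
      rw [h]; exact Submodule.mem_top
    exact this

/-! ### Uniform and local objects -/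

/-- Any two nonzero subobjects meet. -/
def IsUniform (M : GrMod 𝒜) : Prop :=
  ∀ X Y : M.GrSub, X ≠ ⊥ → Y ≠ ⊥ → infSub X Y ≠ ⊥

/-- There is a greatest proper subobject. -/
def IsLocal (M : GrMod 𝒜) : Prop :=
  ∃ X : M.GrSub, X ≠ ⊤ ∧ ∀ Y : M.GrSub, Y ≠ ⊤ → Y ≤ X

theorem Hom.iso_mapSub_top (f : N.Hom M) (hf : Function.Injective f.1) :
    N.Iso (M.sub (f.mapSub ⊤)) := by
  refine (f.cod (f.mapSub ⊤) fun x => ⟨x, Submodule.mem_top, rfl⟩).iso_of_bijective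
      ⟨fun x y h => hf (congrArg Subtype.val h), ?_⟩
  rintro ⟨_, x, -, rfl⟩
  exact ⟨x, rfl⟩

/-- Two simple subobjects of a uniform object meet, hence coincide, so the socle is the image of
`f`. -/
theorem IsUniform.soc_iso (hM : M.IsUniform) (hN : N.IsSimple) (f : N.Hom M)
    (hf : Function.Injective f.1) : (M.sub M.soc).Iso N := by
  have hm : (M.sub (f.mapSub ⊤)).IsSimple := hN.of_iso (f.iso_mapSub_top hf)
  have hsoc : M.soc = f.mapSub ⊤ := by
    apply Subtype.ext
    refine le_antisymm (iSup_le fun X => ?_)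
      (le_iSup (fun X : {X : M.GrSub // (M.sub X).IsSimple} => X.1.1) ⟨_, hm⟩)
    have h0 := hM X.1 (f.mapSub ⊤) (ne_bot_of_isSimple_sub X.2) (ne_bot_of_isSimple_sub hm)
    have h1 := (eq_bot_or_eq_of_isSimple_sub X.2 (Y := infSub X.1 (f.mapSub ⊤))
      (fun x hx => hx.1)).resolve_left h0
    rw [← h1]
    exact fun x hx => hx.2
  rw [hsoc]
  exact (f.iso_mapSub_top hf).symm

theorem IsUniform.of_injective (hN : N.IsUniform) (f : M.Hom N) (hf : Function.Injective f.1) :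
    M.IsUniform := by
  have hmap : ∀ X : M.GrSub, X ≠ ⊥ → f.mapSub X ≠ ⊥ := by
    intro X hX h
    apply hX
    rw [eq_bot_iff_sub] at h ⊢
    exact (Submodule.map_injective_of_injective hf) (h.trans (Submodule.map_bot f.1).symm)
  intro X Y hX hY h
  apply hN _ _ (hmap X hX) (hmap Y hY)
  rw [eq_bot_iff_sub] at h ⊢
  change X.1.map f.1 ⊓ Y.1.map f.1 = ⊥
  rw [← Submodule.map_inf f.1 hf]
  rw [show X.1 ⊓ Y.1 = ⊥ from h, Submodule.map_bot]

theorem Hom.eq_top_of_mapSub_eq_top (f : M.Hom N) {X : M.GrSub} (hk : f.ker ≤ X)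
    (h : f.mapSub X = ⊤) : X = ⊤ := by
  rw [eq_top_iff_sub] at h ⊢
  rw [eq_top_iff]
  intro x _
  have : f.1 x ∈ (f.mapSub X).1 := by rw [h]; exact Submodule.mem_top
  obtain ⟨y, hy, hyx⟩ := this
  have h1 : x - y ∈ X.1 := hk (show f.1 (x - y) = 0 by rw [map_sub, hyx, sub_self])
  simpa using X.1.add_mem h1 hy

theorem IsLocal.of_surjective (hM : M.IsLocal) (f : M.Hom N) (hf : Function.Surjective f.1)
    [Nontrivial N] : N.IsLocal := by
  obtain ⟨X, hX, hmax⟩ := hM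
  have hcomap : ∀ Y : N.GrSub, Y ≠ ⊤ → f.comapSub Y ≠ ⊤ := by
    intro Y hY h
    apply hY
    rw [eq_top_iff_sub] at h ⊢
    rw [eq_top_iff]
    intro y _
    obtain ⟨x, rfl⟩ := hf y
    have : x ∈ (f.comapSub Y).1 := by rw [h]; exact Submodule.mem_top
    exact this
  have hker : f.ker ≤ X := by
    have := hmax (f.comapSub ⊥) (hcomap ⊥ ?_)
    · exact this
    · intro h
      rw [eq_top_iff_sub] at h
      exact bot_ne_top (α := Submodule A N) h
  refine ⟨f.mapSub X, ?_, ?_⟩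
  · exact fun h => hX (f.eq_top_of_mapSub_eq_top hker h)
  · intro Y hY y hy
    obtain ⟨x, rfl⟩ := hf y
    exact ⟨x, hmax _ (hcomap Y hY) hy, rfl⟩

/-- A greatest proper subobject is the only maximal one. -/
theorem IsLocal.rad_eq {X : M.GrSub} (hX : X ≠ ⊤) (hmax : ∀ Y : M.GrSub, Y ≠ ⊤ → Y ≤ X) :
    M.rad = X := by
  have hco : ∀ Y : M.GrSub, IsCoatom Y ↔ Y = X := by
    intro Y
    constructor
    · intro hY
      by_contra h
      exact hX (hY.2 X (lt_of_le_of_ne (hmax Y hY.1) h))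
    · rintro rfl
      refine ⟨hX, fun Z hZ => ?_⟩
      by_contra h
      exact absurd (hmax Z h) (not_le_of_gt hZ)
  apply Subtype.ext
  refine le_antisymm (iInf_le (fun N : {N : M.GrSub // IsCoatom N} => N.1.1)
    ⟨X, (hco X).2 rfl⟩) (le_iInf fun Y => ?_)
  rw [(hco Y.1).1 Y.2]

/-- The kernel of an epimorphism onto a simple object is maximal, so it is the greatest proper
subobject. -/
theorem IsLocal.head_iso (hM : M.IsLocal) (hN : N.IsSimple) (f : M.Hom N)
    (hf : Function.Surjective f.1) : M.head.Iso N := by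
  obtain ⟨X, hX, hmax⟩ := hM
  have hrad := IsLocal.rad_eq hX hmax
  have hk : f.ker ≤ X := hmax _ fun h => by
    rw [eq_top_iff_sub] at h
    obtain ⟨y, hy⟩ := @exists_ne _ hN.1 (0 : N)
    obtain ⟨x, rfl⟩ := hf y
    have : x ∈ f.ker.1 := by rw [h]; exact Submodule.mem_top
    exact hy this
  have hker : f.ker = X := by
    refine le_antisymm hk ?_
    rcases hN.2 (f.mapSub X) with h | h
    · rw [eq_bot_iff_sub] at h
      intro x hx
      have : f.1 x ∈ (f.mapSub X).1 := ⟨x, hx, rfl⟩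
      rw [h, Submodule.mem_bot] at this
      exact this
    · exact absurd (f.eq_top_of_mapSub_eq_top hk h) hX
  refine quot_iso _ f hf fun x => ?_
  rw [hrad, ← hker]
  rfl

theorem IsLocal.isSimple_head (hM : M.IsLocal) : M.head.IsSimple := by
  obtain ⟨X, hX, hmax⟩ := hM
  have hrad := IsLocal.rad_eq hX hmax
  rw [head, hrad]
  have hX' : X.1 ≠ ⊤ := fun h => hX ((eq_top_iff_sub X).2 h)
  refine ⟨Submodule.Quotient.nontrivial_iff.2 hX', fun Y => ?_⟩
  by_cases hY : (M.mkQ X).comapSub Y = ⊤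
  · right
    rw [eq_top_iff_sub] at hY ⊢
    rw [eq_top_iff]
    intro y _
    obtain ⟨x, rfl⟩ := M.mkQ_surjective X y
    have : x ∈ ((M.mkQ X).comapSub Y).1 := by rw [hY]; exact Submodule.mem_top
    exact this
  · left
    have := hmax _ hY
    rw [eq_bot_iff_sub, eq_bot_iff]
    intro y hy
    obtain ⟨x, rfl⟩ := M.mkQ_surjective X y
    exact (Submodule.mem_bot A).2 ((M.mkQ_eq_zero X x).2 (this hy))

end Category

end GrMod

namespace GrMod

section Filtrations

variable {K A : Type u} [Field K] [Ring A] [Algebra K A] {𝒜 : ℤ → Submodule K A}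
  {M N L : GrMod 𝒜}

/-! ### Building filtrations -/

theorem finrank_sub_add_quot (X : M.GrSub) :
    Module.finrank K (M.sub X) + Module.finrank K (M.quot X) = Module.finrank K M := by
  have := Submodule.finrank_quotient_add_finrank (X.1.restrictScalars K)
  rw [add_comm]
  exact this

theorem factor_comap_iso (X : M.GrSub) (S S' : (M.quot X).GrSub) :
    (M.factor ((M.mkQ X).comapSub S) ((M.mkQ X).comapSub S')).Iso ((M.quot X).factor S S') := by
  let p : (M.sub ((M.mkQ X).comapSub S)).Hom ((M.quot X).sub S) :=
    ((M.mkQ X).comp (M.incl _)).cod S fun x => x.2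
  refine factor_iso _ _ ((mkQ _ _).comp p) ?_ ?_
  · intro y
    obtain ⟨z, rfl⟩ := mkQ_surjective _ _ y
    obtain ⟨x, hx⟩ := M.mkQ_surjective X (((M.quot X).incl S).1 z)
    have hxm : x ∈ ((M.mkQ X).comapSub S).1 := by
      change (M.mkQ X).1 x ∈ S.1
      rw [hx]
      exact z.2
    exact ⟨⟨x, hxm⟩, congrArg (mkQ ((M.quot X).sub S) _).1 (Subtype.ext hx)⟩
  · intro x
    exact mkQ_eq_zero _ _ _

/-- Pull the filtration of `M/X` back to `M`: its last step becomes `X`, and one more step `⊥` is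
appended, with subquotient `X`. -/
theorem exists_filtration_extend {C : GrMod 𝒜 → Prop} (hC : ∀ {M N}, M.Iso N → C M → C N)
    (X : M.GrSub) (hX : C (M.sub X)) (F : (M.quot X).Filtration)
    (hF : ∀ i < F.length, C (F.quotient i)) :
    ∃ F' : M.Filtration, ∀ i < F'.length, C (F'.quotient i) := by
  have hlast : (M.mkQ X).comapSub (F.step F.length) = X := by
    rw [F.step_length]
    apply Subtype.ext
    ext x
    exact M.mkQ_eq_zero X x
  refine ⟨{ length := F.length + 1
            step := fun i => if i ≤ F.length then (M.mkQ X).comapSub (F.step i) else ⊥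
            step_zero := by
              rw [if_pos (Nat.zero_le _), F.step_zero]
              rfl
            step_length := if_neg (by omega)
            step_le := ?_ }, ?_⟩
  · intro i hi
    by_cases h : i < F.length
    · rw [if_pos (by omega), if_pos (by omega)]
      intro x hx
      exact F.step_le i h hx
    · rw [if_neg (by omega)]
      exact bot_le
  · intro i hi
    change i < F.length + 1 at hi
    change C (M.factor (if i ≤ F.length then (M.mkQ X).comapSub (F.step i) else ⊥)
      (if i + 1 ≤ F.length then (M.mkQ X).comapSub (F.step (i + 1)) else ⊥))
    by_cases h : i < F.length
    · rw [if_pos (by omega), if_pos (by omega)]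
      exact hC (factor_comap_iso X _ _).symm (hF i h)
    · obtain rfl : i = F.length := by omega
      rw [if_pos (le_refl _), if_neg (by omega), hlast]
      refine hC (Iso.symm (factor_iso X ⊥ (Hom.id _) (fun x => ⟨x, rfl⟩) fun x => ?_)) hX
      constructor
      · intro h
        change x = 0 at h
        rw [h]
        exact (map_zero (M.incl X).1 : _)
      · intro h
        exact M.incl_injective X (((Submodule.mem_bot A).1 h).trans (map_zero _).symm)

/-- Induction on dimension, splitting off subobjects from the bottom. `C` is the condition on
subquotients, `D` the invariant inherited by the remaining quotient. It serves composition series,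
with trivial `D`, and standard filtrations, where `D` is numerical freeness. -/
theorem exists_filtration {C D : GrMod 𝒜 → Prop} (hC : ∀ {M N}, M.Iso N → C M → C N)
    (hD : ∀ M, D M → Nontrivial M → ∃ X : M.GrSub, Nontrivial (M.sub X) ∧ C (M.sub X) ∧
      D (M.quot X)) (M : GrMod 𝒜) (hM : D M) :
    ∃ F : M.Filtration, ∀ i < F.length, C (F.quotient i) := by
  induction hn : Module.finrank K M using Nat.strong_induction_on generalizing M with
  | _ n ih =>
    by_cases hnt : Nontrivial M
    · obtain ⟨X, hX, hCX, hDX⟩ := hD M hM hnt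
      have hpos : 0 < Module.finrank K (M.sub X) := Module.finrank_pos
      have := finrank_sub_add_quot X
      obtain ⟨F, hF⟩ := ih _ (by omega) (M.quot X) hDX rfl
      exact exists_filtration_extend hC X hCX F hF
    · rw [not_nontrivial_iff_subsingleton] at hnt
      refine ⟨⟨0, fun _ => ⊥, ?_, rfl, fun i hi => absurd hi (Nat.not_lt_zero i)⟩,
        fun i hi => absurd hi (Nat.not_lt_zero i)⟩
      rw [eq_top_iff_sub]
      exact Subsingleton.elim _ _

theorem exists_composition_series (M : GrMod 𝒜) :
    ∃ F : M.Filtration, ∀ i < F.length, (F.quotient i).IsSimple := by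
  refine exists_filtration (D := fun _ => True) (fun h h' => h'.of_iso h) ?_ M trivial
  intro M _ hM
  obtain ⟨Y, -, hY⟩ := exists_simple_sub_le (⊤ : M.GrSub) fun h => by
    rw [eq_bot_iff_sub] at h
    exact top_ne_bot (α := Submodule A M) h
  exact ⟨Y, hY.1, hY, trivial⟩

theorem Filtration.antitone (F : M.Filtration) {i j : ℕ} (hij : i ≤ j) (hj : j ≤ F.length) :
    F.step j ≤ F.step i := by
  induction j, hij using Nat.le_induction with
  | base => exact le_refl _
  | succ n hn ih => exact (F.step_le n (by omega)).trans (ih (by omega))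

/-! ### Projective and injective objects -/

/-- `P` is an injective object of `𝒢(A)`. -/
def IsInjective (P : GrMod 𝒜) : Prop :=
  ∀ (M N : GrMod 𝒜) (g : M.Hom N) (f : M.Hom P), Function.Injective g.1 →
    ∃ k : N.Hom P, ∀ x, k.1 (g.1 x) = f.1 x

theorem IsProjective.of_retract (hM : M.IsProjective) (s : N.Hom M) (r : M.Hom N)
    (h : ∀ x, r.1 (s.1 x) = x) : N.IsProjective := by
  intro X Y g f hg
  obtain ⟨k, hk⟩ := hM X Y g (f.comp r) hg
  refine ⟨k.comp s, fun x => (hk (s.1 x)).trans ?_⟩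
  exact congrArg f.1 (h x)

theorem IsInjective.of_retract (hM : M.IsInjective) (s : N.Hom M) (r : M.Hom N)
    (h : ∀ x, r.1 (s.1 x) = x) : N.IsInjective := by
  intro X Y g f hg
  obtain ⟨k, hk⟩ := hM X Y g (s.comp f) hg
  refine ⟨r.comp k, fun x => (congrArg r.1 (hk x)).trans ?_⟩
  exact h _

theorem Iso.exists_inverse (h : M.Iso N) : ∃ (s : N.Hom M) (r : M.Hom N),
    (∀ x, r.1 (s.1 x) = x) ∧ ∀ x, s.1 (r.1 x) = x := by
  obtain ⟨e, he⟩ := h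
  exact ⟨⟨e.symm.toLinearMap, fun i x hx => (he i _).2 (by simpa using hx)⟩,
    ⟨e.toLinearMap, fun i x => (he i x).1⟩, e.apply_symm_apply, e.symm_apply_apply⟩

theorem IsInjective.of_iso (hM : M.IsInjective) (h : M.Iso N) : N.IsInjective := by
  obtain ⟨s, r, hsr, -⟩ := h.exists_inverse
  exact hM.of_retract s r hsr

theorem IsProjective.of_iso (hM : M.IsProjective) (h : M.Iso N) : N.IsProjective := by
  obtain ⟨s, r, hsr, -⟩ := h.exists_inverse
  exact hM.of_retract s r hsr

theorem IsProjective.exists_section (hP : N.IsProjective) (q : M.Hom N)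
    (hq : Function.Surjective q.1) : ∃ s : N.Hom M, ∀ x, q.1 (s.1 x) = x :=
  hP M N q (Hom.id N) hq

theorem Hom.bijective_of_injective (f : M.Hom N) (hf : Function.Injective f.1)
    (h : Module.finrank K N ≤ Module.finrank K M) : Function.Bijective f.1 := by
  have h1 : Module.finrank K M = Module.finrank K N :=
    le_antisymm (LinearMap.finrank_le_finrank_of_injective (f := f.1.restrictScalars K) hf) h
  exact ⟨hf, (LinearMap.injective_iff_surjective_of_finrank_eq_finrank
    (f := f.1.restrictScalars K) h1).1 hf⟩

theorem Hom.bijective_of_surjective (f : M.Hom N) (hf : Function.Surjective f.1)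
    (h : Module.finrank K M ≤ Module.finrank K N) : Function.Bijective f.1 := by
  have h1 : Module.finrank K M = Module.finrank K N :=
    le_antisymm h (LinearMap.finrank_le_finrank_of_surjective (f := f.1.restrictScalars K) hf)
  exact ⟨(LinearMap.injective_iff_surjective_of_finrank_eq_finrank
    (f := f.1.restrictScalars K) h1).2 hf, hf⟩

theorem Hom.finrank_le_of_injective (f : M.Hom N) (hf : Function.Injective f.1) :
    Module.finrank K M ≤ Module.finrank K N :=
  LinearMap.finrank_le_finrank_of_injective (f := f.1.restrictScalars K) hf

theorem Hom.finrank_le_of_surjective (f : M.Hom N) (hf : Function.Surjective f.1) :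
    Module.finrank K N ≤ Module.finrank K M :=
  LinearMap.finrank_le_finrank_of_surjective (f := f.1.restrictScalars K) hf

/-- A minimal subobject `X` of `M` that still maps onto `N` is the cover: minimality makes it
essential, and it is projective because it is a retract of `M`. -/
theorem IsProjective.exists_projectiveCover (hM : M.IsProjective) (q : M.Hom N)
    (hq : Function.Surjective q.1) : ∃ P : GrMod 𝒜, P.IsProjectiveCover N := by
  obtain ⟨X, hX, hmin⟩ := wellFounded_lt.has_min {X : M.GrSub | q.mapSub X = ⊤}
    ⟨⊤, by
      rw [Set.mem_ofPred_eq, eq_top_iff_sub]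
      exact (Submodule.map_top q.1).trans (LinearMap.range_eq_top.2 hq)⟩
  rw [Set.mem_ofPred_eq, eq_top_iff_sub] at hX
  let qX : (M.sub X).Hom N := q.comp (M.incl X)
  have hqX : Function.Surjective qX.1 := by
    intro y
    have : y ∈ X.1.map q.1 := by rw [show X.1.map q.1 = ⊤ from hX]; exact Submodule.mem_top
    obtain ⟨x, hx, hxy⟩ := this
    exact ⟨⟨x, hx⟩, hxy⟩
  have hcover : ∀ Y : (M.sub X).GrSub, Y.1.map qX.1 = ⊤ → Y = ⊤ := by
    intro Y hY
    have h1 : q.mapSub ((M.incl X).mapSub Y) = ⊤ := by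
      rw [eq_top_iff_sub]
      exact (Submodule.map_comp (M.incl X).1 q.1 Y.1).symm.trans hY
    have h2 : (M.incl X).mapSub Y ≤ X := by
      rintro _ ⟨y, -, rfl⟩
      exact y.2
    have h3 : X ≤ (M.incl X).mapSub Y := by
      by_contra h
      exact hmin _ h1 (lt_of_le_not_ge h2 h)
    rw [eq_top_iff_sub, eq_top_iff]
    intro y _
    obtain ⟨z, hz, hzy⟩ := h3 y.2
    rwa [← M.incl_injective X hzy]
  -- Lift `q` through `X → N`. By minimality the restriction of the lift to `X` is onto, hence
  -- bijective by dimension; inverting it splits `k`.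
  obtain ⟨k, hk⟩ := hM (M.sub X) N qX q hqX
  have hs : Function.Surjective (k.comp (M.incl X)).1 := by
    have := hcover ((k.comp (M.incl X)).mapSub ⊤) (by
      rw [eq_top_iff]
      intro y _
      obtain ⟨x, hx⟩ := hqX y
      exact ⟨(k.comp (M.incl X)).1 x, ⟨x, Submodule.mem_top, rfl⟩,
        (hk ((M.incl X).1 x)).trans hx⟩)
    intro y
    rw [eq_top_iff_sub] at this
    have hy : y ∈ ((k.comp (M.incl X)).mapSub ⊤).1 := by rw [this]; exact Submodule.mem_top
    obtain ⟨x, -, hx⟩ := hy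
    exact ⟨x, hx⟩
  have hb := (k.comp (M.incl X)).bijective_of_surjective hs le_rfl
  obtain ⟨j, hj⟩ := (k.comp (M.incl X)).exists_desc hs (M.incl X) fun x hx => by
    rw [hb.1 (hx.trans (map_zero _).symm), map_zero]
  refine ⟨M.sub X, hM.of_retract j k ?_, qX, hqX, hcover⟩
  intro y
  obtain ⟨x, rfl⟩ := hs y
  rw [hj]
  rfl

/-- A lift of one cover through the other is onto because covers are essential. Surjections in both
directions force equal dimensions. -/
theorem IsProjectiveCover.unique {P P' : GrMod 𝒜} (h : P.IsProjectiveCover N)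
    (h' : P'.IsProjectiveCover N) : P.Iso P' := by
  have key : ∀ {P P' : GrMod 𝒜}, P.IsProjectiveCover N → P'.IsProjectiveCover N →
      ∃ k : P.Hom P', Function.Surjective k.1 := by
    rintro P P' ⟨hP, f, hf, -⟩ ⟨-, f', hf', hc⟩
    obtain ⟨k, hk⟩ := hP P' N f' f hf'
    refine ⟨k, ?_⟩
    have := hc (k.mapSub ⊤) (by
      rw [eq_top_iff]
      intro y _
      obtain ⟨x, rfl⟩ := hf y
      exact ⟨k.1 x, ⟨x, Submodule.mem_top, rfl⟩, hk x⟩)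
    rw [eq_top_iff_sub] at this
    intro y
    have hy : y ∈ (k.mapSub ⊤).1 := by rw [this]; exact Submodule.mem_top
    obtain ⟨x, -, hx⟩ := hy
    exact ⟨x, hx⟩
  obtain ⟨k, hk⟩ := key h h'
  obtain ⟨k', hk'⟩ := key h' h
  exact k.iso_of_bijective (k.bijective_of_surjective hk (k'.finrank_le_of_surjective hk'))

theorem IsProjectiveCover.of_iso {P P' : GrMod 𝒜} (h : P.IsProjectiveCover N) (e : P.Iso P') :
    P'.IsProjectiveCover N := by
  obtain ⟨hP, f, hf, hc⟩ := h
  obtain ⟨s, r, hsr, hrs⟩ := e.exists_inverse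
  refine ⟨hP.of_iso e, f.comp s, fun y => ?_, fun X hX => ?_⟩
  · obtain ⟨x, rfl⟩ := hf y
    exact ⟨r.1 x, congrArg f.1 (hrs x)⟩
  · have := hc (s.mapSub X) ((Submodule.map_comp s.1 f.1 X.1).symm.trans hX)
    rw [eq_top_iff_sub] at this ⊢
    rw [eq_top_iff]
    intro y _
    have hy : s.1 y ∈ (s.mapSub X).1 := by rw [this]; exact Submodule.mem_top
    obtain ⟨z, hz, hzy⟩ := hy
    rwa [← hsr y, ← hzy, hsr]

theorem IsProjectiveCover.of_iso_target {P N' : GrMod 𝒜} (h : P.IsProjectiveCover N)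
    (e : N.Iso N') : P.IsProjectiveCover N' := by
  obtain ⟨hP, f, hf, hc⟩ := h
  obtain ⟨g, hg⟩ := e.exists_hom
  refine ⟨hP, g.comp f, hg.2.comp hf, fun X hX => hc X ?_⟩
  rw [eq_top_iff]
  intro y _
  have hy : g.1 y ∈ X.1.map (g.comp f).1 := by rw [hX]; exact Submodule.mem_top
  obtain ⟨x, hx, hxy⟩ := hy
  exact ⟨x, hx, hg.1 hxy⟩

theorem IsProjectiveCover.isLocal {P : GrMod 𝒜} (h : P.IsProjectiveCover N) (hN : N.IsSimple) :
    P.IsLocal := by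
  obtain ⟨-, f, hf, hc⟩ := h
  refine ⟨f.ker, fun h => ?_, fun Y hY => ?_⟩
  · rw [eq_top_iff_sub] at h
    obtain ⟨y, hy⟩ := @exists_ne _ hN.1 (0 : N)
    obtain ⟨x, rfl⟩ := hf y
    have : x ∈ f.ker.1 := by rw [h]; exact Submodule.mem_top
    exact hy this
  · rcases hN.2 (f.mapSub Y) with h | h
    · rw [eq_bot_iff_sub] at h
      intro x hx
      have : f.1 x ∈ (f.mapSub Y).1 := ⟨x, hx, rfl⟩
      rw [h, Submodule.mem_bot] at this
      exact this
    · rw [eq_top_iff_sub] at h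
      exact absurd (hc Y h) hY

/-- If `X ∩ Y = 0`, then `X` embeds in `M/Y`, and injectivity gives an endomorphism `φ` that kills
`Y` and is the identity on `X`. For nonzero `X` and `Y` neither `φ` nor `1 - φ` is injective, so
neither is onto, and both images lie in the greatest proper subobject. Their sum is the identity, a
contradiction. -/
theorem IsLocal.isUniform (hM : M.IsLocal) (hI : M.IsInjective) : M.IsUniform := by
  obtain ⟨X0, hX0, hmax⟩ := hM
  intro X Y hX hY h
  rw [eq_bot_iff_sub] at h
  have hinj : Function.Injective ((M.mkQ Y).comp (M.incl X)).1 := by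
    rw [← LinearMap.ker_eq_bot, LinearMap.ker_eq_bot']
    intro x hx
    have h1 : (M.incl X).1 x ∈ Y.1 := (M.mkQ_eq_zero Y _).1 hx
    have h2 : (M.incl X).1 x ∈ (infSub X Y).1 := ⟨x.2, h1⟩
    rw [h, Submodule.mem_bot] at h2
    exact M.incl_injective X (h2.trans (map_zero _).symm)
  obtain ⟨g, hg⟩ := hI _ _ ((M.mkQ Y).comp (M.incl X)) (M.incl X) hinj
  let φ : M.Hom M := g.comp (M.mkQ Y)
  let ψ : M.Hom M := (Hom.id M).diff φ
  have hφY : ∀ y ∈ Y.1, φ.1 y = 0 := fun y hy =>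
    (congrArg g.1 ((M.mkQ_eq_zero Y y).2 hy)).trans (map_zero _)
  have hψX : ∀ x ∈ X.1, ψ.1 x = 0 := fun x hx => by
    change x - φ.1 x = 0
    rw [sub_eq_zero]
    exact (hg ⟨x, hx⟩).symm
  have hex : ∀ Z : M.GrSub, Z ≠ ⊥ → ∃ z ∈ Z.1, z ≠ 0 := fun Z hZ =>
    (Submodule.ne_bot_iff _).1 fun h => hZ ((eq_bot_iff_sub Z).2 h)
  have hns : ∀ (θ : M.Hom M) (Z : M.GrSub), Z ≠ ⊥ → (∀ z ∈ Z.1, θ.1 z = 0) → θ.mapSub ⊤ ≤ X0 := by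
    intro θ Z hZ hθ
    apply hmax
    intro h
    rw [eq_top_iff_sub] at h
    have hs : Function.Surjective θ.1 := by
      rw [← LinearMap.range_eq_top, ← Submodule.map_top]
      exact h
    obtain ⟨z, hz, hz0⟩ := hex Z hZ
    exact hz0 ((θ.bijective_of_surjective hs le_rfl).1 ((hθ z hz).trans (map_zero _).symm))
  apply hX0
  rw [eq_top_iff_sub, eq_top_iff]
  intro x _
  have h1 := hns φ Y hY hφY ⟨x, Submodule.mem_top, rfl⟩
  have h2 := hns ψ X hX hψX ⟨x, Submodule.mem_top, rfl⟩
  have := X0.1.add_mem h1 h2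
  change φ.1 x + (x - φ.1 x) ∈ X0.1 at this
  rwa [add_sub_cancel] at this

theorem IsUniform.injective_of_injective_comp (hM : M.IsUniform) (f : M.Hom N) (X : M.GrSub)
    (hX : X ≠ ⊥) (h : ∀ x ∈ X.1, f.1 x = 0 → x = 0) : Function.Injective f.1 := by
  by_contra hf
  have hk : f.ker ≠ ⊥ := by
    intro h'
    rw [eq_bot_iff_sub] at h'
    exact hf (LinearMap.ker_eq_bot.1 h')
  apply hM X f.ker hX hk
  rw [eq_bot_iff_sub, eq_bot_iff]
  intro x hx
  exact (Submodule.mem_bot A).2 (h x hx.1 hx.2)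

/-- Two uniform injective objects with a common simple subobject are isomorphic. -/
theorem IsUniform.iso_of_common_sub (hM : M.IsUniform) (hN : N.IsUniform) (hMI : M.IsInjective)
    (hNI : N.IsInjective) [Nontrivial L] (f : L.Hom M) (g : L.Hom N)
    (hf : Function.Injective f.1) (hg : Function.Injective g.1) : M.Iso N := by
  -- Injectivity of `N` extends `g` along `f`; the extension is injective because a nonzero kernel
  -- would meet the image of `L`.
  have key : ∀ {M N : GrMod 𝒜}, M.IsUniform → N.IsInjective → ∀ (f : L.Hom M) (g : L.Hom N),
      Function.Injective f.1 → Function.Injective g.1 →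
      ∃ k : M.Hom N, Function.Injective k.1 := by
    intro M N hM hNI f g hf hg
    obtain ⟨k, hk⟩ := hNI L M f g hf
    refine ⟨k, hM.injective_of_injective_comp k (f.mapSub ⊤) (fun h => ?_) ?_⟩
    · obtain ⟨x, hx⟩ := exists_ne (0 : L)
      rw [eq_bot_iff_sub] at h
      have : f.1 x ∈ (f.mapSub ⊤).1 := ⟨x, Submodule.mem_top, rfl⟩
      rw [h, Submodule.mem_bot] at this
      exact hx (hf (this.trans (map_zero _).symm))
    · rintro _ ⟨x, -, rfl⟩ hx
      rw [hk] at hx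
      rw [hg (hx.trans (map_zero _).symm), map_zero]
  obtain ⟨k, hk⟩ := key hM hNI f g hf hg
  obtain ⟨k', hk'⟩ := key hN hMI g f hg hf
  exact k.iso_of_bijective (k.bijective_of_injective hk (k'.finrank_le_of_injective hk'))

/-! ### Graded versus ungraded projectivity and injectivity -/

/-- The part of degree zero of an `A`-linear map between graded modules. -/
theorem exists_degree_zero_part [GradedAlgebra 𝒜] (k : M →ₗ[A] N) :
    ∃ k0 : M.Hom N, ∀ i, ∀ x ∈ M.gr i, k0.1 x = N.proj i (k x) := by
  let g : M →ₗ[K] N := DirectSum.toModule K ℤ N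
    (fun i => N.proj i ∘ₗ k.restrictScalars K ∘ₗ (M.gr i).subtype) ∘ₗ M.sumEquiv.symm.toLinearMap
  have hg : ∀ i, ∀ x ∈ M.gr i, g x = N.proj i (k x) := by
    intro i x hx
    simp [g, M.symm_of_mem i x hx]
  have hsmul : ∀ (a : A) (x : M), g (a • x) = a • g x := by
    intro a
    induction a using DirectSum.Decomposition.inductionOn 𝒜 with
    | zero => intro x; rw [zero_smul, zero_smul, map_zero]
    | @homogeneous j a =>
      have : g ∘ₗ Algebra.lsmul K K M a.1 = Algebra.lsmul K K N a.1 ∘ₗ g := by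
        apply proj_ext M
        intro i x hx
        simp only [LinearMap.comp_apply, Algebra.lsmul_coe]
        rw [hg i x hx, hg (j + i) _ (M.smul_mem j i _ x a.2 hx), map_smul,
          N.proj_smul j (j + i) _ a.2, add_sub_cancel_left]
      exact fun x => LinearMap.congr_fun this x
    | add a b ha hb => intro x; rw [add_smul, add_smul, map_add, ha, hb]
  refine ⟨⟨{ g with map_smul' := hsmul }, fun i x hx => ?_⟩, hg⟩
  change g x ∈ N.gr i
  rw [hg i x hx]
  exact N.proj_mem i _

theorem Hom.ext_of_gr {f g : M.Hom N} (h : ∀ i, ∀ x ∈ M.gr i, f.1 x = g.1 x) (x : M) :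
    f.1 x = g.1 x :=
  LinearMap.congr_fun (proj_ext M (f.1.restrictScalars K) (g.1.restrictScalars K) h) x

/-- The degree-zero part of an ungraded lift is still a lift, since the maps of the lifting problem
have degree zero. -/
theorem isProjective_of_module [GradedAlgebra 𝒜] [Module.Projective A M] : M.IsProjective := by
  intro X Y g f hg
  obtain ⟨k, hk⟩ := Module.projective_lifting_property g.1 f.1 hg
  obtain ⟨k0, hk0⟩ := exists_degree_zero_part (M := M) (N := X) k
  refine ⟨k0, Hom.ext_of_gr (f := g.comp k0) (g := f) fun i x hx => ?_⟩
  change g.1 (k0.1 x) = f.1 x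
  rw [hk0 i x hx, g.map_proj, ← LinearMap.comp_apply, hk]
  exact Y.proj_self i _ (f.2 i x hx)

theorem isInjective_of_module [GradedAlgebra 𝒜] (h : Module.Injective A M) : M.IsInjective := by
  intro X Y g f hg
  obtain ⟨k, hk⟩ := h.out g.1 hg f.1
  obtain ⟨k0, hk0⟩ := exists_degree_zero_part (M := Y) (N := M) k
  refine ⟨k0, Hom.ext_of_gr (f := k0.comp g) (g := f) fun i x hx => ?_⟩
  change k0.1 (g.1 x) = f.1 x
  rw [hk0 i _ (g.2 i x hx), hk]
  exact M.proj_self i _ (f.2 i x hx)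

theorem isProjective_tensor [GradedAlgebra 𝒜] [FiniteDimensional K A] {B : Type u} [Ring B]
    [Algebra K B] {ℬ : ℤ → Submodule K B} (V : GrMod ℬ) : (tensor 𝒜 V).IsProjective := by
  have : Module.Projective A (tensor 𝒜 V) := inferInstanceAs (Module.Projective A (A ⊗[K] V))
  exact isProjective_of_module

/-- Over `A` the module `A ⊗ V` is free of finite rank, so self-injectivity of `A` extends maps
coordinate by coordinate. -/
theorem isInjective_tensor [GradedAlgebra 𝒜] [FiniteDimensional K A] {B : Type u} [Ring B]
    [Algebra K B] {ℬ : ℤ → Submodule K B} (V : GrMod ℬ) (hA : Module.Injective A A) :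
    (tensor 𝒜 V).IsInjective := by
  refine isInjective_of_module ⟨fun X Y _ _ _ _ f hf g => ?_⟩
  let b := Algebra.TensorProduct.basis A (Module.finBasis K V)
  have hc : ∀ i, ∃ h : Y →ₗ[A] A, ∀ x, h (f x) = b.repr (g x) i := fun i =>
    hA.out f hf (b.coord i ∘ₗ g)
  choose h hh using hc
  refine ⟨b.equivFun.symm.toLinearMap ∘ₗ LinearMap.pi h, fun x => ?_⟩
  exact (LinearEquiv.symm_apply_eq b.equivFun).2 (funext fun i => hh i x)

end Filtrations

end GrMod

namespace GrMod

section Duality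

variable {K A B : Type u} [Field K] [Ring A] [Algebra K A] [Ring B] [Algebra K B]
  {𝒜 : ℤ → Submodule K A} {ℬ : ℤ → Submodule K B}
  (φ : A ≃ₐ[K] Bᵐᵒᵖ) (hφ : ∀ i, ∀ a ∈ 𝒜 i, (φ a).unop ∈ ℬ (-i))
  (ψ : B ≃ₐ[K] Aᵐᵒᵖ)

/-! ### Duality as a functor -/

theorem dual_ext {M : GrMod ℬ} {f g : M.dual φ hφ}
    (h : ∀ x, dualEquiv φ hφ M f x = dualEquiv φ hφ M g x) : f = g :=
  (dualEquiv φ hφ M).injective (LinearMap.ext h)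

theorem eq_zero_of_dual {M : GrMod ℬ} {x : M}
    (h : ∀ f : M.dual φ hφ, dualEquiv φ hφ M f x = 0) : x = 0 :=
  (Module.forall_dual_apply_eq_zero_iff K x).1 fun f => h f

/-- A morphism `N → M*` is a balanced pairing of `N` with `M`; read in the other variable it is a
morphism `M → N*`. -/
theorem exists_adj (hψ : ∀ i, ∀ b ∈ ℬ i, (ψ b).unop ∈ 𝒜 (-i))
    (hφψ : ∀ b, (φ (ψ b).unop).unop = b) {M : GrMod ℬ} {N : GrMod 𝒜}
    (g : N.Hom (M.dual φ hφ)) : ∃ k : M.Hom (N.dual ψ hψ), ∀ m n,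
      dualEquiv ψ hψ N (k.1 m) n = dualEquiv φ hφ M (g.1 n) m := by
  let gK : N →ₗ[K] Module.Dual K M := (dualEquiv φ hφ M).toLinearMap ∘ₗ g.1.restrictScalars K
  let k0 : M →ₗ[K] N.dual ψ hψ := (dualEquiv ψ hψ N).symm.toLinearMap ∘ₗ gK.flip
  have hk0 : ∀ m n, dualEquiv ψ hψ N (k0 m) n = dualEquiv φ hφ M (g.1 n) m := fun m n => rfl
  refine ⟨⟨{ k0 with map_smul' := fun b m => ?_ }, fun i m hm j hj n hn => ?_⟩, hk0⟩
  · apply dual_ext ψ hψ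
    intro n
    change dualEquiv ψ hψ N (k0 (b • m)) n = dualEquiv ψ hψ N (b • k0 m) n
    rw [dual_smul_apply, hk0, hk0, g.1.map_smul, dual_smul_apply, hφψ]
  · exact g.2 j n hn i (Ne.symm hj) m hm

/-- The transpose of an injection is onto, and in finite dimension every functional on `M*` is
evaluation at an element of `M`. -/
theorem adj_surjective (hψ : ∀ i, ∀ b ∈ ℬ i, (ψ b).unop ∈ 𝒜 (-i))
    {M : GrMod ℬ} {N : GrMod 𝒜} (g : N.Hom (M.dual φ hφ))
    (k : M.Hom (N.dual ψ hψ))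
    (hk : ∀ m n, dualEquiv ψ hψ N (k.1 m) n = dualEquiv φ hφ M (g.1 n) m)
    (hg : Function.Injective g.1) : Function.Surjective k.1 := by
  let gK : N →ₗ[K] Module.Dual K M := (dualEquiv φ hφ M).toLinearMap ∘ₗ g.1.restrictScalars K
  have hs := LinearMap.dualMap_surjective_of_injective (f := gK) hg
  intro ξ
  obtain ⟨η, hη⟩ := hs (dualEquiv ψ hψ N ξ)
  refine ⟨(Module.evalEquiv K M).symm η, dual_ext ψ hψ fun n => ?_⟩
  rw [hk, ← hη]
  exact (Module.apply_evalEquiv_symm_apply K M (gK n) η)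

theorem adj_injective (hψ : ∀ i, ∀ b ∈ ℬ i, (ψ b).unop ∈ 𝒜 (-i))
    {M : GrMod ℬ} {N : GrMod 𝒜} (g : N.Hom (M.dual φ hφ))
    (k : M.Hom (N.dual ψ hψ))
    (hk : ∀ m n, dualEquiv ψ hψ N (k.1 m) n = dualEquiv φ hφ M (g.1 n) m)
    (hg : Function.Surjective g.1) : Function.Injective k.1 := by
  rw [← LinearMap.ker_eq_bot, LinearMap.ker_eq_bot']
  intro m hm
  apply eq_zero_of_dual φ hφ
  intro f
  obtain ⟨n, rfl⟩ := hg f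
  rw [← hk, hm, map_zero]
  rfl

theorem exists_dualMap {M N : GrMod ℬ} (f : M.Hom N) :
    ∃ k : (N.dual φ hφ).Hom (M.dual φ hφ), ∀ ξ m,
      dualEquiv φ hφ M (k.1 ξ) m = dualEquiv φ hφ N ξ (f.1 m) := by
  let k0 : N.dual φ hφ →ₗ[K] M.dual φ hφ := (dualEquiv φ hφ M).symm.toLinearMap ∘ₗ
    (f.1.restrictScalars K).dualMap ∘ₗ (dualEquiv φ hφ N).toLinearMap
  have hk0 : ∀ ξ m, dualEquiv φ hφ M (k0 ξ) m = dualEquiv φ hφ N ξ (f.1 m) := fun ξ m => rfl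
  refine ⟨⟨{ k0 with map_smul' := fun a ξ => ?_ }, fun i ξ hξ j hj m hm => ?_⟩, hk0⟩
  · apply dual_ext φ hφ
    intro m
    change dualEquiv φ hφ M (k0 (a • ξ)) m = dualEquiv φ hφ M (a • k0 ξ) m
    rw [dual_smul_apply, hk0, hk0, dual_smul_apply, f.1.map_smul]
  · exact hξ j hj _ (f.2 j m hm)

theorem dualMap_injective {M N : GrMod ℬ} (f : M.Hom N) (k : (N.dual φ hφ).Hom (M.dual φ hφ))
    (hk : ∀ ξ m, dualEquiv φ hφ M (k.1 ξ) m = dualEquiv φ hφ N ξ (f.1 m))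
    (hf : Function.Surjective f.1) : Function.Injective k.1 := by
  rw [← LinearMap.ker_eq_bot, LinearMap.ker_eq_bot']
  intro ξ hξ
  apply dual_ext φ hφ
  intro n
  obtain ⟨m, rfl⟩ := hf n
  rw [← hk, hξ, map_zero, map_zero]
  rfl

theorem dualMap_surjective {M N : GrMod ℬ} (f : M.Hom N) (k : (N.dual φ hφ).Hom (M.dual φ hφ))
    (hk : ∀ ξ m, dualEquiv φ hφ M (k.1 ξ) m = dualEquiv φ hφ N ξ (f.1 m))
    (hf : Function.Injective f.1) : Function.Surjective k.1 := by
  have hs := LinearMap.dualMap_surjective_of_injective (f := f.1.restrictScalars K) hf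
  intro η
  obtain ⟨ξ, hξ⟩ := hs (dualEquiv φ hφ M η)
  refine ⟨(dualEquiv φ hφ N).symm ξ, dual_ext φ hφ fun m => ?_⟩
  rw [hk, ← hξ]
  rfl

theorem Iso.dual {M N : GrMod ℬ} (h : M.Iso N) : (M.dual φ hφ).Iso (N.dual φ hφ) := by
  obtain ⟨f, hf⟩ := h.exists_hom
  obtain ⟨k, hk⟩ := exists_dualMap φ hφ f
  exact Iso.symm (k.iso_of_bijective
    ⟨dualMap_injective φ hφ f k hk hf.2, dualMap_surjective φ hφ f k hk hf.1⟩)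

/-- Evaluation is the adjoint of the identity of `N*`. -/
theorem exists_bidual (hψ : ∀ i, ∀ b ∈ ℬ i, (ψ b).unop ∈ 𝒜 (-i))
    (hψφ : ∀ a, (ψ (φ a).unop).unop = a) (N : GrMod 𝒜) :
    ∃ ev : N.Hom ((N.dual ψ hψ).dual φ hφ), Function.Bijective ev.1 ∧
      ∀ n ξ, dualEquiv φ hφ (N.dual ψ hψ) (ev.1 n) ξ = dualEquiv ψ hψ N ξ n := by
  obtain ⟨k, hk⟩ := exists_adj ψ hψ φ hφ hψφ (Hom.id (N.dual ψ hψ))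
  exact ⟨k, ⟨adj_injective ψ hψ φ hφ (Hom.id (N.dual ψ hψ)) k hk Function.surjective_id,
    adj_surjective ψ hψ φ hφ (Hom.id (N.dual ψ hψ)) k hk Function.injective_id⟩, hk⟩

theorem bidual_iso (hψ : ∀ i, ∀ b ∈ ℬ i, (ψ b).unop ∈ 𝒜 (-i))
    (hψφ : ∀ a, (ψ (φ a).unop).unop = a) (N : GrMod 𝒜) :
    N.Iso ((N.dual ψ hψ).dual φ hφ) := by
  obtain ⟨ev, hev, -⟩ := exists_bidual φ hφ ψ hψ hψφ N
  exact ev.iso_of_bijective hev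

/-! ### Duals of projective and injective objects -/

/-- By adjunction an extension problem into `P*` becomes a lifting problem out of `P`. -/
theorem IsProjective.dual (hψ : ∀ i, ∀ b ∈ ℬ i, (ψ b).unop ∈ 𝒜 (-i))
    (hφψ : ∀ b, (φ (ψ b).unop).unop = b)
    (hψφ : ∀ a, (ψ (φ a).unop).unop = a) {P : GrMod ℬ}
    (hP : P.IsProjective) : (P.dual φ hφ).IsInjective := by
  intro M N g f hg
  obtain ⟨f', hf'⟩ := exists_adj φ hφ ψ hψ hφψ f
  obtain ⟨g', hg'⟩ := exists_dualMap ψ hψ g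
  obtain ⟨k, hk⟩ := hP _ _ g' f' (dualMap_surjective ψ hψ g g' hg' hg)
  obtain ⟨k', hk'⟩ := exists_adj ψ hψ φ hφ hψφ k
  refine ⟨k', fun x => dual_ext φ hφ fun p => ?_⟩
  rw [hk', ← hf', ← hg', hk]

theorem IsInjective.dual (hψ : ∀ i, ∀ b ∈ ℬ i, (ψ b).unop ∈ 𝒜 (-i))
    (hφψ : ∀ b, (φ (ψ b).unop).unop = b)
    (hψφ : ∀ a, (ψ (φ a).unop).unop = a) {P : GrMod ℬ}
    (hP : P.IsInjective) : (P.dual φ hφ).IsProjective := by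
  intro M N g f hg
  obtain ⟨f', hf'⟩ := exists_dualMap ψ hψ f
  obtain ⟨g', hg'⟩ := exists_dualMap ψ hψ g
  -- The dualized problem has target `P**`, so `P` is replaced by its bidual; its solution lands in
  -- `M**` and is brought back along `M ≅ M**`.
  obtain ⟨k, hk⟩ := (hP.of_iso (bidual_iso ψ hψ φ hφ hφψ P)) _ _ g' f'
    (dualMap_injective ψ hψ g g' hg' hg)
  obtain ⟨k', hk'⟩ := exists_adj ψ hψ φ hφ hψφ k
  obtain ⟨ev, hev, hev'⟩ := exists_bidual φ hφ ψ hψ hψφ M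
  obtain ⟨e, he⟩ := ev.exists_desc hev.2 (Hom.id M) fun x hx =>
    hev.1 (hx.trans (map_zero _).symm)
  have hee : ∀ y, ev.1 (e.1 y) = y := by
    intro y
    obtain ⟨x, rfl⟩ := hev.2 y
    rw [he]
    rfl
  refine ⟨e.comp k', fun x => eq_zero_of_dual ψ hψ (fun ξ => ?_) |> sub_eq_zero.1⟩
  change dualEquiv ψ hψ N ξ (g.1 (e.1 (k'.1 x)) - f.1 x) = 0
  rw [map_sub, sub_eq_zero, ← hg', ← hev', hee, hk', hk, hf']

/-! ### Annihilators -/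

/-- The annihilator in `M` of a graded submodule of the dual of `M`. -/
def perpSub {M : GrMod ℬ} (X : (M.dual φ hφ).GrSub) : M.GrSub :=
  ⟨{ carrier := {x | ∀ f ∈ X.1, dualEquiv φ hφ M f x = 0}
     zero_mem' := fun f _ => map_zero _
     add_mem' := fun {x y} hx hy f hf => by rw [map_add, hx f hf, hy f hf, add_zero]
     smul_mem' := fun b x hx f hf => by
        have h2 := hx _ (X.1.smul_mem (φ.symm (MulOpposite.op b)) hf)
        rw [dual_smul_apply] at h2
        simpa using h2 },
    fun x hx i f hf => by
      have h2 := hx _ (X.2 f hf i)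
      rw [dual_proj_apply] at h2
      exact h2⟩

/-- In finite dimension a subspace of the dual is its own double annihilator. -/
theorem mem_of_forall_perpSub {M : GrMod ℬ} (X : (M.dual φ hφ).GrSub) (f : M.dual φ hφ)
    (hf : ∀ x ∈ (perpSub φ hφ X).1, dualEquiv φ hφ M f x = 0) : f ∈ X.1 := by
  let U : Submodule K (Module.Dual K M) :=
    (X.1.restrictScalars K).map (dualEquiv φ hφ M).toLinearMap
  have hU : U.dualCoannihilator.dualAnnihilator = U :=
    Subspace.dualCoannihilator_dualAnnihilator_eq
  have : dualEquiv φ hφ M f ∈ U := by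
    rw [← hU, Submodule.mem_dualAnnihilator]
    intro x hx
    rw [Submodule.mem_dualCoannihilator] at hx
    exact hf x fun g hg => hx _ ⟨g, hg, rfl⟩
  obtain ⟨g, hg, hgf⟩ := this
  rwa [← (dualEquiv φ hφ M).injective hgf]

theorem perpSub_anti {M : GrMod ℬ} {X Y : (M.dual φ hφ).GrSub} (h : X ≤ Y) :
    perpSub φ hφ Y ≤ perpSub φ hφ X := fun _ hx f hf => hx f (h hf)

/-- Restricting functionals from `Y` to the annihilator of `X` embeds the quotient of `Y` by `X`
into the dual of that annihilator. The transposed map is onto, with kernel the elements also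
annihilated by `Y`. -/
theorem perp_factor_iso (hψ : ∀ i, ∀ b ∈ ℬ i, (ψ b).unop ∈ 𝒜 (-i))
    (hφψ : ∀ b, (φ (ψ b).unop).unop = b) {M : GrMod ℬ}
    (X Y : (M.dual φ hφ).GrSub) :
    (M.factor (perpSub φ hφ X) (perpSub φ hφ Y)).Iso
      (((M.dual φ hφ).factor Y X).dual ψ hψ) := by
  obtain ⟨r, hr⟩ := exists_dualMap φ hφ (M.incl (perpSub φ hφ X))
  let q := mkQ ((M.dual φ hφ).sub Y) (((M.dual φ hφ).incl Y).comapSub X)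
  have hq : ∀ ξ, q.1 ξ = 0 ↔ ((M.dual φ hφ).incl Y).1 ξ ∈ X.1 := fun ξ => mkQ_eq_zero _ _ ξ
  obtain ⟨d, hd⟩ := q.exists_desc (mkQ_surjective _ _) (r.comp ((M.dual φ hφ).incl Y))
    fun ξ hξ => by
      apply dual_ext φ hφ
      intro x
      exact (hr _ x).trans (x.2 _ ((hq ξ).1 hξ))
  have hdinj : Function.Injective d.1 := by
    rw [← LinearMap.ker_eq_bot, LinearMap.ker_eq_bot']
    intro η hη
    obtain ⟨ξ, rfl⟩ := mkQ_surjective _ _ η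
    refine (hq ξ).2 (mem_of_forall_perpSub φ hφ X _ fun x hx => ?_)
    have h1 := hr (((M.dual φ hφ).incl Y).1 ξ) ⟨x, hx⟩
    have h2 : r.1 (((M.dual φ hφ).incl Y).1 ξ) = 0 := (hd ξ).symm.trans hη
    rw [h2, map_zero] at h1
    exact h1.symm
  obtain ⟨k, hk⟩ := exists_adj φ hφ ψ hψ hφψ d
  have hker : ∀ x, k.1 x = 0 ↔ (M.incl (perpSub φ hφ X)).1 x ∈ (perpSub φ hφ Y).1 := by
    refine fun x => ⟨fun hx f hf => ?_, fun hx => dual_ext ψ hψ fun η => ?_⟩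
    · let f' : (M.dual φ hφ).sub Y := ⟨f, hf⟩
      have h1 := hk x (q.1 f')
      rw [hx, map_zero, hd f'] at h1
      exact (hr f x).symm.trans h1.symm
    · obtain ⟨ξ, rfl⟩ := mkQ_surjective _ _ η
      rw [hk, map_zero]
      refine (congrArg (fun z => dualEquiv φ hφ _ z x) (hd ξ)).trans ?_
      exact (hr _ x).trans (hx _ ξ.2)
  exact factor_iso _ _ k (adj_surjective φ hφ ψ hψ d k hk hdinj) hker

/-- A filtration of the dual of `M` gives a filtration of `M` with the dual subquotients. -/
theorem exists_filtration_of_dual (hψ : ∀ i, ∀ b ∈ ℬ i, (ψ b).unop ∈ 𝒜 (-i))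
    (hφψ : ∀ b, (φ (ψ b).unop).unop = b) {M : GrMod ℬ}
    (F : (M.dual φ hφ).Filtration) : ∃ F' : M.Filtration, F'.length = F.length ∧
      ∀ i < F.length, (F'.quotient i).Iso ((F.quotient (F.length - 1 - i)).dual ψ hψ) := by
  refine ⟨{ length := F.length
            -- Annihilators reverse inclusions, so the steps are traversed backwards; subquotient
            -- `i` comes from subquotient `length - 1 - i`.
            step := fun i => perpSub φ hφ (F.step (F.length - i))
            step_zero := ?_
            step_length := ?_
            step_le := ?_ }, rfl, ?_⟩
  · rw [Nat.sub_zero, F.step_length, eq_top_iff_sub, eq_top_iff]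
    intro x _ f hf
    rw [(Submodule.mem_bot A).1 hf, map_zero]
    rfl
  · rw [Nat.sub_self, F.step_zero, eq_bot_iff_sub, eq_bot_iff]
    intro x hx
    exact (Submodule.mem_bot B).2 (eq_zero_of_dual φ hφ fun f => hx f Submodule.mem_top)
  · intro i hi
    apply perpSub_anti
    have := F.step_le (F.length - (i + 1)) (by omega)
    rwa [show F.length - (i + 1) + 1 = F.length - i by omega] at this
  · intro i hi
    have := perp_factor_iso φ hφ ψ hψ hφψ (F.step (F.length - i)) (F.step (F.length - (i + 1)))
    rw [Filtration.quotient, Filtration.quotient, show F.length - 1 - i = F.length - (i + 1) by omega,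
      show F.length - (i + 1) + 1 = F.length - i by omega]
    exact this

/-- The dual of an injective hull is a projective cover. If `X ⊆ P*` maps onto `S*`, its annihilator
meets the image of `S` in zero, so it vanishes by uniformity and `X = P*`. -/
theorem isProjectiveCover_dual (hψ : ∀ i, ∀ b ∈ ℬ i, (ψ b).unop ∈ 𝒜 (-i))
    (hφψ : ∀ b, (φ (ψ b).unop).unop = b)
    (hψφ : ∀ a, (ψ (φ a).unop).unop = a) {P S : GrMod ℬ} (hP : P.IsInjective)
    (hU : P.IsUniform) (hS : Nontrivial S) (f : S.Hom P) (hf : Function.Injective f.1) :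
    (P.dual φ hφ).IsProjectiveCover (S.dual φ hφ) := by
  obtain ⟨k, hk⟩ := exists_dualMap φ hφ f
  refine ⟨hP.dual φ hφ ψ hψ hφψ hψφ, k, dualMap_surjective φ hφ f k hk hf, fun X hX => ?_⟩
  have hfS : f.mapSub ⊤ ≠ ⊥ := by
    intro h
    obtain ⟨x, hx⟩ := exists_ne (0 : S)
    rw [eq_bot_iff_sub] at h
    have : f.1 x ∈ (f.mapSub ⊤).1 := ⟨x, Submodule.mem_top, rfl⟩
    rw [h, Submodule.mem_bot] at this
    exact hx (hf (this.trans (map_zero _).symm))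
  have hbot : perpSub φ hφ X = ⊥ := by
    by_contra h
    apply hU _ _ hfS h
    rw [eq_bot_iff_sub, eq_bot_iff]
    rintro _ ⟨⟨s, -, rfl⟩, hs⟩
    have : s = 0 := by
      apply eq_zero_of_dual φ hφ
      intro η
      have hη : η ∈ X.1.map k.1 := by rw [hX]; exact Submodule.mem_top
      obtain ⟨ξ, hξ, rfl⟩ := hη
      rw [hk]
      exact hs ξ hξ
    rw [this, map_zero]
    exact Submodule.zero_mem _
  rw [eq_top_iff_sub, eq_top_iff]
  intro ξ _
  refine mem_of_forall_perpSub φ hφ X ξ fun x hx => ?_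
  rw [hbot] at hx
  rw [(Submodule.mem_bot B).1 hx, map_zero]

end Duality

end GrMod

namespace GradedTriple

/-! ### Numerical freeness over `A⁻` -/

/-- The part of the axioms of a triangular decomposition on which highest weight theory rests. -/
structure IsWeaklyTriangular {K A : Type u} [Field K] [Ring A] [Algebra K A]
    {𝒜 : ℤ → Submodule K A} (τ : GradedTriple 𝒜) : Prop where
  mul_bijective : Function.Bijective τ.mulMap
  neg_zero : τ.neg.toSubmodule ⊓ 𝒜 0 = (⊥ : Subalgebra K A).toSubmodule
  pos_zero : τ.pos.toSubmodule ⊓ 𝒜 0 = (⊥ : Subalgebra K A).toSubmodule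

theorem IsTriangularDecomposition.isWeaklyTriangular {K A : Type u} [Field K] [Ring A]
    [Algebra K A] {𝒜 : ℤ → Submodule K A} {τ : GradedTriple 𝒜}
    (h : τ.IsTriangularDecomposition) : τ.IsWeaklyTriangular :=
  ⟨h.mul_bijective, h.neg_zero, h.pos_zero⟩

theorem finrank_map₂_le {K V W X : Type*} [Field K] [AddCommGroup V] [AddCommGroup W]
    [AddCommGroup X] [Module K V] [Module K W] [Module K X] (f : V →ₗ[K] W →ₗ[K] X)
    (p : Submodule K V) (q : Submodule K W) [FiniteDimensional K p] [FiniteDimensional K q] :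
    Module.finrank K (Submodule.map₂ f p q) ≤ Module.finrank K p * Module.finrank K q := by
  rw [TensorProduct.map₂_eq_range_lift_comp_mapIncl, ← Module.finrank_tensorProduct]
  exact LinearMap.finrank_range_le _

variable {K A : Type u} [Field K] [Ring A] [Algebra K A] {𝒜 : ℤ → Submodule K A}
  {τ : GradedTriple 𝒜}

/-- Since A⁻₀ = K, membership of all of `A⁻` in a subspace is tested on `1` and on negative degrees.
-/
theorem IsWeaklyTriangular.neg_le (hτ : τ.IsWeaklyTriangular) (S : Submodule K A) (h1 : 1 ∈ S)
    (h : ∀ j < 0, ∀ a ∈ τ.neg, a ∈ 𝒜 j → a ∈ S) : τ.neg.toSubmodule ≤ S := by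
  refine τ.neg_le.trans (iSup_le fun i a ha => ?_)
  by_cases hi : i = 0
  · subst hi
    rw [Nat.cast_zero, _root_.neg_zero, hτ.neg_zero] at ha
    obtain ⟨c, rfl⟩ := Algebra.mem_bot.1 ha
    rw [Algebra.algebraMap_eq_smul_one]
    exact S.smul_mem c h1
  · exact h (-i) (by omega) a ha.1 ha.2

theorem IsWeaklyTriangular.pos_le (hτ : τ.IsWeaklyTriangular) (S : Submodule K A) (h1 : 1 ∈ S)
    (h : ∀ j > 0, ∀ a ∈ τ.pos, a ∈ 𝒜 j → a ∈ S) : τ.pos.toSubmodule ≤ S := by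
  refine τ.pos_le.trans (iSup_le fun i a ha => ?_)
  by_cases hi : i = 0
  · subst hi
    rw [Nat.cast_zero, hτ.pos_zero] at ha
    obtain ⟨c, rfl⟩ := Algebra.mem_bot.1 ha
    rw [Algebra.algebraMap_eq_smul_one]
    exact S.smul_mem c h1
  · exact h i (by omega) a ha.1 ha.2

theorem IsWeaklyTriangular.eq_top (hτ : τ.IsWeaklyTriangular) (S : Submodule K A)
    (h : ∀ n ∈ τ.neg, ∀ t ∈ τ.T, ∀ p ∈ τ.pos, n * t * p ∈ S) : S = ⊤ := by
  refine eq_top_iff.2 fun a _ => ?_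
  obtain ⟨z, rfl⟩ := hτ.mul_bijective.2 a
  clear * - h
  induction z with
  | zero => rw [map_zero]; exact S.zero_mem
  | add x y hx hy => rw [map_add]; exact S.add_mem hx hy
  | tmul x p =>
    induction x with
    | zero => rw [TensorProduct.zero_tmul, map_zero]; exact S.zero_mem
    | add x y hx hy => rw [TensorProduct.add_tmul, map_add]; exact S.add_mem hx hy
    | tmul n t => exact h n n.2 t t.2 p p.2

theorem IsWeaklyTriangular.finrank_eq (hτ : τ.IsWeaklyTriangular) [FiniteDimensional K A] :
    Module.finrank K A =
      Module.finrank K τ.neg * Module.finrank K τ.T * Module.finrank K τ.pos := by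
  rw [← (LinearEquiv.ofBijective τ.mulMap hτ.mul_bijective).finrank_eq,
    Module.finrank_tensorProduct, Module.finrank_tensorProduct]

/-- The subspace `A⁻_{<0} M`. -/
def negSMul (τ : GradedTriple 𝒜) (M : GrMod 𝒜) : Submodule K M :=
  Submodule.span K {y | ∃ j < 0, ∃ a ∈ τ.neg, a ∈ 𝒜 j ∧ ∃ x : M, y = a • x}

/-- The subspace `A⁻ W`. -/
def negMul (τ : GradedTriple 𝒜) {M : GrMod 𝒜} (W : Submodule K M) : Submodule K M :=
  Submodule.map₂ (Algebra.lsmul K K M).toLinearMap τ.neg.toSubmodule W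

theorem smul_mem_negMul {M : GrMod 𝒜} {W : Submodule K M} {a : A} (ha : a ∈ τ.neg) {x : M}
    (hx : x ∈ W) : a • x ∈ τ.negMul W :=
  Submodule.apply_mem_map₂ (Algebra.lsmul K K M).toLinearMap ha hx

theorem le_negMul {M : GrMod 𝒜} (W : Submodule K M) : W ≤ τ.negMul W := fun x hx => by
  have := smul_mem_negMul τ.neg.one_mem hx
  rwa [one_smul] at this

theorem negMul_le {M : GrMod 𝒜} {W U : Submodule K M}
    (h : ∀ a ∈ τ.neg, ∀ x ∈ W, a • x ∈ U) : τ.negMul W ≤ U :=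
  Submodule.map₂_le.2 h

theorem smul_negMul_mem {M : GrMod 𝒜} {W : Submodule K M} {a : A} (ha : a ∈ τ.neg) {x : M}
    (hx : x ∈ τ.negMul W) : a • x ∈ τ.negMul W := by
  have : τ.negMul W ≤ (τ.negMul W).comap (Algebra.lsmul K K M a) := negMul_le fun b hb y hy => by
    change a • b • y ∈ τ.negMul W
    rw [smul_smul]
    exact smul_mem_negMul (τ.neg.mul_mem ha hb) hy
  exact this hx

theorem finrank_negMul_le [FiniteDimensional K A] {M : GrMod 𝒜} (W : Submodule K M) :
    Module.finrank K (τ.negMul W) ≤ Module.finrank K τ.neg * Module.finrank K W :=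
  finrank_map₂_le _ _ _

/-- Graded Nakayama lemma: substituting M = W + A⁻_{<0} M into itself pushes the error term into
ever lower degrees, where `M` vanishes. -/
theorem negMul_eq_top {M : GrMod 𝒜} (W : Submodule K M) (hW : W ⊔ τ.negSMul M = ⊤) :
    τ.negMul W = ⊤ := by
  let low : ℤ → Submodule K M := fun j => ⨆ i, ⨆ (_ : i ≤ j), M.gr i
  have hlow : ∀ i j, i ≤ j → M.gr i ≤ low j := fun i j h =>
    le_iSup_of_le i (le_iSup_of_le h (le_refl _))
  have hlow_le : ∀ j (S : Submodule K M), (∀ i ≤ j, M.gr i ≤ S) → low j ≤ S := fun j S h =>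
    iSup_le fun i => iSup_le fun hi => h i hi
  obtain ⟨D, hD⟩ : ∃ D : ℕ, ∀ i : ℤ, M.gr i ≠ ⊥ → -D < i ∧ i ≤ D := by
    obtain ⟨D, hD⟩ := (M.finite_gr_ne_bot.image Int.natAbs).bddAbove
    refine ⟨D + 1, fun i hi => ?_⟩
    have := hD ⟨i, hi, rfl⟩
    omega
  -- Each substitution lowers the degree of the error by at least one. After `2 * D` rounds it is
  -- confined to degrees at most `-D`, where `M` is zero.
  have claim : ∀ n : ℕ, (⊤ : Submodule K M) ≤ τ.negMul W ⊔ low (D - n) := by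
    intro n
    induction n with
    | zero =>
      rw [← M.iSup_gr]
      refine iSup_le fun i => ?_
      by_cases hi : M.gr i = ⊥
      · rw [hi]; exact bot_le
      · exact (hlow i _ (by have := hD i hi; simp; omega)).trans le_sup_right
    | succ n ih =>
      rw [← hW]
      refine sup_le ((le_negMul W).trans le_sup_left) (Submodule.span_le.2 ?_)
      rintro _ ⟨j, hj, a, ha, haj, x, rfl⟩
      obtain ⟨y, hy, z, hz, rfl⟩ := Submodule.mem_sup.1 (ih (Submodule.mem_top (x := x)))
      rw [smul_add]
      refine Submodule.add_mem _ (le_sup_left (a := τ.negMul W) (smul_negMul_mem ha hy)) ?_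
      have : low (D - n) ≤ (τ.negMul W ⊔ low (D - (n + 1 : ℕ))).comap (Algebra.lsmul K K M a) :=
        hlow_le _ _ fun i hi w hw => by
          refine le_sup_right (a := τ.negMul W) (hlow (j + i) _ ?_ (M.smul_mem j i a w haj hw))
          push_cast
          omega
      exact this hz
  rw [eq_top_iff]
  refine (claim (2 * D)).trans (sup_le le_rfl (hlow_le _ _ fun i hi => ?_))
  by_cases h : M.gr i = ⊥
  · rw [h]; exact bot_le
  · have := hD i h
    push_cast at hi
    omega

/-- For a complement `W` of A⁻_{<0} M, Nakayama makes A⁻ ⊗ W → M onto, so dim M ≤ dim A⁻ · (dim M -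
dim A⁻_{<0} M), written here without subtraction. Equality means that this map is an isomorphism. -/
theorem finrank_add_le [FiniteDimensional K A] (M : GrMod 𝒜) :
    Module.finrank K M + Module.finrank K τ.neg * Module.finrank K (τ.negSMul M) ≤
      Module.finrank K τ.neg * Module.finrank K M := by
  obtain ⟨W, hW⟩ := (τ.negSMul M).exists_isCompl
  have h1 := Submodule.finrank_add_eq_of_isCompl hW
  have h2 := finrank_negMul_le (τ := τ) W
  rw [negMul_eq_top W (by rw [sup_comm]; exact hW.sup_eq_top), finrank_top] at h2
  nlinarith

/-- Numerical freeness of `M` over `A⁻`: equality holds in the inequality `finrank_add_le`. -/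
def IsNegFree (τ : GradedTriple 𝒜) (M : GrMod 𝒜) : Prop :=
  Module.finrank K τ.neg * Module.finrank K M ≤
    Module.finrank K M + Module.finrank K τ.neg * Module.finrank K (τ.negSMul M)

/-- Modulo A⁻_{<0} the module is spanned by T A⁺ ⊗ V, whose dimension is at most dim (A ⊗ V) / dim
A⁻ by the triangular decomposition. -/
theorem IsWeaklyTriangular.isNegFree_tensor (hτ : τ.IsWeaklyTriangular) [GradedAlgebra 𝒜]
    [FiniteDimensional K A] {B : Type u} [Ring B] [Algebra K B] {ℬ : ℤ → Submodule K B}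
    (V : GrMod ℬ) : τ.IsNegFree (GrMod.tensor 𝒜 V) := by
  let TP : Submodule K A := Submodule.map₂ (LinearMap.mul K A) τ.T.toSubmodule τ.pos.toSubmodule
  let U : Submodule K (GrMod.tensor 𝒜 V) := Submodule.map₂ (GrMod.tmk 𝒜 V) TP ⊤
  have hU : Module.finrank K U ≤
      Module.finrank K τ.T * Module.finrank K τ.pos * Module.finrank K V := by
    refine (finrank_map₂_le _ _ _).trans ?_
    rw [finrank_top]
    exact Nat.mul_le_mul_right _ (finrank_map₂_le _ _ _)
  have hmem : ∀ (a : A) (v : V), GrMod.tmk 𝒜 V a v ∈ τ.negSMul (GrMod.tensor 𝒜 V) ⊔ U := by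
    intro a v
    have : (τ.negSMul (GrMod.tensor 𝒜 V) ⊔ U).comap ((GrMod.tmk 𝒜 V).flip v) = ⊤ := by
      refine hτ.eq_top _ fun n hn t ht p hp => ?_
      have htp : t * p ∈ TP := Submodule.apply_mem_map₂ (LinearMap.mul K A) ht hp
      have := hτ.neg_le ((τ.negSMul (GrMod.tensor 𝒜 V) ⊔ U).comap
        ((GrMod.tmk 𝒜 V).flip v ∘ₗ LinearMap.mulRight K (t * p))) ?_ ?_ hn
      · rw [mul_assoc]; exact this
      · change GrMod.tmk 𝒜 V (1 * (t * p)) v ∈ τ.negSMul (GrMod.tensor 𝒜 V) ⊔ U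
        rw [one_mul]
        exact le_sup_right (a := τ.negSMul (GrMod.tensor 𝒜 V))
          (Submodule.apply_mem_map₂ (GrMod.tmk 𝒜 V) htp Submodule.mem_top)
      · intro j hj a ha haj
        exact le_sup_left (b := U) (Submodule.subset_span
          ⟨j, hj, a, ha, haj, GrMod.tmk 𝒜 V (t * p) v, rfl⟩)
    exact (this ▸ Submodule.mem_top : a ∈ Submodule.comap _ _)
  have htop : τ.negSMul (GrMod.tensor 𝒜 V) ⊔ U = ⊤ := by
    rw [eq_top_iff]
    intro z _
    change A ⊗[K] V at z
    induction z with
    | zero => exact Submodule.zero_mem _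
    | add x y hx hy => exact Submodule.add_mem _ (hx trivial) (hy trivial)
    | tmul a v => exact hmem a v
  have h1 := Submodule.finrank_add_le_finrank_add_finrank (τ.negSMul (GrMod.tensor 𝒜 V)) U
  rw [htop, finrank_top] at h1
  have h2 : Module.finrank K (GrMod.tensor 𝒜 V) = Module.finrank K τ.neg *
      (Module.finrank K τ.T * Module.finrank K τ.pos * Module.finrank K V) := by
    refine (Module.finrank_tensorProduct (R := K) (S := K) (M := A) (M' := V)).trans ?_
    rw [hτ.finrank_eq]
    ring
  unfold IsNegFree
  have h3 := Nat.mul_le_mul_left (Module.finrank K τ.neg) (h1.trans (Nat.add_le_add_left hU _))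
  rw [Nat.mul_add, ← h2] at h3
  omega

theorem map_negSMul_le {M N : GrMod 𝒜} (f : M →ₗ[A] N) :
    (τ.negSMul M).map (f.restrictScalars K) ≤ τ.negSMul N := by
  rw [negSMul, Submodule.map_span, Submodule.span_le]
  rintro _ ⟨_, ⟨j, hj, a, ha, haj, x, rfl⟩, rfl⟩
  exact Submodule.subset_span ⟨j, hj, a, ha, haj, f x, map_smul f a x⟩

/-- Write M = N ⊕ R with `R` the kernel of the retraction. Both sides of the inequality
`finrank_add_le` add up over the summands, and it holds for `R`; equality for `M` therefore forces
equality for `N`. -/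
theorem IsNegFree.of_retract [FiniteDimensional K A] {M N : GrMod 𝒜} (hM : τ.IsNegFree M)
    (s : N.Hom M) (r : M.Hom N) (h : ∀ x, r.1 (s.1 x) = x) : τ.IsNegFree N := by
  let R := M.sub r.ker
  let p : M →ₗ[A] R := (LinearMap.id - s.1 ∘ₗ r.1).codRestrict r.ker.1 fun x => by
    change r.1 (x - s.1 (r.1 x)) = 0
    rw [map_sub, h, sub_self]
  have hp : ∀ x, (M.incl r.ker).1 (p x) = x - s.1 (r.1 x) := fun x => rfl
  let e : M →ₗ[K] N × R := (r.1.restrictScalars K).prod (p.restrictScalars K)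
  have he : Function.Injective e := by
    rw [← LinearMap.ker_eq_bot, LinearMap.ker_eq_bot']
    intro x hx
    have h1 : r.1 x = 0 := congrArg Prod.fst hx
    have h2 : p x = 0 := congrArg Prod.snd hx
    have h3 := hp x
    rw [h1, h2, map_zero, map_zero, sub_zero] at h3
    exact h3.symm
  have h1 : Module.finrank K (τ.negSMul M) ≤
      Module.finrank K (τ.negSMul N) + Module.finrank K (τ.negSMul R) := by
    let e' : τ.negSMul M →ₗ[K] τ.negSMul N × τ.negSMul R :=
      (((r.1.restrictScalars K) ∘ₗ (τ.negSMul M).subtype).codRestrict _ fun x =>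
        map_negSMul_le r.1 ⟨x, x.2, rfl⟩).prod
      (((p.restrictScalars K) ∘ₗ (τ.negSMul M).subtype).codRestrict _ fun x =>
        map_negSMul_le p ⟨x, x.2, rfl⟩)
    rw [← Module.finrank_prod]
    refine LinearMap.finrank_le_finrank_of_injective (f := e') fun x y hxy => ?_
    exact Subtype.ext (he (Prod.ext (congrArg (fun z => (z.1 : N)) hxy)
      (congrArg (fun z => (z.2 : R)) hxy)))
  have h2 : Module.finrank K M = Module.finrank K N + Module.finrank K R := by
    have hr : LinearMap.range (r.1.restrictScalars K) = ⊤ :=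
      LinearMap.range_eq_top.2 fun x => ⟨s.1 x, h x⟩
    rw [← (r.1.restrictScalars K).finrank_range_add_finrank_ker, hr, finrank_top]
    rfl
  have h3 := finrank_add_le (τ := τ) R
  unfold IsNegFree at hM ⊢
  have h4 := Nat.mul_le_mul_left (Module.finrank K τ.neg) h1
  rw [h2] at hM
  rw [Nat.mul_add] at h4 hM
  omega

/-! ### Subobjects generated in top degree -/

variable (τ) in
/-- The subspace `V` of `M` is stable under `T` and killed by the elements of positive degree of
`A⁺`. -/
def IsSingular {M : GrMod 𝒜} (V : Submodule τ.T M) : Prop :=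
  ∀ j > 0, ∀ a ∈ τ.pos, a ∈ 𝒜 j → ∀ x ∈ V, a • x = 0

theorem isSingular_of_le_gr {M : GrMod 𝒜} {V : Submodule τ.T M} {d : ℤ}
    (hV : ∀ x ∈ V, x ∈ M.gr d) (hd : ∀ j, d < j → M.gr j = ⊥) : τ.IsSingular V := by
  intro j hj a _ haj x hx
  have := M.smul_mem j d a x haj (hV x hx)
  rw [hd _ (by omega)] at this
  exact (Submodule.mem_bot K).1 this

/-- A⁺ acts on a singular `V` by scalars and `T` preserves it, so A V = A⁻ T A⁺ V = A⁻ V. -/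
theorem IsWeaklyTriangular.span_eq_negMul (hτ : τ.IsWeaklyTriangular) {M : GrMod 𝒜}
    (V : Submodule τ.T M) (hV : τ.IsSingular V) :
    (Submodule.span A (V : Set M)).restrictScalars K = τ.negMul (V.restrictScalars K) := by
  have key : ∀ (a : A), ∀ x ∈ V, a • x ∈ τ.negMul (V.restrictScalars K) := by
    intro a x hx
    have : (τ.negMul (V.restrictScalars K)).comap (LinearMap.toSpanSingleton A M x |>.restrictScalars K) = ⊤ := by
      refine hτ.eq_top _ fun n hn t ht p hp => ?_
      change (n * t * p) • x ∈ τ.negMul (V.restrictScalars K)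
      have hpx : p • x ∈ V := by
        have := hτ.pos_le ((V.restrictScalars K).comap
          (LinearMap.toSpanSingleton A M x |>.restrictScalars K)) ?_ ?_ hp
        · exact this
        · change (1 : A) • x ∈ V
          rwa [one_smul]
        · intro j hj a ha haj
          change a • x ∈ V
          rw [hV j hj a ha haj x hx]
          exact V.zero_mem
      rw [mul_assoc, mul_smul, mul_smul]
      exact smul_mem_negMul hn (V.smul_mem ⟨t, ht⟩ hpx)
    exact (this ▸ Submodule.mem_top : a ∈ Submodule.comap _ _)
  have hstab : ∀ (a : A), ∀ y ∈ τ.negMul (V.restrictScalars K),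
      a • y ∈ τ.negMul (V.restrictScalars K) := by
    intro a y hy
    have : τ.negMul (V.restrictScalars K) ≤
        (τ.negMul (V.restrictScalars K)).comap (Algebra.lsmul K K M a) :=
      negMul_le fun n _ x hx => by
        change a • n • x ∈ τ.negMul (V.restrictScalars K)
        rw [smul_smul]
        exact key _ x hx
    exact this hy
  apply le_antisymm
  · intro x hx
    change x ∈ Submodule.span A (V : Set M) at hx
    induction hx using Submodule.span_induction with
    | mem x hx => exact le_negMul _ hx
    | zero => exact Submodule.zero_mem _
    | add x y _ _ hx hy => exact Submodule.add_mem _ hx hy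
    | smul a x _ hx => exact hstab a x hx
  · exact negMul_le fun a _ x hx => Submodule.smul_mem _ a (Submodule.subset_span hx)

/-- Elements of negative degree send `M` into degrees below the top degree `d`. -/
theorem disjoint_negSMul {M : GrMod 𝒜} {V : Submodule τ.T M} {d : ℤ}
    (hV : ∀ x ∈ V, x ∈ M.gr d) (hd : ∀ j, d < j → M.gr j = ⊥) :
    Disjoint (τ.negSMul M) (V.restrictScalars K) := by
  have hle : τ.negSMul M ≤ LinearMap.ker (M.proj d) := by
    refine Submodule.span_le.2 ?_
    rintro _ ⟨j, hj, a, -, haj, x, rfl⟩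
    change M.proj d (a • x) = 0
    have h0 : M.proj (d - j) x = 0 := by
      have := M.proj_mem (d - j) x
      rw [hd _ (by omega)] at this
      exact (Submodule.mem_bot K).1 this
    rw [M.proj_smul j d a haj, h0, smul_zero]
  rw [Submodule.disjoint_def]
  intro x hx hxV
  rw [← M.proj_self d x (hV x hxV)]
  exact hle hx

variable [GradedAlgebra 𝒜]

/-- The graded submodule generated by a subspace of homogeneous elements of degree `d`. -/
def gen {M : GrMod 𝒜} (V : Submodule τ.T M) {d : ℤ} (hV : ∀ x ∈ V, x ∈ M.gr d) : M.GrSub :=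
  ⟨Submodule.span A V, M.isGraded_span _ fun x hx i => by
    by_cases h : d = i
    · subst h
      rw [M.proj_self _ x (hV x hx)]
      exact Submodule.subset_span hx
    · rw [M.proj_ne i d h x (hV x hx)]
      exact Submodule.zero_mem _⟩

theorem IsWeaklyTriangular.finrank_gen_le (hτ : τ.IsWeaklyTriangular) [FiniteDimensional K A]
    {M : GrMod 𝒜} (V : Submodule τ.T M) {d : ℤ} (hV : ∀ x ∈ V, x ∈ M.gr d)
    (hs : τ.IsSingular V) :
    Module.finrank K (M.sub (gen V hV)) ≤
      Module.finrank K τ.neg * Module.finrank K (V.restrictScalars K) := by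
  refine le_trans (le_of_eq ?_) (finrank_negMul_le _)
  rw [← hτ.span_eq_negMul V hs]
  rfl

/-- Let N = AV. There are three inequalities: dim N ≤ dim A⁻ · dim V; the Nakayama bound for M/N;
and dim A⁻_{<0} M + dim V ≤ dim A⁻_{<0}(M/N) + dim N, as the sum on the left is direct for degree
reasons. Added up, they give the Nakayama bound for `M`. That bound is an equality when `M` is
numerically free, so the first two are equalities as well, which is the claim. -/
theorem IsWeaklyTriangular.finrank_gen_and_quot (hτ : τ.IsWeaklyTriangular)
    [FiniteDimensional K A] {M : GrMod 𝒜} (hM : τ.IsNegFree M) (V : Submodule τ.T M) {d : ℤ}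
    (hV : ∀ x ∈ V, x ∈ M.gr d) (hd : ∀ j, d < j → M.gr j = ⊥) :
    Module.finrank K (M.sub (gen V hV)) =
      Module.finrank K τ.neg * Module.finrank K (V.restrictScalars K) ∧
    τ.IsNegFree (M.quot (gen V hV)) := by
  let N := gen V hV
  have h1 := hτ.finrank_gen_le V hV (isSingular_of_le_gr hV hd)
  have h2 := GrMod.finrank_sub_add_quot N
  have h3 := finrank_add_le (τ := τ) (M.quot N)
  have h4 : Module.finrank K (τ.negSMul M) + Module.finrank K (V.restrictScalars K) ≤
      Module.finrank K (τ.negSMul (M.quot N)) + Module.finrank K (M.sub N) := by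
    have hdis := disjoint_negSMul (τ := τ) hV hd
    have h5 := Submodule.finrank_sup_add_finrank_inf_eq (τ.negSMul M) (V.restrictScalars K)
    rw [hdis.eq_bot, finrank_bot, add_zero] at h5
    -- Map A⁻_{<0} M ⊕ V to M/N: the image lies in A⁻_{<0}(M/N) since `V` dies, and the kernel lies
    -- in `N`.
    rw [← h5]
    let g : (τ.negSMul M ⊔ V.restrictScalars K : Submodule K M) →ₗ[K] M.quot N :=
      (M.mkQ N).1.restrictScalars K ∘ₗ Submodule.subtype _
    rw [← g.finrank_range_add_finrank_ker]
    refine Nat.add_le_add (Submodule.finrank_mono ?_) ?_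
    · rintro _ ⟨⟨x, hx⟩, rfl⟩
      obtain ⟨y, hy, z, hz, rfl⟩ := Submodule.mem_sup.1 hx
      change (M.mkQ N).1 (y + z) ∈ _
      rw [map_add, (M.mkQ_eq_zero N z).2 (Submodule.subset_span hz), add_zero]
      exact map_negSMul_le (M.mkQ N).1 ⟨y, hy, rfl⟩
    · let k : LinearMap.ker g →ₗ[K] N.1.restrictScalars K :=
        (Submodule.subtype _ ∘ₗ Submodule.subtype _).codRestrict _
          fun x => (M.mkQ_eq_zero N _).1 x.2
      refine LinearMap.finrank_le_finrank_of_injective (f := k) fun x y h => ?_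
      exact Subtype.ext (Subtype.ext (congrArg (fun z : N.1.restrictScalars K => (z : M)) h))
  unfold IsNegFree at hM ⊢
  change Module.finrank K (M.sub N) ≤ _ at h1
  change Module.finrank K (M.sub N) = _ ∧ _
  set a := Module.finrank K τ.neg
  have h6 := Nat.mul_le_mul_left a h4
  rw [← h2] at hM
  simp only [Nat.mul_add] at hM h6
  constructor <;> [skip; change a * Module.finrank K (M.quot N) ≤ Module.finrank K (M.quot N) +
    a * Module.finrank K (τ.negSMul (M.quot N))] <;> omega

end GradedTriple

/-! ### Shifts, isomorphism classes, and maps out of `A ⊗ V`. -/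

namespace GrMod

variable {K A : Type u} [Field K] [Ring A] [Algebra K A] {𝒜 : ℤ → Submodule K A}

/-- The graded module `M` with its grading moved up by `n`. -/
def shift (M : GrMod 𝒜) (n : ℤ) : GrMod 𝒜 where
  carrier := M
  gr i := M.gr (i - n)
  internal := by
    refine isInternal_of_proj _ (fun i => M.proj (i - n)) (fun i x hx => M.proj_self _ x hx)
      (fun i j hij x hx => M.proj_ne _ _ (by omega) x hx) ?_
    rw [← M.iSup_gr]
    exact (Equiv.subRight n).iSup_comp (g := M.gr)
  smul_mem i j a x ha hx := by
    have := M.smul_mem i (j - n) a x ha hx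
    rwa [show i + (j - n) = i + j - n by ring] at this

theorem Irr.rep_mk_iso (S : {M : GrMod 𝒜 // M.IsSimple}) :
    (Irr.rep (Quotient.mk (simpleSetoid 𝒜) S)).Iso S.1 :=
  Quotient.exact (Quotient.out_eq (Quotient.mk (simpleSetoid 𝒜) S))

theorem Irr.eq_of_rep_iso {s t : Irr 𝒜} (h : s.rep.Iso t.rep) : s = t := by
  rw [← Quotient.out_eq s, ← Quotient.out_eq t]
  exact Quotient.sound h

theorem Irr.gr_deg_ne_bot (s : Irr 𝒜) : s.rep.gr s.deg ≠ ⊥ :=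
  Classical.choose_spec (exists_gr_ne_bot s.rep s.rep_isSimple)

/-- The morphism from `A ⊗ V` induced by a degree-preserving linear map from `V`. -/
theorem exists_tensor_hom [GradedAlgebra 𝒜] [FiniteDimensional K A] {B : Type u} [Ring B]
    [Algebra K B] {ℬ : ℤ → Submodule K B} (V : GrMod ℬ) (N : GrMod 𝒜) (f : V →ₗ[K] N)
    (hf : ∀ i, ∀ x ∈ V.gr i, f x ∈ N.gr i) :
    ∃ g : (tensor 𝒜 V).Hom N, ∀ a x, g.1 (tmk 𝒜 V a x) = a • f x := by
  let g0 : A ⊗[K] V →ₗ[K] N := TensorProduct.lift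
    ((LinearMap.lcomp K N f) ∘ₗ (Algebra.lsmul K K N).toLinearMap)
  have hg0 : ∀ a x, g0 (a ⊗ₜ x) = a • f x := fun a x => rfl
  have hsmul : ∀ (a : A) (z : A ⊗[K] V), g0 (a • z) = a • g0 z := by
    intro a z
    induction z with
    | zero => rw [smul_zero, map_zero, smul_zero]
    | add x y hx hy => rw [smul_add, map_add, hx, hy, map_add, smul_add]
    | tmul b x => rw [TensorProduct.smul_tmul', hg0, hg0, smul_eq_mul, mul_smul]
  refine ⟨⟨{ g0 with map_smul' := hsmul }, fun n z hz => ?_⟩, hg0⟩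
  have : (⨆ i, Submodule.map₂ (TensorProduct.mk K A V) (𝒜 i) (V.gr (n - i))) ≤
      (N.gr n).comap g0 := by
    refine iSup_le fun i => Submodule.map₂_le.2 fun a ha x hx => ?_
    change a • f x ∈ N.gr n
    have := N.smul_mem i (n - i) a (f x) ha (hf _ x hx)
    rwa [add_sub_cancel] at this
  exact this hz

theorem tmk_mem_gr [GradedAlgebra 𝒜] [FiniteDimensional K A] {B : Type u} [Ring B]
    [Algebra K B] {ℬ : ℤ → Submodule K B} (V : GrMod ℬ) {a : A} {x : V} {i j n : ℤ}
    (ha : a ∈ 𝒜 i) (hx : x ∈ V.gr j) (h : i + j = n) :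
    tmk 𝒜 V a x ∈ (tensor 𝒜 V).gr n := by
  change a ⊗ₜ[K] x ∈ ⨆ k, Submodule.map₂ (TensorProduct.mk K A V) (𝒜 k) (V.gr (n - k))
  refine Submodule.mem_iSup_of_mem i
    (Submodule.apply_mem_map₂ (TensorProduct.mk K A V) ha ?_)
  rwa [← h, add_sub_cancel_left]

end GrMod

namespace GradedTriple

variable {K A : Type u} [Field K] [Ring A] [Algebra K A] {𝒜 : ℤ → Submodule K A}
  {τ : GradedTriple 𝒜}

/-! ### Graded `T`-modules -/

theorem smul_mem_gr (M : GrMod 𝒜) (t : τ.T) {i : ℤ} {x : M} (hx : x ∈ M.gr i) :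
    t • x ∈ M.gr i := by
  have := M.smul_mem 0 i t x (τ.T_le t.2) hx
  rwa [zero_add] at this

theorem smul_mem_gr_T (M : GrMod τ.grT) (t : τ.T) {i : ℤ} {x : M} (hx : x ∈ M.gr i) :
    t • x ∈ M.gr i := by
  have := M.smul_mem 0 i t x (τ.T_le t.2) hx
  rwa [zero_add] at this

/-- As `T` sits in degree zero, each homogeneous component is a subobject. -/
theorem gr_eq_top_of_isSimple {M : GrMod τ.grT} (hM : M.IsSimple) {d : ℤ} (hd : M.gr d ≠ ⊥) :
    M.gr d = ⊤ := by
  let X : M.GrSub := ⟨{ M.gr d with smul_mem' := fun t x hx => smul_mem_gr_T M t hx },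
    fun x hx i => by
      change x ∈ M.gr d at hx
      change M.proj i x ∈ M.gr d
      by_cases h : d = i
      · subst h
        exact M.proj_mem _ _
      · rw [M.proj_ne i d h x hx]
        exact Submodule.zero_mem _⟩
  rcases hM.2 X with h | h
  · exfalso
    apply hd
    rw [eq_bot_iff]
    intro x hx
    have hx' : x ∈ X.1 := hx
    rw [h] at hx'
    exact (Submodule.mem_bot K).2 ((Submodule.mem_bot τ.T).1 hx')
  · rw [eq_top_iff]
    intro x _
    have hx' : x ∈ X.1 := by rw [h]; exact Submodule.mem_top
    exact hx'

/-- A graded simple `T`-module lives in one degree, so all its `T`-submodules are graded. -/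
theorem isSimpleModule_of_isSimple {M : GrMod τ.grT} (hM : M.IsSimple) : IsSimpleModule τ.T M := by
  obtain ⟨d, hd⟩ := M.exists_gr_ne_bot hM
  have htop := gr_eq_top_of_isSimple hM hd
  have := hM.1
  refine (isSimpleModule_iff _ _).2 { eq_bot_or_eq_top := fun X => ?_ }
  rcases hM.2 ⟨X, fun x hx i => by
      have hxd : x ∈ M.gr d := by rw [htop]; exact Submodule.mem_top
      by_cases h : d = i
      · subst h
        rwa [M.proj_self _ x hxd]
      · rw [M.proj_ne i d h x hxd]
        exact Submodule.zero_mem _⟩ with h | h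
  · exact Or.inl (congrArg Subtype.val h)
  · exact Or.inr (congrArg Subtype.val h)

instance (lam : τ.Wt) : IsSimpleModule τ.T lam.rep := isSimpleModule_of_isSimple lam.rep_isSimple

theorem gr_deg (lam : τ.Wt) : lam.rep.gr lam.deg = ⊤ :=
  gr_eq_top_of_isSimple lam.rep_isSimple lam.gr_deg_ne_bot

theorem mem_gr_deg (lam : τ.Wt) (x : lam.rep) : x ∈ lam.rep.gr lam.deg := by
  rw [gr_deg]; exact Submodule.mem_top

theorem eq_zero_of_mem_gr (lam : τ.Wt) {d : ℤ} (hd : d ≠ lam.deg) {x : lam.rep}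
    (hx : x ∈ lam.rep.gr d) : x = 0 := by
  rw [← lam.rep.proj_self d x hx]
  exact lam.rep.proj_ne _ _ hd.symm x (mem_gr_deg lam x)

theorem exists_ne_zero (lam : τ.Wt) : ∃ x : lam.rep, x ≠ 0 := @exists_ne _ lam.rep_isSimple.1 0

theorem Wt.eq_of_equiv {lam μ : τ.Wt} (e : lam.rep ≃ₗ[τ.T] μ.rep) (h : lam.deg = μ.deg) :
    lam = μ := by
  apply GrMod.Irr.eq_of_rep_iso
  let f : lam.rep.Hom μ.rep := ⟨e.toLinearMap, fun i x hx => by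
    by_cases hi : i = lam.deg
    · rw [hi, h]
      exact mem_gr_deg μ _
    · rw [eq_zero_of_mem_gr lam hi hx, map_zero]
      exact Submodule.zero_mem _⟩
  exact f.iso_of_bijective e.bijective

section Concentrated

variable [GradedAlgebra 𝒜]

variable (τ) in
/-- A `T`-module as a graded `T`-module concentrated in degree `d`. -/
noncomputable def concentrated (V : Type u) [AddCommGroup V] [Module K V] [Module τ.T V]
    [IsScalarTower K τ.T V] [Module.Finite K V] (d : ℤ) : GrMod τ.grT where
  carrier := V
  gr i := if i = d then ⊤ else ⊥
  internal := by
    refine GrMod.isInternal_of_proj _ (fun i => if i = d then LinearMap.id else 0) ?_ ?_ ?_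
    · intro i x hx
      by_cases h : i = d
      · simp [h]
      · rw [if_neg h] at hx
        simp [(Submodule.mem_bot K).1 hx]
    · intro i j hij x hx
      by_cases h : j = d
      · rw [if_neg (by omega)]
        rfl
      · rw [if_neg h] at hx
        simp [(Submodule.mem_bot K).1 hx]
    · rw [eq_top_iff]
      exact le_iSup_of_le d (by rw [if_pos rfl])
  smul_mem i j a x ha hx := by
    by_cases hj : j = d
    · by_cases hi : i = 0
      · rw [if_pos (by omega)]
        exact Submodule.mem_top
      · have : a = 0 := by
          by_contra h
          exact hi (DirectSum.degree_eq_of_mem_mem 𝒜 (show (a : A) ∈ 𝒜 i from ha) (τ.T_le a.2)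
            fun h' => h (Subtype.ext h'))
        rw [this, zero_smul]
        exact Submodule.zero_mem _
    · rw [if_neg hj] at hx
      rw [(Submodule.mem_bot K).1 hx, smul_zero]
      exact Submodule.zero_mem _

theorem exists_wt_of_isSimpleModule (V : Type u) [AddCommGroup V] [Module K V] [Module τ.T V]
    [IsScalarTower K τ.T V] [Module.Finite K V] [hV : IsSimpleModule τ.T V] (d : ℤ) :
    ∃ κ : τ.Wt, κ.deg = d ∧ Nonempty (κ.rep ≃ₗ[τ.T] V) := by
  have hs : (concentrated τ V d).IsSimple := by
    refine ⟨IsSimpleModule.nontrivial τ.T V, fun X => ?_⟩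
    rcases eq_bot_or_eq_top (α := Submodule τ.T V) X.1 with h | h
    · exact Or.inl (Subtype.ext h)
    · exact Or.inr (Subtype.ext h)
  obtain ⟨κ, e, he⟩ : ∃ κ : τ.Wt, κ.rep.Iso (concentrated τ V d) :=
    ⟨_, GrMod.Irr.rep_mk_iso ⟨concentrated τ V d, hs⟩⟩
  refine ⟨κ, ?_, ⟨e⟩⟩
  by_contra hne
  obtain ⟨x, hx⟩ := exists_ne_zero κ
  have h1 : e x ∈ (concentrated τ V d).gr κ.deg := (he _ x).1 (mem_gr_deg κ x)
  have h2 : (concentrated τ V d).gr κ.deg = ⊥ := if_neg hne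
  rw [h2] at h1
  exact hx (e.injective (((Submodule.mem_bot K).1 h1).trans (map_zero e).symm))

end Concentrated

/-! ### Top components -/

/-- `M` lives in degrees at most `deg κ`, and its component of degree `deg κ` is the simple
`T`-module `κ`. -/
def HasTop (τ : GradedTriple 𝒜) (M : GrMod 𝒜) (κ : τ.Wt) : Prop :=
  (∀ j, κ.deg < j → M.gr j = ⊥) ∧ ∃ f : κ.rep →ₗ[τ.T] M, Function.Injective f ∧
    ∀ x, x ∈ M.gr κ.deg ↔ x ∈ LinearMap.range f

theorem HasTop.gr_ne_bot {M : GrMod 𝒜} {κ : τ.Wt} (h : τ.HasTop M κ) : M.gr κ.deg ≠ ⊥ := by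
  obtain ⟨-, f, hf, hr⟩ := h
  intro h
  obtain ⟨x, hx⟩ := exists_ne_zero κ
  have := (hr (f x)).2 ⟨x, rfl⟩
  rw [h] at this
  exact hx (hf (((Submodule.mem_bot K).1 this).trans (map_zero f).symm))

theorem HasTop.unique {M : GrMod 𝒜} {κ κ' : τ.Wt} (h : τ.HasTop M κ) (h' : τ.HasTop M κ') :
    κ = κ' := by
  have hdeg : κ.deg = κ'.deg := by
    refine le_antisymm ?_ ?_ <;> by_contra hlt <;> rw [not_le] at hlt
    · exact h.gr_ne_bot (h'.1 _ hlt)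
    · exact h'.gr_ne_bot (h.1 _ hlt)
  obtain ⟨-, f, hf, hr⟩ := h
  obtain ⟨-, f', hf', hr'⟩ := h'
  have hrange : LinearMap.range f = LinearMap.range f' := by
    ext x
    rw [← hr, ← hr', hdeg]
  exact Wt.eq_of_equiv ((LinearEquiv.ofInjective f hf).trans
    ((LinearEquiv.ofEq _ _ hrange).trans (LinearEquiv.ofInjective f' hf').symm)) hdeg

/-- The top component of `N` is a quotient of the simple module `κ`; if nonzero, it is `κ` by
Schur's lemma. -/
theorem HasTop.of_surjective {M N : GrMod 𝒜} {κ : τ.Wt} (h : τ.HasTop M κ) (q : M.Hom N)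
    (hq : Function.Surjective q.1) (hne : N.gr κ.deg ≠ ⊥) : τ.HasTop N κ := by
  obtain ⟨hb, f, hf, hr⟩ := h
  refine ⟨fun j hj => GrMod.gr_eq_bot_of_surjective q hq j (hb j hj), ?_⟩
  let f' : κ.rep →ₗ[τ.T] N := q.1.restrictScalars τ.T ∘ₗ f
  have hr' : ∀ y, y ∈ N.gr κ.deg ↔ y ∈ LinearMap.range f' := by
    intro y
    constructor
    · intro hy
      obtain ⟨x, hx, rfl⟩ := q.exists_homogeneous_preimage hq _ y hy
      obtain ⟨z, rfl⟩ := (hr x).1 hx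
      exact ⟨z, rfl⟩
    · rintro ⟨z, rfl⟩
      exact q.2 _ _ ((hr _).2 ⟨z, rfl⟩)
  refine ⟨f', (LinearMap.injective_or_eq_zero f').resolve_right fun h => hne ?_, hr'⟩
  rw [eq_bot_iff]
  intro y hy
  obtain ⟨z, rfl⟩ := (hr' y).1 hy
  rw [h]
  exact Submodule.zero_mem _

theorem HasTop.of_iso {M N : GrMod 𝒜} {κ : τ.Wt} (h : τ.HasTop M κ) (e : M.Iso N) :
    τ.HasTop N κ := by
  obtain ⟨q, hq⟩ := e.exists_hom
  refine h.of_surjective q hq.2 fun hb => ?_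
  exact h.gr_ne_bot (GrMod.gr_eq_bot_of_injective q hq.1 _ hb)

theorem HasTop.sub {M : GrMod 𝒜} {κ : τ.Wt} (h : τ.HasTop M κ) (X : M.GrSub)
    (hX : ∀ x ∈ M.gr κ.deg, x ∈ X.1) : τ.HasTop (M.sub X) κ := by
  obtain ⟨hb, f, hf, hr⟩ := h
  refine ⟨fun j hj => GrMod.gr_eq_bot_of_injective (M.incl X) (M.incl_injective X) j (hb j hj),
    f.codRestrict (X.1.restrictScalars τ.T) fun x => hX _ ((hr _).2 ⟨x, rfl⟩),
    fun x y hxy => hf (congrArg Subtype.val hxy), fun x => ?_⟩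
  refine (hr x.1).trans ⟨?_, ?_⟩
  · rintro ⟨z, hz⟩
    exact ⟨z, Subtype.ext hz⟩
  · rintro ⟨z, hz⟩
    exact ⟨z, congrArg Subtype.val hz⟩

variable (τ) in
/-- The homogeneous component of degree `d` as a `T`-module. -/
def topT (M : GrMod 𝒜) (d : ℤ) : Submodule τ.T M :=
  { M.gr d with smul_mem' := fun t _ hx => smul_mem_gr M t hx }

theorem topT_ne_bot {M : GrMod 𝒜} {d : ℤ} (hd : M.gr d ≠ ⊥) : τ.topT M d ≠ ⊥ := by
  intro h
  apply hd
  rw [eq_bot_iff]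
  intro x hx
  have hx' : x ∈ τ.topT M d := hx
  rw [h] at hx'
  exact hx'

/-- The degree `d` is only a label given to the simple submodule that is found; in applications `V`
consists of elements of degree `d`. -/
theorem exists_wt_of_ne_bot [GradedAlgebra 𝒜] [IsSemisimpleRing τ.T] {M : GrMod 𝒜} {d : ℤ}
    (V : Submodule τ.T M) (hV : V ≠ ⊥) : ∃ κ : τ.Wt, κ.deg = d ∧
      ∃ f : κ.rep →ₗ[τ.T] M, Function.Injective f ∧ ∀ x, f x ∈ V := by
  have : Nontrivial V := Submodule.nontrivial_iff_ne_bot.2 hV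
  obtain ⟨S, hS⟩ := IsSemisimpleModule.exists_simple_submodule τ.T V
  have : Module.Finite K V := inferInstanceAs (Module.Finite K (V.restrictScalars K))
  have : Module.Finite K S := inferInstanceAs (Module.Finite K (S.restrictScalars K))
  obtain ⟨κ, hκ, ⟨e⟩⟩ := exists_wt_of_isSimpleModule (τ := τ) S d
  exact ⟨κ, hκ, V.subtype ∘ₗ S.subtype ∘ₗ e.toLinearMap,
    V.injective_subtype.comp (S.injective_subtype.comp e.injective), fun x => (e x).1.2⟩

end GradedTriple

namespace GradedTriple

variable {K A : Type u} [Field K] [Ring A] [Algebra K A] {𝒜 : ℤ → Submodule K A}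
  {τ : GradedTriple 𝒜}

theorem eq_zero_of_tmul_eq_zero {K V W : Type*} [Field K] [AddCommGroup V] [AddCommGroup W]
    [Module K V] [Module K W] {v : V} {w : W} (hw : w ≠ 0) (h : v ⊗ₜ[K] w = 0) : v = 0 := by
  obtain ⟨ξ, hξ⟩ : ∃ ξ : Module.Dual K W, ξ w ≠ 0 := by
    by_contra! h'
    exact hw ((Module.forall_dual_apply_eq_zero_iff K w).1 h')
  have h1 := congrArg ((TensorProduct.rid K V).toLinearMap ∘ₗ ξ.lTensor V) h
  simpa [hξ] using h1

/-- The product is the image of `1 ⊗ t ⊗ p` under the bijective multiplication map. It follows that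
`T p` is a copy of `T` inside `A`. -/
theorem IsWeaklyTriangular.mul_right_injective (hτ : τ.IsWeaklyTriangular) [Nontrivial A] {p : A}
    (hp : p ∈ τ.pos) (hp0 : p ≠ 0) (t : τ.T) (h : (t : A) * p = 0) : t = 0 := by
  have h1 : τ.mulMap (((1 : τ.neg) ⊗ₜ t) ⊗ₜ (⟨p, hp⟩ : τ.pos)) = 0 := by
    change (1 : A) * t * p = 0
    rw [one_mul, h]
  have h2 := hτ.mul_bijective.1 (h1.trans (map_zero _).symm)
  have h3 := eq_zero_of_tmul_eq_zero (fun h => hp0 (congrArg Subtype.val h)) h2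
  have h4 : t ⊗ₜ[K] (1 : τ.neg) = 0 := by
    rw [← TensorProduct.comm_tmul, h3, map_zero]
  exact eq_zero_of_tmul_eq_zero one_ne_zero h4

theorem nontrivial_of_wt (lam : τ.Wt) : Nontrivial A := by
  obtain ⟨x, hx⟩ := exists_ne_zero lam
  refine ⟨0, 1, fun h => hx ?_⟩
  have : (1 : τ.T) = 0 := Subtype.ext h.symm
  rw [← one_smul τ.T x, this, zero_smul]

variable [GradedAlgebra 𝒜] [FiniteDimensional K A]

/-! ### Standard objects -/

theorem smul_tmk (M : GrMod τ.grT) (a b : A) (m : M) :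
    a • GrMod.tmk 𝒜 M b m = GrMod.tmk 𝒜 M (a * b) m := rfl

variable (τ) in
/-- The canonical map `M → Δ(M)`. -/
noncomputable def stdIncl (M : GrMod τ.grT) : M →ₗ[τ.T] τ.stdFunctor M where
  toFun m := ((GrMod.tensor 𝒜 M).mkQ ⟨_, τ.isGraded_standardRel M⟩).1 (GrMod.tmk 𝒜 M 1 m)
  map_add' x y := by
    rw [map_add, map_add]
    rfl
  map_smul' t m := by
    rw [RingHom.id_apply]
    have h : GrMod.tmk 𝒜 M t m - GrMod.tmk 𝒜 M 1 (t • m) ∈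
        Submodule.span A (τ.standardRel M) := Submodule.subset_span (Or.inl ⟨t, m, rfl⟩)
    have h1 := ((GrMod.tensor 𝒜 M).mkQ_eq_zero ⟨_, τ.isGraded_standardRel M⟩ _).2 h
    rw [map_sub, sub_eq_zero] at h1
    rw [← h1]
    have h2 : GrMod.tmk 𝒜 M (t : A) m = (t : A) • GrMod.tmk 𝒜 M 1 m := by
      rw [smul_tmk, mul_one]
    rw [h2, map_smul]
    rfl

theorem smul_stdIncl (M : GrMod τ.grT) (a : A) (m : M) : a • τ.stdIncl M m =
    ((GrMod.tensor 𝒜 M).mkQ ⟨_, τ.isGraded_standardRel M⟩).1 (GrMod.tmk 𝒜 M a m) := by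
  have h2 : GrMod.tmk 𝒜 M a m = a • GrMod.tmk 𝒜 M 1 m := by rw [smul_tmk, mul_one]
  rw [h2, map_smul]
  rfl

theorem pos_smul_stdIncl (M : GrMod τ.grT) {j : ℤ} (hj : 0 < j) {a : A} (ha : a ∈ τ.pos)
    (haj : a ∈ 𝒜 j) (m : M) : a • τ.stdIncl M m = 0 := by
  rw [smul_stdIncl]
  refine (GrMod.mkQ_eq_zero _ _ _).2 (Submodule.subset_span (Or.inr ⟨j, a, m, hj, ?_, haj, rfl⟩))
  have := Submodule.mul_mem_mul (M := τ.pos.toSubmodule) (N := τ.T.toSubmodule) ha τ.T.one_mem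
  rwa [mul_one] at this

theorem stdIncl_mem_gr (M : GrMod τ.grT) {i : ℤ} {m : M} (hm : m ∈ M.gr i) :
    τ.stdIncl M m ∈ (τ.stdFunctor M).gr i := by
  exact (GrMod.mkQ _ _).2 i _ (GrMod.tmk_mem_gr M (SetLike.one_mem_graded 𝒜) hm (zero_add i))

theorem span_range_stdIncl (M : GrMod τ.grT) :
    Submodule.span A (LinearMap.range (τ.stdIncl M) : Set (τ.stdFunctor M)) = ⊤ := by
  rw [eq_top_iff]
  intro y _
  obtain ⟨z, rfl⟩ := GrMod.mkQ_surjective _ _ y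
  change A ⊗[K] M at z
  induction z with
  | zero => exact Submodule.zero_mem _
  | add x y hx hy => exact Submodule.add_mem _ (hx trivial) (hy trivial)
  | tmul a m =>
    have := Submodule.smul_mem (Submodule.span A (LinearMap.range (τ.stdIncl M) :
      Set (τ.stdFunctor M))) a (Submodule.subset_span ⟨m, rfl⟩)
    rw [smul_stdIncl] at this
    exact this

/-- Universal property of induction from B⁺: as `N` vanishes above degree `d`, elements of positive
degree kill the image of `f`, which is what the relations of Δ demand. -/
theorem exists_stdFunctor_hom {M : GrMod τ.grT} {N : GrMod 𝒜} {d : ℤ} (hM : M.gr d = ⊤)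
    (f : M →ₗ[τ.T] N) (hf : ∀ x, f x ∈ N.gr d) (hN : ∀ j, d < j → N.gr j = ⊥) :
    ∃ g : (τ.stdFunctor M).Hom N, ∀ x, g.1 (τ.stdIncl M x) = f x := by
  obtain ⟨g0, hg0⟩ := GrMod.exists_tensor_hom M N (f.restrictScalars K) fun i x hx => by
    by_cases h : i = d
    · subst h
      exact hf x
    · have : x = 0 := by
        rw [← M.proj_self i x hx]
        exact M.proj_ne _ _ (Ne.symm h) x (by rw [hM]; exact Submodule.mem_top)
      rw [this, map_zero]
      exact Submodule.zero_mem _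
  have hker : Submodule.span A (τ.standardRel M) ≤ LinearMap.ker g0.1 := by
    rw [Submodule.span_le]
    rintro _ (⟨t, m, rfl⟩ | ⟨i, b, m, hi, -, hbi, rfl⟩)
    · change g0.1 _ = 0
      rw [map_sub, hg0, hg0, one_smul, sub_eq_zero]
      exact (f.map_smul t m).symm
    · change g0.1 _ = 0
      rw [hg0]
      have := N.smul_mem i d b (f m) hbi (hf m)
      rw [hN _ (by omega)] at this
      exact (Submodule.mem_bot K).1 this
  obtain ⟨g, hg⟩ := (GrMod.mkQ (GrMod.tensor 𝒜 M) ⟨_, τ.isGraded_standardRel M⟩).exists_desc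
    (GrMod.mkQ_surjective _ _) g0 fun x hx => hker ((GrMod.mkQ_eq_zero _ _ x).1 hx)
  refine ⟨g, fun x => ?_⟩
  have : g.1 (τ.stdIncl M x) = g0.1 (GrMod.tmk 𝒜 M 1 x) := hg _
  exact this.trans ((hg0 1 x).trans (one_smul A (f x)))

/-- The canonical map `λ → Δ(λ)`. -/
noncomputable abbrev wtIncl (lam : τ.Wt) : lam.rep →ₗ[τ.T] τ.std lam := τ.stdIncl lam.rep

theorem span_range_wtIncl (lam : τ.Wt) :
    Submodule.span A (LinearMap.range (wtIncl lam) : Set (τ.std lam)) = ⊤ :=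
  span_range_stdIncl lam.rep

theorem wtIncl_mem_gr (lam : τ.Wt) (x : lam.rep) : wtIncl lam x ∈ (τ.std lam).gr lam.deg :=
  stdIncl_mem_gr _ (mem_gr_deg lam x)

theorem range_wtIncl_le (lam : τ.Wt) :
    ∀ x ∈ LinearMap.range (wtIncl lam), x ∈ (τ.std lam).gr lam.deg := by
  rintro _ ⟨x, rfl⟩
  exact wtIncl_mem_gr lam x

theorem isSingular_range_wtIncl (lam : τ.Wt) : τ.IsSingular (LinearMap.range (wtIncl lam)) := by
  rintro j hj a ha haj _ ⟨x, rfl⟩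
  exact pos_smul_stdIncl _ hj ha haj x

theorem IsWeaklyTriangular.negMul_range_wtIncl (hτ : τ.IsWeaklyTriangular) (lam : τ.Wt) :
    τ.negMul ((LinearMap.range (wtIncl lam)).restrictScalars K) = ⊤ := by
  rw [← hτ.span_eq_negMul _ (isSingular_range_wtIncl lam)]
  rw [span_range_wtIncl]
  rfl

theorem IsWeaklyTriangular.finrank_std_le (hτ : τ.IsWeaklyTriangular) (lam : τ.Wt) :
    Module.finrank K (τ.std lam) ≤ Module.finrank K τ.neg * Module.finrank K lam.rep := by
  have h1 := finrank_negMul_le (τ := τ) ((LinearMap.range (wtIncl lam)).restrictScalars K)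
  rw [hτ.negMul_range_wtIncl, finrank_top] at h1
  refine h1.trans (Nat.mul_le_mul_left _ ?_)
  exact ((wtIncl lam).restrictScalars K).finrank_range_le

/-- Δ(λ) is A⁻ applied to the image of λ, and A⁻ = K + A⁻_{<0}; so nothing lies above degree `deg
λ`, and in that degree there is only the image of λ. -/
theorem IsWeaklyTriangular.proj_std (hτ : τ.IsWeaklyTriangular) (lam : τ.Wt) (y : τ.std lam) :
    (∀ j, lam.deg < j → (τ.std lam).proj j y = 0) ∧
      (τ.std lam).proj lam.deg y ∈ LinearMap.range (wtIncl lam) := by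
  let M := τ.std lam
  let V := (LinearMap.range (wtIncl lam)).restrictScalars K
  let S : Submodule K M := (⨅ j, ⨅ (_ : lam.deg < j), LinearMap.ker (M.proj j)) ⊓
    V.comap (M.proj lam.deg)
  have hmem : ∀ y : M, y ∈ S ↔ (∀ j, lam.deg < j → M.proj j y = 0) ∧ M.proj lam.deg y ∈ V := by
    intro y
    simp [S, Submodule.mem_inf, Submodule.mem_iInf]
  have hS : τ.negMul V ≤ S := by
    refine negMul_le ?_
    rintro a ha x hx
    refine hτ.neg_le (S.comap (LinearMap.toSpanSingleton A M x |>.restrictScalars K)) ?_ ?_ ha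
    · change (1 : A) • x ∈ S
      rw [one_smul, hmem]
      have hxd := range_wtIncl_le lam x hx
      refine ⟨fun j hj => M.proj_ne _ _ (ne_of_lt hj) x hxd, ?_⟩
      rw [M.proj_self _ x hxd]
      exact hx
    · intro i hi a _ hai
      change a • x ∈ S
      have hxd := M.smul_mem i _ a x hai (range_wtIncl_le lam x hx)
      rw [hmem]
      refine ⟨fun j hj => M.proj_ne _ _ (by omega) _ hxd, ?_⟩
      rw [M.proj_ne _ _ (by omega) _ hxd]
      exact V.zero_mem
  have hy : y ∈ S := hS (by rw [hτ.negMul_range_wtIncl]; exact Submodule.mem_top)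
  exact (hmem y).1 hy

theorem IsWeaklyTriangular.std_gr_eq_bot (hτ : τ.IsWeaklyTriangular) (lam : τ.Wt) (j : ℤ)
    (hj : lam.deg < j) : (τ.std lam).gr j = ⊥ := by
  rw [eq_bot_iff]
  intro y hy
  rw [← (τ.std lam).proj_self j y hy]
  exact (Submodule.mem_bot K).2 ((hτ.proj_std lam y).1 j hj)

theorem IsWeaklyTriangular.mem_std_gr_deg (hτ : τ.IsWeaklyTriangular) (lam : τ.Wt)
    (y : τ.std lam) : y ∈ (τ.std lam).gr lam.deg ↔ y ∈ LinearMap.range (wtIncl lam) := by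
  refine ⟨fun hy => ?_, range_wtIncl_le lam y⟩
  rw [← (τ.std lam).proj_self _ y hy]
  exact (hτ.proj_std lam y).2

theorem exists_std_hom {κ : τ.Wt} {N : GrMod 𝒜} (f : κ.rep →ₗ[τ.T] N)
    (hf : ∀ x, f x ∈ N.gr κ.deg) (hN : ∀ j, κ.deg < j → N.gr j = ⊥) :
    ∃ g : (τ.std κ).Hom N, ∀ x, g.1 (wtIncl κ x) = f x :=
  exists_stdFunctor_hom (gr_deg κ) f hf hN

/-! ### The highest weight space of a standard object -/

/-- `D` is the largest degree in which A⁺ is nonzero. In A = A⁻ T A⁺ the other two factors cannot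
raise degrees, so `A` vanishes above `D`. -/
theorem IsWeaklyTriangular.exists_top (hτ : τ.IsWeaklyTriangular) [Nontrivial A] :
    ∃ (D : ℤ) (p : A), p ∈ τ.pos ∧ p ∈ 𝒜 D ∧ p ≠ 0 ∧ ∀ j, D < j → 𝒜 j = ⊥ := by
  have hfin : {i | 𝒜 i ≠ ⊥}.Finite := WellFoundedGT.finite_ne_bot_of_iSupIndep
    (DirectSum.Decomposition.isInternal 𝒜).submodule_iSupIndep
  let I : Set ℤ := {i | ∃ p ∈ τ.pos, p ∈ 𝒜 i ∧ p ≠ 0}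
  have hI : I.Finite := hfin.subset fun i ⟨p, _, hp, hp0⟩ h => hp0 (by
    rw [h] at hp
    exact (Submodule.mem_bot K).1 hp)
  obtain ⟨D, hD, hmax⟩ := hI.toFinset.exists_max_image _root_.id
    ⟨0, hI.mem_toFinset.2 ⟨1, τ.pos.one_mem, SetLike.one_mem_graded 𝒜, one_ne_zero⟩⟩
  obtain ⟨p, hp, hpD, hp0⟩ := hI.mem_toFinset.1 hD
  refine ⟨D, p, hp, hpD, hp0, fun j hj => ?_⟩
  have hker : LinearMap.ker (GradedAlgebra.proj 𝒜 j) = ⊤ := by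
    refine hτ.eq_top _ fun n hn t ht q hq => ?_
    have h1 : τ.neg.toSubmodule ≤ (LinearMap.ker (GradedAlgebra.proj 𝒜 j)).comap
        (LinearMap.mulRight K (t * q)) := by
      refine τ.neg_le.trans (iSup_le fun k n hn => ?_)
      have h2 : τ.pos.toSubmodule ≤ ((LinearMap.ker (GradedAlgebra.proj 𝒜 j)).comap
          (LinearMap.mulLeft K (n * t))) := by
        refine τ.pos_le.trans (iSup_le fun i q hq => ?_)
        change GradedAlgebra.proj 𝒜 j (n * t * q) = 0
        by_cases hq0 : q = 0
        · rw [hq0, mul_zero, map_zero]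
        · have hi : (i : ℤ) ≤ D := hmax i (hI.mem_toFinset.2 ⟨q, hq.1, hq.2, hq0⟩)
          have := SetLike.mul_mem_graded (SetLike.mul_mem_graded hn.2 (τ.T_le ht)) hq.2
          rw [GradedAlgebra.proj_apply]
          exact DirectSum.decompose_of_mem_ne 𝒜 this (by omega)
      change GradedAlgebra.proj 𝒜 j (n * (t * q)) = 0
      rw [← mul_assoc]
      exact h2 hq
    have := h1 hn
    change GradedAlgebra.proj 𝒜 j (n * (t * q)) = 0 at this
    rwa [← mul_assoc] at this
  rw [eq_bot_iff]
  intro a ha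
  have h1 : a ∈ LinearMap.ker (GradedAlgebra.proj 𝒜 j) := by rw [hker]; exact Submodule.mem_top
  rw [LinearMap.mem_ker, GradedAlgebra.proj_apply, DirectSum.decompose_of_mem_same 𝒜 ha] at h1
  exact (Submodule.mem_bot K).2 h1

/-- Every simple `T`-module occurs in top degree of some numerically free module. -/
theorem IsWeaklyTriangular.exists_negFree_top (hτ : τ.IsWeaklyTriangular) [IsSemisimpleRing τ.T]
    (lam : τ.Wt) : ∃ M : GrMod 𝒜, τ.IsNegFree M ∧ (∀ j, lam.deg < j → M.gr j = ⊥) ∧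
      ∃ f : lam.rep →ₗ[τ.T] M, Function.Injective f ∧ ∀ x, f x ∈ M.gr lam.deg := by
  have := nontrivial_of_wt lam
  obtain ⟨D, p, hp, hpD, hp0, hD⟩ := hτ.exists_top
  obtain ⟨I, ⟨e⟩⟩ :=
    IsSemisimpleRing.exists_linearEquiv_ideal_of_isSimpleModule (R := τ.T) (M := lam.rep)
  obtain ⟨v, hv⟩ := exists_ne_zero lam
  -- The shift by `-D` cancels the degree of `p`, so the top degree of `A ⊗ V` is at most `deg λ`
  -- and `p ⊗ v` has degree `deg λ`.
  let V := lam.rep.shift (-D)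
  let M := GrMod.tensor 𝒜 V
  have hgr : ∀ n, M.gr n = ⨆ i, Submodule.map₂ (TensorProduct.mk K A V) (𝒜 i) (V.gr (n - i)) :=
    fun n => rfl
  refine ⟨M, hτ.isNegFree_tensor V, fun j hj => ?_, ?_⟩
  · refine (hgr j).trans (iSup_eq_bot.2 fun i => ?_)
    by_cases hi : D < i
    · rw [hD i hi, Submodule.map₂_bot_left]
      rfl
    · have : V.gr (j - i) = ⊥ := by
        rw [eq_bot_iff]
        intro x hx
        exact (Submodule.mem_bot K).2 (eq_zero_of_mem_gr lam (by omega)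
          (show x ∈ lam.rep.gr (j - i - -D) from hx))
      rw [this, Submodule.map₂_bot_right]
      rfl
  · let f : lam.rep →ₗ[τ.T] M :=
      { toFun := fun x => GrMod.tmk 𝒜 V ((e x : τ.T) * p) v
        map_add' := fun x y => by
          rw [map_add, Submodule.coe_add, Subalgebra.coe_add, add_mul, map_add]
          rfl
        map_smul' := fun t x => by
          rw [map_smul, Submodule.coe_smul, smul_eq_mul, Subalgebra.coe_mul, mul_assoc]
          rfl }
    refine ⟨f, ?_, fun x => ?_⟩
    · rw [← LinearMap.ker_eq_bot, LinearMap.ker_eq_bot']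
      intro x hx
      have h1 : ((e x : τ.T) : A) * p = 0 := eq_zero_of_tmul_eq_zero (K := K) hv hx
      have h2 := hτ.mul_right_injective hp hp0 _ h1
      exact e.injective ((Subtype.ext h2 : e x = 0).trans (map_zero e).symm)
    · have h1 := SetLike.mul_mem_graded (τ.T_le (e x : τ.T).2) hpD
      rw [zero_add] at h1
      refine GrMod.tmk_mem_gr V h1 (j := lam.deg - D) ?_ (by omega)
      change v ∈ lam.rep.gr (lam.deg - D - -D)
      rw [sub_neg_eq_add, sub_add_cancel]
      exact mem_gr_deg lam v

/-- That the relations of Δ(λ) do not collapse λ is seen in a model: the embedding of λ from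
`exists_negFree_top` factors through λ → Δ(λ). -/
theorem IsWeaklyTriangular.wtIncl_injective (hτ : τ.IsWeaklyTriangular) [IsSemisimpleRing τ.T]
    (lam : τ.Wt) : Function.Injective (wtIncl lam) := by
  obtain ⟨M, -, hM, f, hf, hfd⟩ := hτ.exists_negFree_top lam
  obtain ⟨g, hg⟩ := exists_std_hom f hfd hM
  intro x y hxy
  apply hf
  rw [← hg, ← hg, hxy]

theorem IsWeaklyTriangular.hasTop_std (hτ : τ.IsWeaklyTriangular) [IsSemisimpleRing τ.T]
    (lam : τ.Wt) : τ.HasTop (τ.std lam) lam :=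
  ⟨hτ.std_gr_eq_bot lam, wtIncl lam, hτ.wtIncl_injective lam, hτ.mem_std_gr_deg lam⟩

theorem eq_top_of_mem_wtIncl {lam : τ.Wt} (X : (τ.std lam).GrSub) {x : lam.rep} (hx : x ≠ 0)
    (hX : wtIncl lam x ∈ X.1) : X = ⊤ := by
  let S : Submodule τ.T lam.rep := (X.1.restrictScalars τ.T).comap (wtIncl lam)
  have hS : S = ⊤ := (eq_bot_or_eq_top S).resolve_left fun h => hx (by
    have hxS : x ∈ S := hX
    rw [h] at hxS
    exact (Submodule.mem_bot τ.T).1 hxS)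
  rw [GrMod.eq_top_iff_sub, eq_top_iff, ← span_range_wtIncl lam, Submodule.span_le]
  rintro _ ⟨y, rfl⟩
  have hy : y ∈ S := by rw [hS]; exact Submodule.mem_top
  exact hy

/-- The greatest proper subobject consists of the `x` for which `A x` has no component in degree
`deg λ`. A subobject not contained in it has a nonzero element in that degree, hence contains all of
the simple module λ, which generates. -/
theorem IsWeaklyTriangular.isLocal_std (hτ : τ.IsWeaklyTriangular) [IsSemisimpleRing τ.T]
    (lam : τ.Wt) : (τ.std lam).IsLocal := by
  let M := τ.std lam
  let X : M.GrSub := ⟨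
    { carrier := {x | ∀ a : A, M.proj lam.deg (a • x) = 0}
      zero_mem' := fun a => by rw [smul_zero, map_zero]
      add_mem' := fun {x y} hx hy a => by rw [smul_add, map_add, hx, hy, add_zero]
      smul_mem' := fun b x hx a => by rw [smul_smul]; exact hx _ },
    fun x hx i a => by
      induction a using DirectSum.Decomposition.inductionOn 𝒜 with
      | zero => rw [zero_smul, map_zero]
      | @homogeneous k a =>
        have h := hx a.1
        rw [M.proj_smul k lam.deg a.1 a.2] at h ⊢
        by_cases hi : i = lam.deg - k
        · rwa [hi, M.proj_self _ _ (M.proj_mem _ x)]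
        · rw [M.proj_ne _ _ hi _ (M.proj_mem i x), smul_zero]
      | add a b ha hb => rw [add_smul, map_add, ha, hb, add_zero]⟩
  refine ⟨X, fun h => ?_, fun Y hY y hy a => ?_⟩
  · obtain ⟨x, hx⟩ := exists_ne_zero lam
    rw [GrMod.eq_top_iff_sub] at h
    have h1 : wtIncl lam x ∈ X.1 := by rw [h]; exact Submodule.mem_top
    have h2 := h1 1
    rw [one_smul, M.proj_self _ _ (wtIncl_mem_gr lam x)] at h2
    exact hx (hτ.wtIncl_injective lam (h2.trans (map_zero _).symm))
  · by_contra h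
    have h1 : M.proj lam.deg (a • y) ∈ Y.1 := Y.2 _ (Y.1.smul_mem a hy) _
    obtain ⟨x, hx⟩ := (hτ.proj_std lam (a • y)).2
    apply hY
    refine eq_top_of_mem_wtIncl Y (x := x) (fun h0 => h ?_) (by rw [hx]; exact h1)
    rw [← hx, h0, map_zero]

theorem IsWeaklyTriangular.isSimple_simple (hτ : τ.IsWeaklyTriangular) [IsSemisimpleRing τ.T]
    (lam : τ.Wt) : (τ.simple lam).IsSimple := (hτ.isLocal_std lam).isSimple_head

/-- A simple `T`-submodule `κ` of the top component of `L` induces a nonzero map Δ(κ) → L, so `L` is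
the head of the local object Δ(κ). -/
theorem IsWeaklyTriangular.exists_simple_iso (hτ : τ.IsWeaklyTriangular) [IsSemisimpleRing τ.T]
    {L : GrMod 𝒜} (hL : L.IsSimple) : ∃ κ : τ.Wt, τ.HasTop L κ ∧ L.Iso (τ.simple κ) := by
  have := hL.1
  obtain ⟨d, hd, htop⟩ := L.exists_top_degree
  obtain ⟨κ, rfl, f, hf, hfV⟩ := exists_wt_of_ne_bot (d := d) (τ.topT L d) (topT_ne_bot hd)
  obtain ⟨g, hg⟩ := exists_std_hom f hfV htop
  obtain ⟨x, hx⟩ := exists_ne_zero κ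
  have hs : Function.Surjective g.1 := hL.surjective g (wtIncl κ x) (by
    rw [hg]
    exact fun h => hx (hf (h.trans (map_zero f).symm)))
  exact ⟨κ, (hτ.hasTop_std κ).of_surjective g hs hd,
    ((hτ.isLocal_std κ).head_iso hL g hs).symm⟩

theorem IsWeaklyTriangular.hasTop_simple (hτ : τ.IsWeaklyTriangular) [IsSemisimpleRing τ.T]
    (lam : τ.Wt) : τ.HasTop (τ.simple lam) lam := by
  refine (hτ.hasTop_std lam).of_surjective (GrMod.mkQ _ _) (GrMod.mkQ_surjective _ _) fun h => ?_
  obtain ⟨x, hx⟩ := exists_ne_zero lam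
  have h1 := (GrMod.mkQ (τ.std lam) (τ.std lam).rad).2 _ _ (wtIncl_mem_gr lam x)
  have h2 := (GrMod.mkQ_eq_zero _ _ _).1 ((Submodule.mem_bot K).1 (h ▸ h1))
  obtain ⟨X, hX, hmax⟩ := hτ.isLocal_std lam
  rw [GrMod.IsLocal.rad_eq hX hmax] at h2
  exact hX (eq_top_of_mem_wtIncl X hx h2)

/-- Reduces the recognition of simple objects to a comparison of top components. -/
theorem IsWeaklyTriangular.simple_iso_iff (hτ : τ.IsWeaklyTriangular) [IsSemisimpleRing τ.T]
    {L : GrMod 𝒜} (hL : L.IsSimple) (κ : τ.Wt) : L.Iso (τ.simple κ) ↔ τ.HasTop L κ := by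
  obtain ⟨μ, hμ, e⟩ := hτ.exists_simple_iso hL
  constructor
  · exact fun h => (hτ.hasTop_simple κ).of_iso h.symm
  · intro h
    rwa [h.unique hμ]

/-! ### Highest weights and standard filtrations -/

/-- The component of `M` in degree `deg κ` is a simple `T`-module, so in any composition series
exactly one factor carries it, and carries all of it. That factor is L(κ); the others vanish in
degrees at least `deg κ`. -/
theorem HasTop.hasHighestWeight (hτ : τ.IsWeaklyTriangular) [IsSemisimpleRing τ.T] {M : GrMod 𝒜}
    {κ : τ.Wt} (h : τ.HasTop M κ) : τ.HasHighestWeight M κ := by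
  have key : ∀ F : M.Filtration, (∀ i < F.length, (F.quotient i).IsSimple) →
      ∃ i0 < F.length, τ.HasTop (F.quotient i0) κ ∧
        ∀ i < F.length, i ≠ i0 → (F.quotient i).gr κ.deg = ⊥ := by
    intro F hF
    obtain ⟨hb, f, hf, hr⟩ := h
    -- By simplicity of `κ` a subobject contains the top component or meets it in zero; one nonzero
    -- vector `x0` decides which.
    have hdich : ∀ X : M.GrSub, (∀ x ∈ M.gr κ.deg, x ∈ X.1) ∨
        (∀ x ∈ M.gr κ.deg, x ∈ X.1 → x = 0) := by
      intro X
      rcases eq_bot_or_eq_top ((X.1.restrictScalars τ.T).comap f) with hX | hX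
      · right
        intro x hx hxX
        obtain ⟨z, rfl⟩ := (hr x).1 hx
        have hz : z ∈ (X.1.restrictScalars τ.T).comap f := hxX
        rw [hX] at hz
        rw [(Submodule.mem_bot τ.T).1 hz, map_zero]
      · left
        intro x hx
        obtain ⟨z, rfl⟩ := (hr x).1 hx
        have hz : z ∈ (X.1.restrictScalars τ.T).comap f := by rw [hX]; exact Submodule.mem_top
        exact hz
    have hx0 : ∃ x ∈ M.gr κ.deg, x ≠ 0 := by
      obtain ⟨z, hz⟩ := exists_ne_zero κ
      exact ⟨f z, (hr _).2 ⟨z, rfl⟩, fun h0 => hz (hf (h0.trans (map_zero f).symm))⟩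
    obtain ⟨x0, hx0, hx0ne⟩ := hx0
    let p : ℕ → Prop := fun i => x0 ∉ (F.step i).1
    have hp : ∃ i, p i := ⟨F.length, fun hmem => hx0ne (by
      rw [F.step_length] at hmem
      exact (Submodule.mem_bot A).1 hmem)⟩
    classical
    -- `n` is the first step that misses `x0`, so the distinguished factor has index `n - 1`.
    obtain ⟨n, hn, hnmin⟩ : ∃ n, p n ∧ ∀ m < n, ¬ p m :=
      ⟨Nat.find hp, Nat.find_spec hp, fun m hm => Nat.find_min hp hm⟩
    have hn0 : n ≠ 0 := by
      rintro rfl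
      apply hn
      rw [F.step_zero]
      exact Submodule.mem_top
    have hnlen : n ≤ F.length := by
      by_contra hlt
      refine hnmin F.length (by omega) fun hmem => hx0ne ?_
      rw [F.step_length] at hmem
      exact (Submodule.mem_bot A).1 hmem
    have hbig : ∀ i < n, ∀ x ∈ M.gr κ.deg, x ∈ (F.step i).1 := by
      intro i hi
      rcases hdich (F.step i) with h1 | h1
      · exact h1
      · exact absurd (h1 x0 hx0 (not_not.1 (hnmin i hi))) hx0ne
    have hsmall : ∀ i, n ≤ i → i ≤ F.length → ∀ x ∈ M.gr κ.deg, x ∈ (F.step i).1 → x = 0 := by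
      intro i hi hil
      rcases hdich (F.step i) with h1 | h1
      · exact absurd (F.antitone hi hil (h1 x0 hx0)) hn
      · exact h1
    have hker : ∀ i (z : M.sub (F.step i)),
        (GrMod.mkQ (M.sub (F.step i)) ((M.incl (F.step i)).comapSub (F.step (i + 1)))).1 z = 0 ↔
          (M.incl _).1 z ∈ (F.step (i + 1)).1 := fun i z => GrMod.mkQ_eq_zero _ _ z
    refine ⟨n - 1, by omega, ?_, fun i hi hine => ?_⟩
    · have hsub : τ.HasTop (M.sub (F.step (n - 1))) κ :=
        HasTop.sub ⟨hb, f, hf, hr⟩ _ (hbig _ (by omega))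
      refine hsub.of_surjective (GrMod.mkQ (M.sub (F.step (n - 1)))
        ((M.incl (F.step (n - 1))).comapSub (F.step (n - 1 + 1)))) (GrMod.mkQ_surjective _ _)
        fun hbot => hx0ne ?_
      let z : M.sub (F.step (n - 1)) := ⟨x0, hbig _ (by omega) x0 hx0⟩
      have hz := (GrMod.mkQ (M.sub (F.step (n - 1)))
        ((M.incl (F.step (n - 1))).comapSub (F.step (n - 1 + 1)))).2 κ.deg z hx0
      have hz' := (hker _ z).1 ((Submodule.mem_bot K).1 (hbot.le hz))
      exact hsmall _ (by omega) (by omega) x0 hx0 hz'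
    · change ((M.sub (F.step i)).quot ((M.incl (F.step i)).comapSub (F.step (i + 1)))).gr κ.deg = ⊥
      rw [eq_bot_iff]
      intro y hy
      obtain ⟨z, hz, rfl⟩ := (GrMod.mkQ _ _).exists_homogeneous_preimage
        (GrMod.mkQ_surjective _ _) _ y hy
      have hzd : (M.incl _).1 z ∈ M.gr κ.deg := hz
      refine (Submodule.mem_bot K).2 ((hker i z).2 ?_)
      by_cases hin : i < n
      · exact hbig (i + 1) (by omega) _ hzd
      · rw [hsmall i (by omega) hi.le _ hzd z.2]
        exact Submodule.zero_mem _
  have hgt : ∀ (F : M.Filtration) (i : ℕ) (j : ℤ), κ.deg < j → (F.quotient i).gr j = ⊥ :=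
    fun F i j hj => GrMod.gr_eq_bot_of_surjective (GrMod.mkQ _ _) (GrMod.mkQ_surjective _ _) j
      (GrMod.gr_eq_bot_of_injective (M.incl _) (M.incl_injective _) j (h.1 j hj))
  obtain ⟨F1, hF1⟩ := M.exists_composition_series
  have hne : ∀ μ : τ.Wt, {n | ∃ F : M.Filtration, (∀ i < F.length, (F.quotient i).IsSimple) ∧
      n = Nat.card {i : Fin F.length // (F.quotient i).Iso (τ.simple μ)}}.Nonempty :=
    fun μ => ⟨_, F1, hF1, rfl⟩
  constructor
  · intro μ hμ
    -- The multiplicity is an infimum attained by some series. As `key` covers every series,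
    -- Jordan–Hölder is not needed.
    obtain ⟨F, hF, hcard⟩ := Nat.sInf_mem (hne μ)
    have hpos : Nat.card {i : Fin F.length // (F.quotient i).Iso (τ.simple μ)} ≠ 0 := by
      rw [← hcard]
      exact hμ
    obtain ⟨⟨i, hi⟩⟩ := (Nat.card_ne_zero.1 hpos).1
    have htop := (hτ.simple_iso_iff (hF i i.2) μ).1 hi
    obtain ⟨i0, hi0, htop0, hother⟩ := key F hF
    by_cases hii : (i : ℕ) = i0
    · left
      rw [hii] at htop
      exact htop.unique htop0
    · right
      rcases lt_trichotomy μ.deg κ.deg with hlt | heq | hgt'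
      · exact hlt
      · exact absurd (heq ▸ hother i i.2 hii) htop.gr_ne_bot
      · exact absurd (hgt F i _ hgt') htop.gr_ne_bot
  · obtain ⟨F, hF, hcard⟩ := Nat.sInf_mem (hne κ)
    obtain ⟨i0, hi0, htop0, hother⟩ := key F hF
    refine hcard.trans (Nat.card_eq_one_iff_unique.2 ⟨⟨?_⟩, ⟨⟨⟨i0, hi0⟩, ?_⟩⟩⟩)
    · have huniq : ∀ i : {i : Fin F.length // (F.quotient i).Iso (τ.simple κ)},
          (i.1 : ℕ) = i0 := by
        rintro ⟨i, hi⟩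
        by_contra hii
        exact ((hτ.simple_iso_iff (hF i i.2) κ).1 hi).gr_ne_bot (hother i i.2 hii)
      intro i j
      exact Subtype.ext (Fin.ext ((huniq i).trans (huniq j).symm))
    · exact (hτ.simple_iso_iff (hF i0 hi0) κ).2 htop0

theorem HasHighestWeight.unique {M : GrMod 𝒜} {κ κ' : τ.Wt} (h : τ.HasHighestWeight M κ)
    (h' : τ.HasHighestWeight M κ') : κ = κ' := by
  have h1 := h.1 κ' (by rw [h'.2]; exact one_ne_zero)
  have h2 := h'.1 κ (by rw [h.2]; exact one_ne_zero)
  rcases h1 with h1 | h1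
  · exact h1.symm
  · rcases h2 with h2 | h2
    · exact h2
    · omega

/-- In a numerically free module, a simple `T`-submodule of top degree generates a standard
object. -/
theorem IsWeaklyTriangular.std_iso_gen (hτ : τ.IsWeaklyTriangular) {M : GrMod 𝒜}
    (hM : τ.IsNegFree M) {κ : τ.Wt} (hd : ∀ j, κ.deg < j → M.gr j = ⊥) (f : κ.rep →ₗ[τ.T] M)
    (hf : Function.Injective f) (hfd : ∀ x ∈ LinearMap.range f, x ∈ M.gr κ.deg) :
    (M.sub (gen (LinearMap.range f) hfd)).Iso (τ.std κ) := by
  obtain ⟨g, hg⟩ := exists_std_hom f (fun x => hfd _ ⟨x, rfl⟩) hd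
  have hmem : ∀ y, g.1 y ∈ (gen (LinearMap.range f) hfd).1 := by
    intro y
    have hle : Submodule.span A (LinearMap.range (wtIncl κ) : Set (τ.std κ)) ≤
        (gen (LinearMap.range f) hfd).1.comap g.1 := by
      rw [Submodule.span_le]
      rintro _ ⟨x, rfl⟩
      change g.1 (wtIncl κ x) ∈ Submodule.span A _
      rw [hg]
      exact Submodule.subset_span ⟨x, rfl⟩
    exact hle (by rw [span_range_wtIncl]; exact Submodule.mem_top)
  have hsurj : Function.Surjective (g.cod _ hmem).1 := by
    rintro ⟨y, hy⟩
    have hle : (gen (LinearMap.range f) hfd).1 ≤ LinearMap.range g.1 := by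
      change Submodule.span A _ ≤ _
      rw [Submodule.span_le]
      rintro _ ⟨x, rfl⟩
      exact ⟨_, hg x⟩
    obtain ⟨z, hz⟩ := hle hy
    exact ⟨z, Subtype.ext hz⟩
  refine ((g.cod _ hmem).iso_of_bijective ((g.cod _ hmem).bijective_of_surjective hsurj ?_)).symm
  -- The generated submodule has dimension dim A⁻ · dim κ, an upper bound for dim Δ(κ); the
  -- surjection from Δ(κ) is therefore bijective.
  rw [(hτ.finrank_gen_and_quot hM _ hfd hd).1]
  refine (hτ.finrank_std_le κ).trans (Nat.mul_le_mul_left _ ?_)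
  exact (LinearMap.finrank_range_of_inj (f := f.restrictScalars K) hf).ge

/-- A simple `T`-submodule of the top component generates some Δ(κ), and the quotient is again
numerically free, so the induction continues. -/
theorem IsWeaklyTriangular.exists_standardFiltration (hτ : τ.IsWeaklyTriangular)
    [IsSemisimpleRing τ.T] {M : GrMod 𝒜} (hM : τ.IsNegFree M) :
    ∃ F : M.Filtration, τ.IsStandardFiltration F := by
  refine GrMod.exists_filtration (C := fun N => ∃ μ : τ.Wt, N.Iso (τ.std μ)) (D := τ.IsNegFree)
    (fun h ⟨μ, hμ⟩ => ⟨μ, h.symm.trans hμ⟩) ?_ M hM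
  intro M hM _
  obtain ⟨d, hd, htop⟩ := M.exists_top_degree
  obtain ⟨κ, rfl, f, hf, hfV⟩ := exists_wt_of_ne_bot (d := d) (τ.topT M d) (topT_ne_bot hd)
  have hfd : ∀ x ∈ LinearMap.range f, x ∈ M.gr κ.deg := by
    rintro _ ⟨x, rfl⟩
    exact hfV x
  have hiso := hτ.std_iso_gen hM htop f hf hfd
  refine ⟨gen _ hfd, ?_, ⟨κ, hiso⟩, (hτ.finrank_gen_and_quot hM _ hfd htop).2⟩
  obtain ⟨x, hx⟩ := exists_ne_zero κ
  exact Submodule.nontrivial_iff_ne_bot.2 fun h => hx (hf (by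
    have : f x ∈ (gen (LinearMap.range f) hfd).1 := Submodule.subset_span ⟨x, rfl⟩
    rw [h] at this
    exact ((Submodule.mem_bot A).1 this).trans (map_zero f).symm))

end GradedTriple

/-- With finitely many classes, two iterates `fⁱ x` and `fʲ x`, `i < j`, lie in one class and so
differ by a shift. Cancelling `fⁱ` by injectivity shows that `f^(j-i) x` is a shift of `x`; undoing
the shift puts `x` in the image. -/
theorem surjective_of_injective_of_commute {X C : Type*} [Finite C] (c : X → C) (s : ℤ → X → X)
    (hs : ∀ n x, s (-n) (s n x) = x) (hc : ∀ x y, c x = c y → ∃ n, y = s n x) {f : X → X}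
    (hinj : Function.Injective f) (hf : ∀ n x, f (s n x) = s n (f x)) :
    Function.Surjective f := by
  have hiter : ∀ (k : ℕ) n x, f^[k] (s n x) = s n (f^[k] x) := by
    intro k n
    induction k with
    | zero => exact fun x => rfl
    | succ k ih =>
      intro x
      rw [Function.iterate_succ_apply, Function.iterate_succ_apply, hf, ih]
  have key : ∀ (x : X) (i j : ℕ), i < j → c (f^[i] x) = c (f^[j] x) → ∃ y, f y = x := by
    intro x i j hij h
    obtain ⟨n, hn⟩ := hc _ _ h
    obtain ⟨k, rfl⟩ : ∃ k, j = i + (k + 1) := ⟨j - i - 1, by omega⟩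
    rw [← hiter, Function.iterate_add_apply] at hn
    have h1 := hinj.iterate i hn
    refine ⟨s (-n) (f^[k] x), ?_⟩
    rw [hf, ← Function.iterate_succ_apply' f k x, h1, hs]
  intro x
  obtain ⟨i, j, hij, h⟩ := Finite.exists_ne_map_eq_of_infinite fun i : ℕ => c (f^[i] x)
  rcases lt_or_gt_of_ne hij with hlt | hlt
  · exact key x i j hlt h
  · exact key x j i hlt h.symm

namespace GrMod

/-! ### Shifts -/

section Shift

variable {K A : Type u} [Field K] [Ring A] [Algebra K A] {𝒜 : ℤ → Submodule K A}
  {M N : GrMod 𝒜}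

theorem proj_shift (M : GrMod 𝒜) (n i : ℤ) : (M.shift n).proj i = M.proj (i - n) := by
  refine proj_ext (M.shift n) _ _ fun j x hx => ?_
  by_cases h : j = i
  · subst h
    exact ((M.shift n).proj_self j x hx).trans (M.proj_self _ x hx).symm
  · exact ((M.shift n).proj_ne i j h x hx).trans (M.proj_ne _ (j - n) (by omega) x hx).symm

/-- The shift of a morphism. -/
def Hom.shift (f : M.Hom N) (n : ℤ) : (M.shift n).Hom (N.shift n) :=
  ⟨f.1, fun i x hx => f.2 (i - n) x hx⟩

theorem Hom.shift_injective {f : M.Hom N} (hf : Function.Injective f.1) (n : ℤ) :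
    Function.Injective (f.shift n).1 := hf

/-- A graded submodule of a shift as a submodule of the original module. -/
def unshiftSub {n : ℤ} (X : (M.shift n).GrSub) : M.GrSub :=
  ⟨X.1, fun x hx i => by
    have := X.2 x hx (i + n)
    rw [proj_shift, add_sub_cancel_right] at this
    exact this⟩

theorem IsSimple.shift (hM : M.IsSimple) (n : ℤ) : (M.shift n).IsSimple := by
  refine ⟨hM.1, fun X => ?_⟩
  rcases hM.2 (unshiftSub X) with h | h
  · exact Or.inl (Subtype.ext ((eq_bot_iff_sub (unshiftSub X)).1 h))
  · exact Or.inr (Subtype.ext ((eq_top_iff_sub (unshiftSub X)).1 h))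

theorem IsProjective.shift (hM : M.IsProjective) (n : ℤ) : (M.shift n).IsProjective := by
  intro X Y g f hg
  obtain ⟨k, hk⟩ := hM (X.shift (-n)) (Y.shift (-n)) (g.shift (-n))
    ⟨f.1, fun i x hx => f.2 (i - -n) x (by
      change x ∈ M.gr (i - -n - n)
      rwa [sub_neg_eq_add, add_sub_cancel_right])⟩ hg
  refine ⟨⟨k.1, fun i x hx => ?_⟩, hk⟩
  have : k.1 x ∈ X.gr (i - n - -n) := k.2 (i - n) x hx
  rwa [sub_neg_eq_add, sub_add_cancel] at this

theorem IsProjectiveCover.shift (h : M.IsProjectiveCover N) (n : ℤ) :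
    (M.shift n).IsProjectiveCover (N.shift n) := by
  obtain ⟨hM, f, hf, hc⟩ := h
  exact ⟨hM.shift n, f.shift n, hf, fun X hX =>
    Subtype.ext ((eq_top_iff_sub (unshiftSub X)).1 (hc (unshiftSub X) hX))⟩

end Shift

/-! ### The last subquotient of a filtration as a subobject. -/

section Filtration

variable {K A : Type u} [Field K] [Ring A] [Algebra K A] {𝒜 : ℤ → Submodule K A}

theorem Filtration.length_pos {M : GrMod 𝒜} [Nontrivial M] (F : M.Filtration) :
    0 < F.length := by
  refine Nat.pos_of_ne_zero fun h => ?_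
  have h1 := F.step_length
  rw [h, F.step_zero, eq_bot_iff_sub] at h1
  exact bot_ne_top (α := Submodule A M) h1.symm

theorem Filtration.exists_last_quotient_injective {M N : GrMod 𝒜} (F : M.Filtration) (hF : 0 < F.length)
    (e : (F.quotient (F.length - 1)).Iso N) : ∃ g : N.Hom M, Function.Injective g.1 := by
  obtain ⟨k, hk⟩ := e.exists_hom
  let q := mkQ (M.sub (F.step (F.length - 1)))
    ((M.incl (F.step (F.length - 1))).comapSub (F.step (F.length - 1 + 1)))
  have hb : F.step (F.length - 1 + 1) = ⊥ := by
    rw [Nat.sub_add_cancel hF]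
    exact F.step_length
  have hq : Function.Injective q.1 := by
    rw [← LinearMap.ker_eq_bot, LinearMap.ker_eq_bot']
    intro x hx
    have hx' : (M.incl _).1 x ∈ (F.step (F.length - 1 + 1)).1 := (mkQ_eq_zero _ _ x).1 hx
    rw [hb] at hx'
    exact M.incl_injective _ (((Submodule.mem_bot A).1 hx').trans (map_zero _).symm)
  have hb : Function.Bijective (Hom.comp (show Hom ((M.sub (F.step (F.length - 1))).quot
    ((M.incl (F.step (F.length - 1))).comapSub (F.step (F.length - 1 + 1)))) N from k) q).1 :=
    hk.comp ⟨hq, mkQ_surjective _ _⟩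
  obtain ⟨g, hg⟩ := (Hom.iso_of_bijective _ hb).symm.exists_hom
  exact ⟨(M.incl _).comp g, (M.incl_injective _).comp hg.1⟩

end Filtration

end GrMod

/-! ### Finiteness of the weights up to shift. -/

namespace GradedTriple

variable {K A : Type u} [Field K] [Ring A] [Algebra K A] {𝒜 : ℤ → Submodule K A}
  {τ : GradedTriple 𝒜}

/-- A semisimple ring has finitely many isotypic components; they label the weights up to shift. -/
theorem exists_component_map (τ : GradedTriple 𝒜) [IsSemisimpleRing τ.T] :
    ∃ c : τ.Wt → isotypicComponents τ.T τ.T, ∀ lam μ, c lam = c μ →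
      Nonempty (lam.rep ≃ₗ[τ.T] μ.rep) := by
  have hex : ∀ lam : τ.Wt, ∃ I : Ideal τ.T, IsSimpleModule τ.T I ∧
      Nonempty (lam.rep ≃ₗ[τ.T] I) := by
    intro lam
    obtain ⟨I, ⟨e⟩⟩ :=
      IsSemisimpleRing.exists_linearEquiv_ideal_of_isSimpleModule (R := τ.T) (M := lam.rep)
    exact ⟨I, IsSimpleModule.congr e.symm, ⟨e⟩⟩
  choose I hI e using hex
  refine ⟨fun lam => ⟨isotypicComponent τ.T τ.T (I lam), I lam, hI lam, rfl⟩, fun lam μ h => ?_⟩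
  have h' : isotypicComponent τ.T τ.T (I μ) = isotypicComponent τ.T τ.T (I lam) :=
    (congrArg Subtype.val h).symm
  obtain ⟨e'⟩ := isIsotypicOfType_submodule_iff.1
    (IsIsotypicOfType.isotypicComponent τ.T τ.T (I lam)) (I μ)
    (h' ▸ Submodule.le_isotypicComponent (I μ))
  exact ⟨(e lam).some.trans (e'.symm.trans (e μ).some.symm)⟩

variable [GradedAlgebra 𝒜]

theorem exists_shift (lam : τ.Wt) (n : ℤ) :
    ∃ κ : τ.Wt, κ.deg = lam.deg + n ∧ Nonempty (κ.rep ≃ₗ[τ.T] lam.rep) :=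
  exists_wt_of_isSimpleModule lam.rep (lam.deg + n)

/-- The simple graded `T`-module `lam` moved up by `n`. -/
noncomputable def Wt.shift (lam : τ.Wt) (n : ℤ) : τ.Wt := (exists_shift lam n).choose

theorem Wt.deg_shift (lam : τ.Wt) (n : ℤ) : GrMod.Irr.deg (Wt.shift lam n) = lam.deg + n :=
  (exists_shift lam n).choose_spec.1

theorem Wt.nonempty_shift_equiv (lam : τ.Wt) (n : ℤ) :
    Nonempty (GrMod.Irr.rep (Wt.shift lam n) ≃ₗ[τ.T] lam.rep) :=
  (exists_shift lam n).choose_spec.2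

theorem Wt.eq_shift {lam μ : τ.Wt} (e : lam.rep ≃ₗ[τ.T] μ.rep) :
    μ = Wt.shift lam (μ.deg - lam.deg) := by
  obtain ⟨e'⟩ := Wt.nonempty_shift_equiv lam (μ.deg - lam.deg)
  refine Wt.eq_of_equiv (e.symm.trans e'.symm) ?_
  rw [Wt.deg_shift, add_sub_cancel]

theorem Wt.shift_neg_shift (lam : τ.Wt) (n : ℤ) : Wt.shift (Wt.shift lam n) (-n) = lam := by
  obtain ⟨e⟩ := Wt.nonempty_shift_equiv lam n
  have := Wt.eq_shift e
  rw [Wt.deg_shift, show lam.deg - (lam.deg + n) = -n by ring] at this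
  exact this.symm

theorem HasTop.shift {M : GrMod 𝒜} {κ : τ.Wt} (h : τ.HasTop M κ) (n : ℤ) :
    τ.HasTop (M.shift n) (Wt.shift κ n) := by
  obtain ⟨hb, f, hf, hr⟩ := h
  obtain ⟨e⟩ := Wt.nonempty_shift_equiv κ n
  refine ⟨fun j hj => hb (j - n) ?_, f ∘ₗ e.toLinearMap, hf.comp e.injective, fun x => ?_⟩
  · rw [Wt.deg_shift] at hj
    omega
  · have h1 := hr x
    have h2 : LinearMap.range (f ∘ₗ e.toLinearMap) = LinearMap.range f :=
      LinearMap.range_comp_of_range_eq_top _ (LinearEquiv.range e)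
    rw [← h2] at h1
    refine Iff.trans ?_ h1
    change x ∈ M.gr (GrMod.Irr.deg (Wt.shift κ n) - n) ↔ _
    rw [Wt.deg_shift, add_sub_cancel_right]
    exact Iff.rfl

/-- The set of weights is not finite in general, but it has finitely many orbits under shifting,
which is enough for equivariant maps. -/
theorem surjective_of_shift [IsSemisimpleRing τ.T] {f : τ.Wt → τ.Wt}
    (hinj : Function.Injective f) (hf : ∀ lam n, f (Wt.shift lam n) = Wt.shift (f lam) n) :
    Function.Surjective f := by
  obtain ⟨c, hc⟩ := exists_component_map τ
  refine surjective_of_injective_of_commute c (fun n lam => Wt.shift lam n)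
    (fun n lam => Wt.shift_neg_shift lam n) (fun lam μ h => ?_) hinj fun n lam => hf lam n
  obtain ⟨e⟩ := hc _ _ h
  exact ⟨_, Wt.eq_shift e⟩

/-! ### Indecomposable projectives -/

theorem gen_ne_bot {M : GrMod 𝒜} {V : Submodule τ.T M} {d : ℤ} (hV : ∀ x ∈ V, x ∈ M.gr d)
    (h : V ≠ ⊥) : gen V hV ≠ ⊥ := by
  intro h'
  rw [GrMod.eq_bot_iff_sub] at h'
  apply h
  rw [eq_bot_iff]
  intro x hx
  have : x ∈ (gen V hV).1 := Submodule.subset_span hx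
  rw [h'] at this
  exact (Submodule.mem_bot τ.T).2 ((Submodule.mem_bot A).1 this)

variable [FiniteDimensional K A]

theorem exists_tensor_simple (lam : τ.Wt) :
    ∃ q : (GrMod.tensor 𝒜 lam.rep).Hom (τ.simple lam), Function.Surjective q.1 :=
  ⟨((τ.std lam).mkQ (τ.std lam).rad).comp
      ((GrMod.tensor 𝒜 lam.rep).mkQ ⟨_, τ.isGraded_standardRel lam.rep⟩),
    (GrMod.mkQ_surjective _ _).comp (GrMod.mkQ_surjective _ _)⟩

theorem exists_isP (lam : τ.Wt) : ∃ P, τ.IsP lam P := by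
  obtain ⟨q, hq⟩ := exists_tensor_simple lam
  exact (GrMod.isProjective_tensor lam.rep).exists_projectiveCover q hq

/-- P(λ) is a direct summand of A ⊗ λ, the source of its numerical freeness and injectivity. -/
theorem IsP.exists_retract {lam : τ.Wt} {P : GrMod 𝒜} (h : τ.IsP lam P) :
    ∃ (s : P.Hom (GrMod.tensor 𝒜 lam.rep)) (r : (GrMod.tensor 𝒜 lam.rep).Hom P),
      ∀ x, r.1 (s.1 x) = x := by
  obtain ⟨hP, f, hf, hc⟩ := h
  obtain ⟨q, hq⟩ := exists_tensor_simple lam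
  obtain ⟨r, hr⟩ := GrMod.isProjective_tensor lam.rep _ _ f q hf
  have hs : Function.Surjective r.1 := by
    have h1 := hc (r.mapSub ⊤) (by
      rw [eq_top_iff]
      intro y _
      obtain ⟨x, rfl⟩ := hq y
      exact ⟨r.1 x, ⟨x, trivial, rfl⟩, hr x⟩)
    rw [GrMod.eq_top_iff_sub] at h1
    intro y
    have : y ∈ (r.mapSub ⊤).1 := by rw [h1]; exact Submodule.mem_top
    obtain ⟨x, -, hx⟩ := this
    exact ⟨x, hx⟩
  obtain ⟨s, hs⟩ := hP.exists_section r hs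
  exact ⟨s, r, hs⟩

theorem IsP.isNegFree (hτ : τ.IsWeaklyTriangular) {lam : τ.Wt} {P : GrMod 𝒜}
    (h : τ.IsP lam P) : τ.IsNegFree P := by
  obtain ⟨s, r, hsr⟩ := h.exists_retract
  exact (hτ.isNegFree_tensor lam.rep).of_retract s r hsr

theorem IsP.isInjective (hA : Module.Injective A A) {lam : τ.Wt} {P : GrMod 𝒜}
    (h : τ.IsP lam P) : P.IsInjective := by
  obtain ⟨s, r, hsr⟩ := h.exists_retract
  exact (GrMod.isInjective_tensor lam.rep hA).of_retract s r hsr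

theorem HasTop.exists_std_injective (hτ : τ.IsWeaklyTriangular) {M : GrMod 𝒜}
    (hM : τ.IsNegFree M) {κ : τ.Wt} (h : τ.HasTop M κ) :
    ∃ g : (τ.std κ).Hom M, Function.Injective g.1 := by
  obtain ⟨hb, f, hf, hr⟩ := h
  obtain ⟨g, hg⟩ := (hτ.std_iso_gen hM hb f hf fun x hx => (hr x).2 hx).symm.exists_hom
  exact ⟨(M.incl _).comp g, (M.incl_injective _).comp hg.1⟩

variable [IsSemisimpleRing τ.T]

theorem IsWeaklyTriangular.simple_injective (hτ : τ.IsWeaklyTriangular) {lam μ : τ.Wt}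
    (h : (τ.simple lam).Iso (τ.simple μ)) : lam = μ :=
  ((hτ.hasTop_simple lam).of_iso h).unique (hτ.hasTop_simple μ)

theorem IsP.isLocal (hτ : τ.IsWeaklyTriangular) {lam : τ.Wt} {P : GrMod 𝒜}
    (h : τ.IsP lam P) : P.IsLocal := GrMod.IsProjectiveCover.isLocal h (hτ.isSimple_simple lam)

theorem IsP.head_iso (hτ : τ.IsWeaklyTriangular) {lam : τ.Wt} {P : GrMod 𝒜}
    (h : τ.IsP lam P) : P.head.Iso (τ.simple lam) := by
  have hl := h.isLocal hτ
  obtain ⟨-, f, hf, -⟩ := h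
  exact hl.head_iso (hτ.isSimple_simple lam) f hf

theorem IsP.unique (hτ : τ.IsWeaklyTriangular) {lam μ : τ.Wt} {P : GrMod 𝒜}
    (h : τ.IsP lam P) (h' : τ.IsP μ P) : lam = μ :=
  hτ.simple_injective ((h.head_iso hτ).symm.trans (h'.head_iso hτ))

theorem IsP.nontrivial (hτ : τ.IsWeaklyTriangular) {lam : τ.Wt} {P : GrMod 𝒜}
    (h : τ.IsP lam P) : Nontrivial P := by
  obtain ⟨-, f, hf, -⟩ := h
  have := (hτ.isSimple_simple lam).1
  exact hf.nontrivial

theorem IsP.shift (hτ : τ.IsWeaklyTriangular) {lam : τ.Wt} {P : GrMod 𝒜}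
    (h : τ.IsP lam P) (n : ℤ) : τ.IsP (Wt.shift lam n) (P.shift n) :=
  (GrMod.IsProjectiveCover.shift h n).of_iso_target
    ((hτ.simple_iso_iff ((hτ.isSimple_simple lam).shift n) _).2 ((hτ.hasTop_simple lam).shift n))

/-- A numerically free uniform module has a simple component of top degree. -/
theorem IsWeaklyTriangular.exists_hasTop (hτ : τ.IsWeaklyTriangular) {M : GrMod 𝒜}
    [Nontrivial M] (hM : τ.IsNegFree M) (hU : M.IsUniform) : ∃ κ, τ.HasTop M κ := by
  obtain ⟨d, hd, htop⟩ := M.exists_top_degree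
  obtain ⟨κ, rfl, f, hf, hfV⟩ := exists_wt_of_ne_bot (d := d) (τ.topT M d) (topT_ne_bot hd)
  refine ⟨κ, htop, f, hf, fun x => ⟨fun hx => ?_, ?_⟩⟩
  swap
  · rintro ⟨z, rfl⟩
    exact hfV z
  by_contra hxf
  -- If `κ` were not the whole top component, a `T`-complement would cut out a second nonzero piece
  -- `V₂` there.
  obtain ⟨W, hW⟩ := exists_isCompl (LinearMap.range f)
  let V₁ := LinearMap.range f
  let V₂ := W ⊓ τ.topT M κ.deg
  have hV₁ : ∀ x ∈ V₁, x ∈ M.gr κ.deg := by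
    rintro _ ⟨z, rfl⟩
    exact hfV z
  have hV₂ : ∀ x ∈ V₂, x ∈ M.gr κ.deg := fun x hx => hx.2
  have hV : ∀ x ∈ V₁ ⊔ V₂, x ∈ M.gr κ.deg := by
    have : V₁ ⊔ V₂ ≤ τ.topT M κ.deg := sup_le hV₁ hV₂
    exact this
  have hne₁ : V₁ ≠ ⊥ := by
    intro h
    obtain ⟨z, hz⟩ := exists_ne_zero κ
    have : f z ∈ V₁ := ⟨z, rfl⟩
    rw [h] at this
    exact hz (hf (((Submodule.mem_bot _).1 this).trans (map_zero f).symm))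
  have hne₂ : V₂ ≠ ⊥ := by
    intro h
    have hx' : x ∈ V₁ ⊔ W := by rw [hW.sup_eq_top]; exact Submodule.mem_top
    obtain ⟨y, hy, z, hz, rfl⟩ := Submodule.mem_sup.1 hx'
    have hz' : z ∈ V₂ := ⟨hz, by
      have := (M.gr κ.deg).sub_mem hx (hV₁ y hy)
      rwa [add_sub_cancel_left] at this⟩
    rw [h] at hz'
    rw [(Submodule.mem_bot _).1 hz', add_zero] at hxf
    exact hxf hy
  refine hU _ _ (gen_ne_bot hV₁ hne₁) (gen_ne_bot hV₂ hne₂) ?_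
  -- Apply the exact dimension formula to `V₁`, `V₂` and `V₁ ⊔ V₂`. It is additive on direct sums,
  -- so the submodules generated by `V₁` and `V₂` meet in zero, against uniformity.
  have e₁ := (hτ.finrank_gen_and_quot hM V₁ hV₁ htop).1
  have e₂ := (hτ.finrank_gen_and_quot hM V₂ hV₂ htop).1
  have e := (hτ.finrank_gen_and_quot hM (V₁ ⊔ V₂) hV htop).1
  have hsum := Submodule.finrank_sup_add_finrank_inf_eq (V₁.restrictScalars K)
    (V₂.restrictScalars K)
  have hdisj : V₁.restrictScalars K ⊓ V₂.restrictScalars K = ⊥ := by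
    rw [eq_bot_iff]
    intro y hy
    have : y ∈ V₁ ⊓ W := ⟨hy.1, hy.2.1⟩
    rw [hW.inf_eq_bot] at this
    exact this
  rw [hdisj, finrank_bot, add_zero] at hsum
  have hsup : (V₁ ⊔ V₂).restrictScalars K = V₁.restrictScalars K ⊔ V₂.restrictScalars K := by
    ext y
    simp only [Submodule.mem_sup, Submodule.restrictScalars_mem]
  rw [hsup, hsum, mul_add, ← e₁, ← e₂] at e
  have hgen : (gen (V₁ ⊔ V₂) hV).1 = (gen V₁ hV₁).1 ⊔ (gen V₂ hV₂).1 := by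
    refine le_antisymm (Submodule.span_le.2 ?_) (sup_le (Submodule.span_mono fun y hy =>
      (le_sup_left : V₁ ≤ V₁ ⊔ V₂) hy) (Submodule.span_mono fun y hy =>
      (le_sup_right : V₂ ≤ V₁ ⊔ V₂) hy))
    rintro y hy
    obtain ⟨y₁, h₁, y₂, h₂, rfl⟩ := Submodule.mem_sup.1 hy
    exact Submodule.add_mem _ (Submodule.mem_sup_left (Submodule.subset_span h₁))
      (Submodule.mem_sup_right (Submodule.subset_span h₂))
  have hsum' := Submodule.finrank_sup_add_finrank_inf_eq ((gen V₁ hV₁).1.restrictScalars K)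
    ((gen V₂ hV₂).1.restrictScalars K)
  have hgen' : (gen V₁ hV₁).1.restrictScalars K ⊔ (gen V₂ hV₂).1.restrictScalars K =
      (gen (V₁ ⊔ V₂) hV).1.restrictScalars K := by
    rw [hgen]
    ext y
    simp only [Submodule.mem_sup, Submodule.restrictScalars_mem]
  rw [hgen'] at hsum'
  have hzero : Module.finrank K ((gen V₁ hV₁).1.restrictScalars K ⊓
      (gen V₂ hV₂).1.restrictScalars K : Submodule K M) = 0 := by
    have e' : Module.finrank K ((gen (V₁ ⊔ V₂) hV).1.restrictScalars K) =
      Module.finrank K ((gen V₁ hV₁).1.restrictScalars K) +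
        Module.finrank K ((gen V₂ hV₂).1.restrictScalars K) := e
    omega
  rw [GrMod.eq_bot_iff_sub, eq_bot_iff]
  intro y hy
  have hy' : y ∈ (gen V₁ hV₁).1.restrictScalars K ⊓ (gen V₂ hV₂).1.restrictScalars K := hy
  rw [Submodule.finrank_eq_zero.1 hzero] at hy'
  exact hy'

theorem IsWeaklyTriangular.nontrivial_std (hτ : τ.IsWeaklyTriangular) (lam : τ.Wt) :
    Nontrivial (τ.std lam) := by
  obtain ⟨x, hx⟩ := exists_ne_zero lam
  exact ⟨wtIncl lam x, 0, fun h => hx (hτ.wtIncl_injective lam (h.trans (map_zero _).symm))⟩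

/-! ### The permutations of the weights -/

variable (τ) in
/-- The indecomposable projective objects are injective. -/
def ProjectivesInjective : Prop := ∀ lam P, τ.IsP lam P → P.IsInjective

theorem IsP.isUniform (hτ : τ.IsWeaklyTriangular) (hI : τ.ProjectivesInjective) {lam : τ.Wt}
    {P : GrMod 𝒜} (h : τ.IsP lam P) : P.IsUniform := (h.isLocal hτ).isUniform (hI lam P h)

theorem exists_simple_injective (hτ : τ.IsWeaklyTriangular) (M : GrMod 𝒜) [Nontrivial M] :
    ∃ (κ : τ.Wt) (f : (τ.simple κ).Hom M), Function.Injective f.1 := by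
  obtain ⟨Y, -, hY⟩ := GrMod.exists_simple_sub_le (⊤ : M.GrSub) fun h => by
    rw [GrMod.eq_bot_iff_sub] at h
    exact bot_ne_top (α := Submodule A M) h.symm
  obtain ⟨κ, -, e⟩ := hτ.exists_simple_iso hY
  obtain ⟨g, hg⟩ := e.symm.exists_hom
  exact ⟨κ, (M.incl Y).comp g, (M.incl_injective Y).comp hg.1⟩

/-- P(λ) is a uniform injective object containing Δ(λ^h), so it is determined by λ^h; this gives
injectivity. Compatibility with shifts gives surjectivity. -/
theorem exists_highestWeightPerm (hτ : τ.IsWeaklyTriangular) (hI : τ.ProjectivesInjective) :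
    ∃ h : Equiv.Perm τ.Wt, ∀ lam P, τ.IsP lam P → τ.HasTop P (h lam) := by
  have hex : ∀ lam : τ.Wt, ∃ κ, ∀ P, τ.IsP lam P → τ.HasTop P κ := by
    intro lam
    obtain ⟨P, hP⟩ := exists_isP lam
    have := hP.nontrivial hτ
    obtain ⟨κ, hκ⟩ := hτ.exists_hasTop (hP.isNegFree hτ) (hP.isUniform hτ hI)
    exact ⟨κ, fun P' hP' => hκ.of_iso (GrMod.IsProjectiveCover.unique hP hP')⟩
  choose h hh using hex
  have hinj : Function.Injective h := by
    intro lam μ hlam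
    obtain ⟨P, hP⟩ := exists_isP lam
    obtain ⟨Q, hQ⟩ := exists_isP μ
    obtain ⟨f, hf⟩ := (hh lam P hP).exists_std_injective hτ (hP.isNegFree hτ)
    obtain ⟨g, hg⟩ := (hlam ▸ hh μ Q hQ).exists_std_injective hτ (hQ.isNegFree hτ)
    have := hτ.nontrivial_std (h lam)
    have e := (hP.isUniform hτ hI).iso_of_common_sub (hQ.isUniform hτ hI) (hI _ _ hP)
      (hI _ _ hQ) f g hf hg
    exact IsP.unique hτ (GrMod.IsProjectiveCover.of_iso hP e) hQ
  refine ⟨Equiv.ofBijective h ⟨hinj, surjective_of_shift hinj fun lam n => ?_⟩, hh⟩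
  obtain ⟨P, hP⟩ := exists_isP lam
  exact (hh _ _ (hP.shift hτ n)).unique ((hh lam P hP).shift n)

theorem exists_nakayamaMap (hτ : τ.IsWeaklyTriangular) :
    ∃ ν : τ.Wt → τ.Wt, ∀ lam P, τ.IsP lam P →
      ∃ f : (τ.simple (ν lam)).Hom P, Function.Injective f.1 := by
  have hex : ∀ lam : τ.Wt, ∃ κ, ∀ P, τ.IsP lam P →
      ∃ f : (τ.simple κ).Hom P, Function.Injective f.1 := by
    intro lam
    obtain ⟨P, hP⟩ := exists_isP lam
    have := hP.nontrivial hτ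
    obtain ⟨κ, f, hf⟩ := exists_simple_injective hτ P
    refine ⟨κ, fun P' hP' => ?_⟩
    obtain ⟨g, hg⟩ := (GrMod.IsProjectiveCover.unique hP hP').exists_hom
    exact ⟨g.comp f, hg.1.comp hf⟩
  choose ν hν using hex
  exact ⟨ν, hν⟩

/-- A uniform injective object is the injective hull of any simple object embedded in it. -/
theorem eq_of_simple_injective (hτ : τ.IsWeaklyTriangular) (hI : τ.ProjectivesInjective)
    {lam μ κ : τ.Wt} {P Q : GrMod 𝒜} (hP : τ.IsP lam P) (hQ : τ.IsP μ Q)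
    (f : (τ.simple κ).Hom P) (hf : Function.Injective f.1) (g : (τ.simple κ).Hom Q)
    (hg : Function.Injective g.1) : lam = μ := by
  have := (hτ.isSimple_simple κ).1
  have e := (hP.isUniform hτ hI).iso_of_common_sub (hQ.isUniform hτ hI) (hI _ _ hP)
    (hI _ _ hQ) f g hf hg
  exact IsP.unique hτ (GrMod.IsProjectiveCover.of_iso hP e) hQ

theorem eq_shift_of_simple_injective (hτ : τ.IsWeaklyTriangular)
    (hI : τ.ProjectivesInjective) {lam κ κ' : τ.Wt} {P : GrMod 𝒜} (hP : τ.IsP lam P) (n : ℤ)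
    (f : (τ.simple κ).Hom P) (hf : Function.Injective f.1) (g : (τ.simple κ').Hom (P.shift n))
    (hg : Function.Injective g.1) : κ' = Wt.shift κ n := by
  have hU := (hP.shift hτ n).isUniform hτ hI
  have e := hU.soc_iso (hτ.isSimple_simple _) g hg
  have e' := hU.soc_iso ((hτ.isSimple_simple _).shift n) (f.shift n)
    (GrMod.Hom.shift_injective hf n)
  exact ((hτ.hasTop_simple _).of_iso (e.symm.trans e')).unique ((hτ.hasTop_simple _).shift n)

theorem exists_nakayamaPerm (hτ : τ.IsWeaklyTriangular) (hI : τ.ProjectivesInjective) :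
    ∃ ν : Equiv.Perm τ.Wt, ∀ lam P, τ.IsP lam P →
      ∃ f : (τ.simple (ν lam)).Hom P, Function.Injective f.1 := by
  obtain ⟨ν, hν⟩ := exists_nakayamaMap hτ
  have hinj : Function.Injective ν := by
    intro lam μ hlam
    obtain ⟨P, hP⟩ := exists_isP lam
    obtain ⟨Q, hQ⟩ := exists_isP μ
    obtain ⟨f, hf⟩ := hν lam P hP
    obtain ⟨g, hg⟩ := hν μ Q hQ
    generalize ν lam = κ at *
    subst hlam
    exact eq_of_simple_injective hτ hI hP hQ f hf g hg
  have hsurj : Function.Surjective ν := by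
    refine surjective_of_shift hinj fun lam n => ?_
    obtain ⟨P, hP⟩ := exists_isP lam
    obtain ⟨f, hf⟩ := hν lam P hP
    obtain ⟨g, hg⟩ := hν _ _ (hP.shift hτ n)
    exact eq_shift_of_simple_injective hτ hI hP n f hf g hg
  exact ⟨Equiv.ofBijective ν ⟨hinj, hsurj⟩, hν⟩

theorem isHighestWeightMap_of_hasTop (hτ : τ.IsWeaklyTriangular) {h : τ.Wt → τ.Wt}
    (hh : ∀ lam P, τ.IsP lam P → τ.HasTop P (h lam)) : τ.IsHighestWeightMap h := by
  intro lam
  refine ⟨exists_isP lam, fun P hP μ => ?_⟩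
  have h1 := (hh lam P hP).hasHighestWeight hτ
  exact ⟨fun h2 => h2.unique h1, fun h2 => h2 ▸ h1⟩

theorem soc_iso_simple_iff (hτ : τ.IsWeaklyTriangular) {M : GrMod 𝒜} (hM : M.IsUniform)
    {κ : τ.Wt} (f : (τ.simple κ).Hom M) (hf : Function.Injective f.1) (μ : τ.Wt) :
    (M.sub M.soc).Iso (τ.simple μ) ↔ μ = κ := by
  have e := hM.soc_iso (hτ.isSimple_simple κ) f hf
  exact ⟨fun e' => hτ.simple_injective (e'.symm.trans e), fun h => h ▸ e⟩

theorem isNakayamaMap_of_injective (hτ : τ.IsWeaklyTriangular) (hI : τ.ProjectivesInjective)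
    {ν : τ.Wt → τ.Wt} (hν : ∀ lam P, τ.IsP lam P →
      ∃ f : (τ.simple (ν lam)).Hom P, Function.Injective f.1) : τ.IsNakayamaMap ν := by
  intro lam P hP μ
  obtain ⟨f, hf⟩ := hν lam P hP
  exact soc_iso_simple_iff hτ (hP.isUniform hτ hI) f hf μ

/-- The socle of the standard object at the top of `P(lam)` is the socle of `P(lam)`. -/
theorem soc_std_iso (hτ : τ.IsWeaklyTriangular) (hI : τ.ProjectivesInjective) {lam κ μ : τ.Wt}
    {P : GrMod 𝒜} (hP : τ.IsP lam P) (f : (τ.simple κ).Hom P) (hf : Function.Injective f.1)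
    (g : (τ.std μ).Hom P) (hg : Function.Injective g.1) :
    ((τ.std μ).sub (τ.std μ).soc).Iso (τ.simple κ) := by
  have hU := hP.isUniform hτ hI
  have := hτ.nontrivial_std μ
  obtain ⟨κ', f', hf'⟩ := exists_simple_injective hτ (τ.std μ)
  -- A simple subobject of Δ(μ) is also one of `P`, hence equals its unique simple subobject L(κ).
  have h1 := (hU.soc_iso (hτ.isSimple_simple _) f hf).symm.trans
    (hU.soc_iso (hτ.isSimple_simple κ') (g.comp f') (hg.comp hf'))
  rw [hτ.simple_injective h1]
  exact (hU.of_injective g hg).soc_iso (hτ.isSimple_simple κ') f' hf'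

end GradedTriple

namespace GrMod

/-! ### Duality between modules over an algebra and over its opposite -/

section OpDual

variable {K A : Type u} [Field K] [Ring A] [Algebra K A] {𝒜 : ℤ → Submodule K A}

theorem unop_mem_of_mem_opGrading (i : ℤ) (a : Aᵐᵒᵖ) (ha : a ∈ opGrading 𝒜 i) :
    ((AlgEquiv.refl : Aᵐᵒᵖ ≃ₐ[K] Aᵐᵒᵖ) a).unop ∈ 𝒜 (-i) := ha

theorem opOp_unop_mem (i : ℤ) (a : A) (ha : a ∈ 𝒜 i) :
    (AlgEquiv.opOp K A a).unop ∈ opGrading 𝒜 (-i) := by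
  change a ∈ 𝒜 (- -i)
  rwa [neg_neg]

/-- The dual of a module, as a module over the opposite algebra. -/
noncomputable abbrev opDual (M : GrMod 𝒜) : GrMod (opGrading 𝒜) :=
  M.dual AlgEquiv.refl unop_mem_of_mem_opGrading

/-- The dual of a module over the opposite algebra. -/
noncomputable abbrev unopDual (N : GrMod (opGrading 𝒜)) : GrMod 𝒜 :=
  N.dual (AlgEquiv.opOp K A) opOp_unop_mem

theorem nontrivial_unopDual (N : GrMod (opGrading 𝒜)) [Nontrivial N] : Nontrivial N.unopDual :=
  inferInstanceAs (Nontrivial (Module.Dual K N))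

theorem exists_surjective_unopDual {M : GrMod 𝒜} {N : GrMod (opGrading 𝒜)}
    (g : N.Hom M.opDual) (hg : Function.Injective g.1) :
    ∃ k : M.Hom N.unopDual, Function.Surjective k.1 := by
  obtain ⟨k, hk⟩ := exists_adj AlgEquiv.refl unop_mem_of_mem_opGrading (AlgEquiv.opOp K A)
    opOp_unop_mem (fun _ => rfl) g
  exact ⟨k, adj_surjective AlgEquiv.refl unop_mem_of_mem_opGrading (AlgEquiv.opOp K A)
    opOp_unop_mem g k hk hg⟩

theorem exists_first_quotient_surjective {M N : GrMod 𝒜} (F : M.Filtration)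
    (e : (F.quotient 0).Iso N) : ∃ g : M.Hom N, Function.Surjective g.1 := by
  obtain ⟨k, hk⟩ := e.exists_hom
  let q := GrMod.mkQ (M.sub (F.step 0)) ((M.incl (F.step 0)).comapSub (F.step (0 + 1)))
  let k' : ((M.sub (F.step 0)).quot ((M.incl (F.step 0)).comapSub (F.step (0 + 1)))).Hom N := k
  have hk' : Function.Surjective k'.1 := hk.2
  let c := (Hom.id M).cod (F.step 0) fun x => by
    rw [F.step_zero]
    exact Submodule.mem_top
  have hc : Function.Surjective c.1 := fun x => ⟨x.1, rfl⟩
  exact ⟨k'.comp (q.comp c), hk'.comp ((mkQ_surjective _ _).comp hc)⟩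

end OpDual

end GrMod

namespace GradedTriple

variable {K A : Type u} [Field K] [Ring A] [Algebra K A] {𝒜 : ℤ → Submodule K A}
  {τ : GradedTriple 𝒜}

/-! ### The opposite triple -/

theorem op_inf_opGrading_zero {S : Subalgebra K A}
    (h : S.toSubmodule ⊓ 𝒜 0 = (⊥ : Subalgebra K A).toSubmodule) :
    S.op.toSubmodule ⊓ opGrading 𝒜 0 = (⊥ : Subalgebra K Aᵐᵒᵖ).toSubmodule := by
  ext x
  have h1 : x.unop ∈ S.toSubmodule ⊓ 𝒜 0 ↔ x.unop ∈ (⊥ : Subalgebra K A).toSubmodule := by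
    rw [h]
  rw [Subalgebra.mem_toSubmodule, Algebra.mem_bot] at h1 ⊢
  refine Iff.trans ?_ (h1.trans ?_)
  · change x.unop ∈ S.toSubmodule ∧ x.unop ∈ 𝒜 (-0) ↔ _
    rw [_root_.neg_zero]
    exact Iff.rfl
  · exact ⟨fun ⟨k, hk⟩ => ⟨k, congrArg MulOpposite.op hk⟩,
      fun ⟨k, hk⟩ => ⟨k, congrArg MulOpposite.unop hk⟩⟩

/-- The multiplication map of the opposite triple is that of the original one after reversing the
order of the tensor factors. -/
theorem IsWeaklyTriangular.op (hτ : τ.IsWeaklyTriangular) : τ.op.IsWeaklyTriangular := by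
  refine ⟨?_, ?_, ?_⟩
  · let E : (τ.op.neg ⊗[K] τ.op.T) ⊗[K] τ.op.pos ≃ₗ[K] (τ.neg ⊗[K] τ.T) ⊗[K] τ.pos :=
      (TensorProduct.congr (TensorProduct.congr τ.pos.linearEquivOp.symm
        τ.T.linearEquivOp.symm) τ.neg.linearEquivOp.symm).trans
      ((TensorProduct.comm K _ _).trans
      ((TensorProduct.congr (LinearEquiv.refl K _) (TensorProduct.comm K _ _)).trans
        (TensorProduct.assoc K _ _ _).symm))
    have h : τ.op.mulMap = (MulOpposite.opLinearEquiv K).toLinearMap ∘ₗ τ.mulMap ∘ₗ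
        E.toLinearMap := by
      refine TensorProduct.ext_threefold fun p t n => ?_
      apply MulOpposite.unop_injective
      exact (mul_assoc n.1.unop t.1.unop p.1.unop).symm
    rw [h]
    exact (MulOpposite.opLinearEquiv K).bijective.comp (hτ.mul_bijective.comp E.bijective)
  · exact op_inf_opGrading_zero hτ.pos_zero
  · exact op_inf_opGrading_zero hτ.neg_zero

theorem isSemisimpleRing_op_T [IsSemisimpleRing τ.T] : IsSemisimpleRing τ.op.T :=
  τ.opTEquiv.symm.toRingEquiv.isSemisimpleRing

variable (τ) in
/-- The identification of `T` with the opposite of the algebra `T` of the opposite triple. -/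
def TEquivOp : τ.T ≃ₐ[K] (τ.op.T)ᵐᵒᵖ where
  toFun t := MulOpposite.op ⟨MulOpposite.op t.1, t.2⟩
  invFun t := ⟨t.unop.1.unop, t.unop.2⟩
  left_inv _ := rfl
  right_inv _ := rfl
  map_mul' _ _ := rfl
  map_add' _ _ := rfl
  commutes' _ := rfl

theorem TEquivOp_mem (i : ℤ) (t : τ.T) (ht : t ∈ τ.grT i) :
    (τ.TEquivOp t).unop ∈ τ.op.grT (-i) := by
  change t.1 ∈ 𝒜 (- -i)
  rw [neg_neg]
  exact ht

theorem star_rep_iso (lam : τ.Wt) : (τ.star lam).rep.Iso (τ.dualT lam.rep) :=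
  GrMod.Irr.rep_mk_iso ⟨τ.dualT lam.rep, lam.rep_isSimple.dual τ.opTEquiv fun _ _ ha => ha⟩

theorem star_surjective (τ : GradedTriple 𝒜) : Function.Surjective τ.star := by
  intro κ
  let M : GrMod τ.grT := κ.rep.dual τ.TEquivOp TEquivOp_mem
  have hM : M.IsSimple := κ.rep_isSimple.dual τ.TEquivOp TEquivOp_mem
  obtain ⟨lam, hlam⟩ : ∃ lam : τ.Wt, lam.rep.Iso M := ⟨_, GrMod.Irr.rep_mk_iso ⟨M, hM⟩⟩
  refine ⟨lam, GrMod.Irr.eq_of_rep_iso ((star_rep_iso lam).trans ?_)⟩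
  exact (hlam.dual τ.opTEquiv fun _ _ ha => ha).trans
    (GrMod.bidual_iso τ.opTEquiv (fun _ _ ha => ha) τ.TEquivOp TEquivOp_mem
      (fun _ => rfl) κ.rep).symm

theorem deg_eq_of_mem_gr {lam : τ.Wt} {d : ℤ} {x : lam.rep} (hx : x ≠ 0)
    (hd : x ∈ lam.rep.gr d) : lam.deg = d := by
  by_contra h
  exact hx (eq_zero_of_mem_gr lam (Ne.symm h) hd)

theorem gr_dualT_deg (lam : τ.Wt) : (τ.dualT lam.rep).gr lam.deg = ⊤ := by
  rw [eq_top_iff]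
  intro f _ j hj x hx
  rw [eq_zero_of_mem_gr lam hj hx]
  exact map_zero (GrMod.dualEquiv τ.opTEquiv (fun _ _ ha => ha) lam.rep f)

/-- No sign appears: the reversal of degrees is built into the grading of the opposite algebra, and
(M*)ᵢ is dual to Mᵢ. -/
theorem deg_star (lam : τ.Wt) : (τ.star lam).deg = lam.deg := by
  obtain ⟨e, he⟩ := star_rep_iso lam
  obtain ⟨x, hx⟩ := exists_ne_zero (τ.star lam)
  refine deg_eq_of_mem_gr hx ((he _ x).2 ?_)
  rw [gr_dualT_deg]
  exact Submodule.mem_top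

/-- The projection of `M` onto its top component is `T`-linear, as `T` has degree zero; its
transpose embeds κ* as the component of `M*` in the same degree. -/
theorem HasTop.opDual {M : GrMod 𝒜} {κ : τ.Wt} (h : τ.HasTop M κ) :
    τ.op.HasTop M.opDual (τ.star κ) := by
  obtain ⟨hb, f, hf, hr⟩ := h
  obtain ⟨ρ, hρ⟩ : ∃ ρ : M →ₗ[τ.T] κ.rep, ∀ x, f (ρ x) = M.proj κ.deg x := by
    let p : M →ₗ[τ.T] M :=
      { toFun := M.proj κ.deg
        map_add' := map_add _
        map_smul' := fun t x => by
          have := M.proj_smul 0 κ.deg t (τ.T_le t.2) x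
          rwa [sub_zero] at this }
    refine ⟨(LinearEquiv.ofInjective f hf).symm.toLinearMap ∘ₗ
      p.codRestrict (LinearMap.range f) fun x => (hr _).1 (M.proj_mem _ x), fun x => ?_⟩
    exact congrArg Subtype.val ((LinearEquiv.ofInjective f hf).apply_symm_apply _)
  have hρf : ∀ z, ρ (f z) = z := by
    intro z
    apply hf
    rw [hρ]
    exact M.proj_self _ _ ((hr _).2 ⟨z, rfl⟩)
  obtain ⟨e, -⟩ := star_rep_iso κ
  let r : τ.dualT κ.rep →ₗ[τ.op.T] M.opDual :=
    { toFun := fun ξ => (GrMod.dualEquiv AlgEquiv.refl GrMod.unop_mem_of_mem_opGrading M).symm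
        (GrMod.dualEquiv τ.opTEquiv (fun _ _ ha => ha) κ.rep ξ ∘ₗ ρ.restrictScalars K)
      map_add' := fun _ _ => rfl
      map_smul' := fun t ξ => by
        apply GrMod.dual_ext
        intro x
        change GrMod.dualEquiv τ.opTEquiv (fun _ _ ha => ha) κ.rep ξ
          ((τ.opTEquiv t).unop • ρ x) = GrMod.dualEquiv τ.opTEquiv (fun _ _ ha => ha) κ.rep ξ
            (ρ ((τ.opTEquiv t).unop • x))
        rw [ρ.map_smul] }
  have hr' : ∀ ξ x, GrMod.dualEquiv AlgEquiv.refl GrMod.unop_mem_of_mem_opGrading M (r ξ) x =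
    GrMod.dualEquiv τ.opTEquiv (fun _ _ ha => ha) κ.rep ξ (ρ x) := fun _ _ => rfl
  refine ⟨fun j hj => ?_, r ∘ₗ e.toLinearMap, fun ξ' η' hξ' => ?_, fun η => ⟨fun hη => ?_, ?_⟩⟩
  · rw [deg_star] at hj
    rw [eq_bot_iff]
    intro η hη
    refine (Submodule.mem_bot K).2 (GrMod.dual_ext _ _ fun x => ?_)
    rw [← (M.opDual).proj_self j η hη, GrMod.dual_proj_apply]
    have : M.proj j x = 0 := by
      have := M.proj_mem j x
      rwa [hb j hj, Submodule.mem_bot] at this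
    rw [this, map_zero, map_zero]
    rfl
  · have hξ : r (e ξ') = r (e η') := hξ'
    refine e.injective (GrMod.dual_ext τ.opTEquiv (fun _ _ ha => ha) fun z => ?_)
    rw [← hρf z, ← hr', ← hr', hξ]
  · rw [deg_star] at hη
    let ξ : τ.dualT κ.rep := (GrMod.dualEquiv τ.opTEquiv (fun _ _ ha => ha) κ.rep).symm
      (GrMod.dualEquiv AlgEquiv.refl GrMod.unop_mem_of_mem_opGrading M η ∘ₗ f.restrictScalars K)
    refine ⟨e.symm ξ, ?_⟩
    change r (e (e.symm ξ)) = η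
    rw [e.apply_symm_apply]
    apply GrMod.dual_ext
    intro x
    rw [hr']
    change GrMod.dualEquiv AlgEquiv.refl GrMod.unop_mem_of_mem_opGrading M η (f (ρ x)) = _
    rw [hρ, ← GrMod.dual_proj_apply, (M.opDual).proj_self _ η hη]
  · rintro ⟨z, rfl⟩
    rw [deg_star]
    intro j hj x hx
    change GrMod.dualEquiv τ.opTEquiv (fun _ _ ha => ha) κ.rep (e z) (ρ x) = 0
    have : ρ x = 0 := hf (by rw [hρ, M.proj_ne _ _ hj x hx, map_zero])
    rw [this, map_zero]

/-! ### Costandard objects and duals of projectives. -/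

variable [GradedAlgebra 𝒜] [FiniteDimensional K A]

theorem exists_stdFunctor_map {M N : GrMod τ.grT} (f : M.Hom N) :
    ∃ g : (τ.stdFunctor M).Hom (τ.stdFunctor N), ∀ x, g.1 (τ.stdIncl M x) =
      τ.stdIncl N (f.1 x) := by
  obtain ⟨g0, hg0⟩ := GrMod.exists_tensor_hom M (τ.stdFunctor N)
    ((τ.stdIncl N ∘ₗ f.1).restrictScalars K) fun i x hx => stdIncl_mem_gr N (f.2 i x hx)
  have hker : Submodule.span A (τ.standardRel M) ≤ LinearMap.ker g0.1 := by
    rw [Submodule.span_le]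
    rintro _ (⟨t, m, rfl⟩ | ⟨i, b, m, hi, hb, hbi, rfl⟩)
    · change g0.1 _ = 0
      rw [map_sub, hg0, hg0, one_smul, sub_eq_zero]
      exact ((τ.stdIncl N ∘ₗ f.1).map_smul t m).symm
    · change g0.1 _ = 0
      rw [hg0]
      refine (smul_stdIncl N b (f.1 m)).trans ?_
      exact (GrMod.mkQ_eq_zero _ _ _).2 (Submodule.subset_span (Or.inr ⟨i, b, _, hi, hb, hbi, rfl⟩))
  obtain ⟨g, hg⟩ := (GrMod.mkQ (GrMod.tensor 𝒜 M) ⟨_, τ.isGraded_standardRel M⟩).exists_desc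
    (GrMod.mkQ_surjective _ _) g0 fun x hx => hker ((GrMod.mkQ_eq_zero _ _ x).1 hx)
  refine ⟨g, fun x => ?_⟩
  have : g.1 (τ.stdIncl M x) = g0.1 (GrMod.tmk 𝒜 M 1 x) := hg _
  exact this.trans ((hg0 1 x).trans (one_smul A _))

theorem stdFunctor_iso {M N : GrMod τ.grT} (e : M.Iso N) :
    (τ.stdFunctor M).Iso (τ.stdFunctor N) := by
  obtain ⟨s, r, hrs, hsr⟩ := e.exists_inverse
  obtain ⟨g, hg⟩ := exists_stdFunctor_map r
  obtain ⟨k, hk⟩ := exists_stdFunctor_map s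
  have key : ∀ {M : GrMod τ.grT} (c : (τ.stdFunctor M).Hom (τ.stdFunctor M)),
      (∀ x, c.1 (τ.stdIncl M x) = τ.stdIncl M x) → ∀ y, c.1 y = y := by
    intro M c hc y
    have hle : Submodule.span A (LinearMap.range (τ.stdIncl M) : Set (τ.stdFunctor M)) ≤
        LinearMap.eqLocus c.1 LinearMap.id := by
      rw [Submodule.span_le]
      rintro _ ⟨x, rfl⟩
      exact hc x
    rw [span_range_stdIncl] at hle
    exact hle Submodule.mem_top
  have h1 := key (k.comp g) fun x => (congrArg k.1 (hg x)).trans ((hk _).trans (by rw [hsr]))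
  have h2 := key (g.comp k) fun x => (congrArg g.1 (hk x)).trans ((hg _).trans (by rw [hrs]))
  exact g.iso_of_bijective ⟨Function.LeftInverse.injective h1,
    Function.RightInverse.surjective h2⟩

/-- ∇(λ) is built from the dual of a representative of λ, whereas `star` passes to a chosen
representative of the dual class; functoriality of Δ bridges the two. -/
theorem costd_iso (lam : τ.Wt) : (τ.costd lam).Iso (τ.op.std (τ.star lam)).unopDual :=
  GrMod.Iso.dual (AlgEquiv.opOp K A) GrMod.opOp_unop_mem
    (stdFunctor_iso (star_rep_iso lam).symm)

/-- The top component κ* of `M*` generates Δ(κ*) there; dualizing this embedding gives the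
epimorphism. -/
theorem exists_surjective_costd (hτ : τ.IsWeaklyTriangular) {M : GrMod 𝒜} {κ : τ.Wt}
    (hM : τ.HasTop M κ) (hD : τ.op.IsNegFree M.opDual) :
    ∃ g : M.Hom (τ.costd κ), Function.Surjective g.1 := by
  obtain ⟨g, hg⟩ := hM.opDual.exists_std_injective hτ.op hD
  obtain ⟨k, hk⟩ := GrMod.exists_surjective_unopDual g hg
  obtain ⟨e, he⟩ := (costd_iso κ).symm.exists_hom
  exact ⟨e.comp k, he.2.comp hk⟩

variable [IsSemisimpleRing τ.T]

theorem opDual_simple_iso (hτ : τ.IsWeaklyTriangular) (lam : τ.Wt) :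
    (τ.simple lam).opDual.Iso (τ.op.simple (τ.star lam)) := by
  have := isSemisimpleRing_op_T (τ := τ)
  exact (hτ.op.simple_iso_iff ((hτ.isSimple_simple lam).dual _ _) _).2
    (hτ.hasTop_simple lam).opDual

/-- `P` is the injective hull of L(κ), so its dual is the projective cover of L(κ)* = L(κ*). -/
theorem IsP.opDual (hτ : τ.IsWeaklyTriangular) (hI : τ.ProjectivesInjective) {lam κ : τ.Wt}
    {P : GrMod 𝒜} (hP : τ.IsP lam P) (f : (τ.simple κ).Hom P) (hf : Function.Injective f.1) :
    τ.op.IsP (τ.star κ) P.opDual :=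
  GrMod.IsProjectiveCover.of_iso_target
    (GrMod.isProjectiveCover_dual AlgEquiv.refl GrMod.unop_mem_of_mem_opGrading
      (AlgEquiv.opOp K A) GrMod.opOp_unop_mem (fun _ => rfl) (fun _ => rfl) (hI _ _ hP)
      (hP.isUniform hτ hI) (hτ.isSimple_simple κ).1 f hf)
    (opDual_simple_iso hτ κ)

/-- Since ν and duality are onto, every indecomposable projective over Aᵒᵖ is the dual of some P(λ),
hence injective because P(λ) is projective. Self-injectivity of Aᵒᵖ is thus not needed as an input.
-/
theorem ProjectivesInjective.op (hτ : τ.IsWeaklyTriangular) (hI : τ.ProjectivesInjective) :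
    τ.op.ProjectivesInjective := by
  intro κ Q hQ
  obtain ⟨ν, hν⟩ := exists_nakayamaPerm hτ hI
  obtain ⟨μ, rfl⟩ := star_surjective τ κ
  obtain ⟨lam, rfl⟩ := ν.surjective μ
  obtain ⟨P, hP⟩ := exists_isP lam
  obtain ⟨f, hf⟩ := hν lam P hP
  have e := GrMod.IsProjectiveCover.unique (hP.opDual hτ hI f hf) hQ
  exact (GrMod.IsProjective.dual AlgEquiv.refl GrMod.unop_mem_of_mem_opGrading
      (AlgEquiv.opOp K A) GrMod.opOp_unop_mem (fun _ => rfl) (fun _ => rfl) hP.1).of_iso e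

theorem IsP.head_iso_of_surjective (hτ : τ.IsWeaklyTriangular) {lam : τ.Wt} {P N : GrMod 𝒜}
    [Nontrivial N] (hP : τ.IsP lam P) (f : P.Hom N) (hf : Function.Surjective f.1) :
    N.head.Iso (τ.simple lam) := by
  have hN := (hP.isLocal hτ).of_surjective f hf
  have h1 := (hP.isLocal hτ).head_iso hN.isSimple_head ((N.mkQ N.rad).comp f)
    ((GrMod.mkQ_surjective _ _).comp hf)
  exact h1.symm.trans (hP.head_iso hτ)

theorem nontrivial_costd (hτ : τ.IsWeaklyTriangular) (lam : τ.Wt) : Nontrivial (τ.costd lam) := by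
  have := isSemisimpleRing_op_T (τ := τ)
  have := hτ.op.nontrivial_std (τ.star lam)
  have := GrMod.nontrivial_unopDual (τ.op.std (τ.star lam))
  obtain ⟨g, hg⟩ := (costd_iso lam).symm.exists_hom
  exact hg.1.nontrivial

/-- Dualize a standard filtration of `M*`. -/
theorem exists_costandardFiltration (hτ : τ.IsWeaklyTriangular) {M : GrMod 𝒜}
    (hD : τ.op.IsNegFree M.opDual) : ∃ F : M.Filtration, τ.IsCostandardFiltration F := by
  have := isSemisimpleRing_op_T (τ := τ)
  obtain ⟨F, hF⟩ := hτ.op.exists_standardFiltration hD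
  obtain ⟨F', hlen, hF'⟩ := GrMod.exists_filtration_of_dual AlgEquiv.refl
    GrMod.unop_mem_of_mem_opGrading (AlgEquiv.opOp K A) GrMod.opOp_unop_mem (fun _ => rfl) F
  refine ⟨F', fun i hi => ?_⟩
  rw [hlen] at hi
  obtain ⟨κ, hκ⟩ := hF (F.length - 1 - i) (by omega)
  obtain ⟨μ, rfl⟩ := star_surjective τ κ
  exact ⟨μ, (hF' i hi).trans ((hκ.dual (AlgEquiv.opOp K A) GrMod.opOp_unop_mem).trans
    (costd_iso μ).symm)⟩

end GradedTriple

/-! ### The main theorem. -/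

theorem mainTheorem4 {K A : Type u} [Field K] [Ring A] [Algebra K A] [FiniteDimensional K A]
    (𝒜 : ℤ → Submodule K A) [GradedAlgebra 𝒜]
    (τ : GradedTriple 𝒜) (hτ : τ.IsTriangularDecomposition)
    (hT : IsSemisimpleRing τ.T) (hA : Module.Injective A A) :
    ∃ (h ν dag : Equiv.Perm τ.Wt) (hop : Equiv.Perm τ.op.Wt),
      τ.IsHighestWeightMap h ∧
      τ.IsNakayamaMap ν ∧
      τ.op.IsHighestWeightMap hop ∧
      (∀ lam, dag lam = ν (h.symm lam)) ∧
      (∀ lam, ((τ.std lam).sub (τ.std lam).soc).Iso (τ.simple (dag lam))) ∧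
      (∀ lam P, τ.IsP lam P →
        (∃ F : P.Filtration, τ.IsStandardFiltration F) ∧
        ∀ F : P.Filtration, τ.IsStandardFiltration F →
          0 < F.length ∧ (F.quotient (F.length - 1)).Iso (τ.std (h lam))) ∧
      (∀ lam, τ.star (h lam) = hop (τ.star (ν lam))) ∧
      (∀ lam P, τ.IsP lam P →
        (∃ F : P.Filtration, τ.IsCostandardFiltration F) ∧
        ∀ F : P.Filtration, τ.IsCostandardFiltration F →
          0 < F.length ∧ (F.quotient 0).Iso (τ.costd (h lam))) ∧
      (∀ lam, (τ.costd lam).head.Iso (τ.simple (ν.symm (dag lam))) ∧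
        ν.symm (dag lam) = h.symm lam) := by
  have hw := hτ.isWeaklyTriangular
  have hI : τ.ProjectivesInjective := fun lam P hP => hP.isInjective hA
  have hTop := GradedTriple.isSemisimpleRing_op_T (τ := τ)
  have hIop := hI.op hw
  obtain ⟨h, hh⟩ := GradedTriple.exists_highestWeightPerm hw hI
  obtain ⟨ν, hν⟩ := GradedTriple.exists_nakayamaPerm hw hI
  obtain ⟨hop, hhop⟩ := GradedTriple.exists_highestWeightPerm hw.op hIop
  have hsoc : ∀ lam P, τ.IsP lam P → ∀ μ (g : (τ.std μ).Hom P), Function.Injective g.1 →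
      ((τ.std μ).sub (τ.std μ).soc).Iso (τ.simple (ν lam)) := by
    intro lam P hP μ g hg
    obtain ⟨f, hf⟩ := hν lam P hP
    exact GradedTriple.soc_std_iso hw hI hP f hf g hg
  have hsocStd : ∀ lam,
      ((τ.std lam).sub (τ.std lam).soc).Iso (τ.simple (ν (h.symm lam))) := by
    intro lam
    obtain ⟨P, hP⟩ := GradedTriple.exists_isP (h.symm lam)
    have htop := hh _ P hP
    rw [h.apply_symm_apply] at htop
    obtain ⟨g, hg⟩ := htop.exists_std_injective hw (hP.isNegFree hw)
    exact hsoc _ P hP lam g hg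
  have hdual : ∀ lam P, τ.IsP lam P → τ.op.IsP (τ.star (ν lam)) P.opDual := by
    intro lam P hP
    obtain ⟨f, hf⟩ := hν lam P hP
    exact hP.opDual hw hI f hf
  have hhead : ∀ lam, (τ.costd lam).head.Iso (τ.simple (h.symm lam)) := by
    intro lam
    obtain ⟨P, hP⟩ := GradedTriple.exists_isP (h.symm lam)
    have htop := hh _ P hP
    rw [h.apply_symm_apply] at htop
    -- P* is an indecomposable projective over Aᵒᵖ, so it is numerically free for the opposite
    -- triple and P maps onto ∇(λ). A nonzero quotient of `P` has the head of `P`.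
    obtain ⟨g, hg⟩ := GradedTriple.exists_surjective_costd hw htop ((hdual _ P hP).isNegFree hw.op)
    have := GradedTriple.nontrivial_costd hw lam
    exact hP.head_iso_of_surjective hw g hg
  refine ⟨h, ν, h.symm.trans ν, hop, GradedTriple.isHighestWeightMap_of_hasTop hw hh,
    GradedTriple.isNakayamaMap_of_injective hw hI hν, GradedTriple.isHighestWeightMap_of_hasTop hw.op hhop,
    fun lam => rfl, hsocStd, ?_, ?_, ?_, ?_⟩
  · intro lam P hP
    refine ⟨hw.exists_standardFiltration (hP.isNegFree hw), fun F hF => ?_⟩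
    have := hP.nontrivial hw
    have hlen := F.length_pos
    refine ⟨hlen, ?_⟩
    obtain ⟨μ, hμ⟩ := hF (F.length - 1) (by omega)
    obtain ⟨g, hg⟩ := F.exists_last_quotient_injective hlen hμ
    -- The bottom factor Δ(μ) has socle L(ν(h⁻¹ μ)), and as a subobject of P(λ) it has socle
    -- L(ν(λ)); hence μ = h(λ).
    have h1 := hw.simple_injective ((hsocStd μ).symm.trans (hsoc lam P hP μ g hg))
    rwa [← ν.injective h1, h.apply_symm_apply]
  · intro lam
    obtain ⟨P, hP⟩ := GradedTriple.exists_isP lam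
    -- Both sides are the top component of P*, computed once as the dual of P(λ) and once as the
    -- projective cover of L(ν(λ)*).
    exact (hh lam P hP).opDual.unique (hhop _ _ (hdual lam P hP))
  · intro lam P hP
    refine ⟨GradedTriple.exists_costandardFiltration hw ((hdual lam P hP).isNegFree hw.op), fun F hF => ?_⟩
    have := hP.nontrivial hw
    have hlen := F.length_pos
    refine ⟨hlen, ?_⟩
    obtain ⟨μ, hμ⟩ := hF 0 hlen
    obtain ⟨g, hg⟩ := GrMod.exists_first_quotient_surjective F hμ
    have := GradedTriple.nontrivial_costd hw μ
    -- The top factor ∇(μ) has head L(h⁻¹ μ), and as a quotient of P(λ) it has head L(λ).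
    have h1 := hw.simple_injective ((hhead μ).symm.trans (hP.head_iso_of_surjective hw g hg))
    rwa [← h1, h.apply_symm_apply]
  · intro lam
    have h1 : ν.symm ((h.symm.trans ν) lam) = h.symm lam := ν.symm_apply_apply _
    rw [h1]
    exact ⟨hhead lam, rfl⟩
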